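/- **Theorem 1.5.** All operads are nonsymmetric and unital, with operations in $\mathbb{Z}$-graded abelian groups; a dg operad carries in addition a differential $d$ of degree $-1$ with $d^2=0$ and $d(x\circ_i y)=dx\circ_i y+(-1)^{|x|}x\circ_i dy$. For a symbol $\kappa$ of arity $0$ and degree $-1$, $[\kappa]$ is the operad freely generated by $\kappa$, $\vee$ is the coproduct of graded operads, and an operad $\mathrm{Q}_0\vee[\kappa]$ is weight graded by the number of $\kappa$. Let $\operatorname{Curv}$ be the category of quadruples $(\mathrm{Q},d_{\mathrm{Q}},\kappa,\mathrm{Q}_0)$, where $(\mathrm{Q},d_{\mathrm{Q}})$ is a dg operad, $\mathrm{Q}_0\subset\mathrm{Q}$ is a graded (not necessarily $d_{\mathrm Q}$-stable) sub-operad and $\kappa\in\mathrm{Q}(0)$ has degree $-1$, with $\kappa\notin\mathrm{Q}_0$ unless $\mathrm{Q}=0$, such that (1) the natural morphism $\mathrm{Q}_0\vee[\kappa]\to\mathrm{Q}$ is an isomorphism; (2) for the resulting weight grading $\mathrm{Q}=\bigoplus_j\mathrm{Q}_j$ one has $d_{\mathrm{Q}}=d_0+d_1$ with $d_i(\mathrm{Q}_j)\subset\mathrm{Q}_{i+j}$;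 (3) $d_1\kappa=0$. Morphisms are morphisms of dg operads that preserve $\kappa$ and map $\mathrm{Q}_0$ into $\mathrm{Q}_0$. Let $\mathrm{cA}_\infty$ be the free operad on operations $\mu_n$, $n\ge0$, of arity $n$ and degree $-1$, with the differential $d\mu_n=-\sum_{p+q+r=n}\mu_{p+1+r}\circ_{p+1}\mu_q$. Let $\mathrm{T}$ be the dg operad freely generated by the arity $0$ operations $\alpha$ of degree $0$ and $\kappa$ of degree $-1$, with $d_{\mathrm{T}}\alpha=\kappa$. For a dg operad $\mathrm{P}$, let $\mathrm{P}\,\hat\vee\,\mathrm{T}$ be the coproduct completed, in each degree, arity and $\kappa$-weight, with respect to the number of $\alpha$ (so it is the direct sum over the number of $\kappa$ of the products over the number of $\alpha$), with the differential $d_{\mathrm{P}}+d_{\mathrm{T}}$, and let $\mathrm{P}\,\hat\vee\,[\alpha]$ be its $\kappa$-weight zero part. Then $(\mathrm{cA}_\infty,d,\mu_0,\langle\mu_i\rangle_{i>0})$ is an object of $\operatorname{Curv}$, and it is initial. Hence there is a forgetful functor $\mathcal{L}:\operatorname{Curv}\to(\mathrm{cA}_\infty\downarrow\text{dg-Op})$,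 which sends $(\mathrm{Q},d_{\mathrm{Q}},\kappa,\mathrm{Q}_0)$ to $(\mathrm{Q},d_{\mathrm{Q}})$ with the unique morphism from the initial object. For every dg operad $\mathrm{P}$ under $\mathrm{cA}_\infty$, the quadruple $$\mathcal{R}(\mathrm{P})=\Big(\mathrm{P}\,\hat\vee\,\mathrm{T},\ d_{\mathrm{P}}+d_{\mathrm{T}},\ \kappa+\sum_{k\ge0}\mu_k(\alpha,\dots,\alpha),\ \mathrm{P}\,\hat\vee\,[\alpha]\Big)$$ is an object of $\operatorname{Curv}$, and the functor $\mathcal{R}$ given by this on objects and by $f\mapsto f\vee 1_{\mathrm{T}}$ on morphisms is right adjoint to $\mathcal{L}$, with counit $\epsilon:\mathcal{L}\mathcal{R}\to1$ given by the morphisms $1_{\mathrm{P}}\vee0:\mathrm{P}\,\hat\vee\,\mathrm{T}\to\mathrm{P}$, which send $\alpha$ and $\kappa$ to $0$. -/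

import Mathlib

open CategoryTheory

universe u

namespace CurvedOperad

/-- The Koszul sign `(-1)^e`. -/
def sgn (e : ℤ) : ℤ := if Even e then 1 else -1

theorem sgn_add (a b : ℤ) : sgn (a + b) = sgn a * sgn b := by
  unfold sgn
  by_cases ha : Even a <;> by_cases hb : Even b <;> simp [Int.even_add, ha, hb]

theorem sgn_mul_self (a : ℤ) : sgn a * sgn a = 1 := by
  unfold sgn
  split_ifs <;> simp

theorem sgn_congr {a b : ℤ} (h : Even (a - b)) : sgn a = sgn b := by
  unfold sgn
  rw [Int.even_sub] at h
  simp [h]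

theorem sgn_succ (a : ℤ) : sgn (a + 1) = -sgn a := by
  rw [sgn_add]
  simp [sgn]

/-- A (unital) nonsymmetric operad in `ℤ`-graded abelian groups, presented by partial
compositions.  `obj n p` is the group of operations of arity `n` and degree `p`, and
`circ i x y` is the result of inserting `y` into the input of `x` which has exactly `i` inputs on
its left, i.e. `x ∘_{i+1} y` in the usual notation.  The indices of the target are variables
constrained by equations, so that the axioms can be stated without transporting elements along
equalities of indices. -/
structure GrOperad : Type (u + 1) where
  obj : ℕ → ℤ → Type u
  [grp : ∀ n p, AddCommGroup (obj n p)]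
  one : obj 1 0
  circ : ∀ {m n k : ℕ} {p q r : ℤ} (i : ℕ) (_ : i < m) (_ : k + 1 = m + n) (_ : p + q = r),
    obj m p →+ obj n q →+ obj k r
  one_circ : ∀ {n : ℕ} {p : ℤ} (h₀ : 0 < 1) (hk : n + 1 = 1 + n) (hr : 0 + p = p) (x : obj n p),
    circ 0 h₀ hk hr one x = x
  circ_one : ∀ {n : ℕ} {p : ℤ} (i : ℕ) (hi : i < n) (hk : n + 1 = n + 1) (hr : p + 0 = p)
    (x : obj n p), circ i hi hk hr x one = x
  circ_seq : ∀ {m n l a b t : ℕ} {p q r pq qr s : ℤ} (i j : ℕ) (hi : i < m) (hj : j < n)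
    (ha : a + 1 = m + n) (hpq : p + q = pq) (hij : i + j < a) (ht : t + 1 = a + l)
    (hs : pq + r = s) (hb : b + 1 = n + l) (hqr : q + r = qr) (ht' : t + 1 = m + b)
    (hs' : p + qr = s) (x : obj m p) (y : obj n q) (z : obj l r),
    circ (i + j) hij ht hs (circ i hi ha hpq x y) z =
      circ i hi ht' hs' x (circ j hj hb hqr y z)
  circ_par : ∀ {m n l a b t : ℕ} {p q r pq pr s : ℤ} (i k k' : ℕ) (_ : i < k) (hi : i < m)
    (hk : k < m) (ha : a + 1 = m + n) (hpq : p + q = pq) (_ : k' + 1 = k + n) (hk' : k' < a)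
    (ht : t + 1 = a + l) (hs : pq + r = s) (hb : b + 1 = m + l) (hpr : p + r = pr) (hib : i < b)
    (ht' : t + 1 = b + n) (hs' : pr + q = s) (x : obj m p) (y : obj n q) (z : obj l r),
    circ k' hk' ht hs (circ i hi ha hpq x y) z =
      sgn (q * r) • circ i hib ht' hs' (circ k hk hb hpr x z) y

attribute [instance] GrOperad.grp

/-- A morphism of graded nonsymmetric operads. -/
@[ext] structure GrOperad.Hom (P Q : GrOperad.{u}) where
  map : ∀ n p, P.obj n p →+ Q.obj n p
  map_one : map 1 0 P.one = Q.one
  map_circ : ∀ {m n k : ℕ} {p q r : ℤ} (i : ℕ) (hi : i < m) (hk : k + 1 = m + n)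
    (hr : p + q = r) (x : P.obj m p) (y : P.obj n q),
    map k r (P.circ i hi hk hr x y) = Q.circ i hi hk hr (map m p x) (map n q y)

/-- A sub-operad of a graded operad. -/
structure SubOperad (P : GrOperad.{u}) where
  carrier : ∀ n p, AddSubgroup (P.obj n p)
  one_mem : P.one ∈ carrier 1 0
  circ_mem : ∀ {m n k : ℕ} {p q r : ℤ} (i : ℕ) (hi : i < m) (hk : k + 1 = m + n)
    (hr : p + q = r) (x : P.obj m p) (y : P.obj n q), x ∈ carrier m p → y ∈ carrier n q →
    P.circ i hi hk hr x y ∈ carrier k r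

/-- A sub-operad, as an operad. -/
def SubOperad.toGrOperad {P : GrOperad.{u}} (S : SubOperad P) : GrOperad.{u} where
  obj n p := S.carrier n p
  one := ⟨P.one, S.one_mem⟩
  circ i hi hk hr :=
    AddMonoidHom.mk' (fun x => AddMonoidHom.mk'
      (fun y => ⟨P.circ i hi hk hr x.1 y.1, S.circ_mem i hi hk hr x.1 y.1 x.2 y.2⟩)
      (fun y y' => Subtype.ext (by simp)))
      (fun x x' => by ext y; simp)
  one_circ h₀ hk hr x := Subtype.ext (P.one_circ h₀ hk hr x.1)
  circ_one i hi hk hr x := Subtype.ext (P.circ_one i hi hk hr x.1)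
  circ_seq i j hi hj ha hpq hij ht hs hb hqr ht' hs' x y z :=
    Subtype.ext (P.circ_seq i j hi hj ha hpq hij ht hs hb hqr ht' hs' x.1 y.1 z.1)
  circ_par i k k' hik hi hk ha hpq hkk hk' ht hs hb hpr hib ht' hs' x y z :=
    Subtype.ext (by
      simpa using P.circ_par i k k' hik hi hk ha hpq hkk hk' ht hs hb hpr hib ht' hs' x.1 y.1 z.1)

/-- The smallest sub-operad containing a given set of operations. -/
def SubOperad.closure {P : GrOperad.{u}} (s : ∀ n p, Set (P.obj n p)) : SubOperad P where
  carrier n p := ⨅ S : {S : SubOperad P // ∀ n p, s n p ⊆ S.carrier n p}, S.1.carrier n p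
  one_mem := by simpa [AddSubgroup.mem_iInf] using fun S _ => S.one_mem
  circ_mem i hi hk hr x y hx hy := by
    rw [AddSubgroup.mem_iInf] at *
    exact fun S => S.1.circ_mem i hi hk hr x y (hx S) (hy S)

/-- A nonsymmetric dg operad over `ℤ`, with homological conventions: `d` lowers the degree by
one. -/
structure DGOperad : Type (u + 1) extends GrOperad.{u} where
  d : ∀ {n : ℕ} {p q : ℤ} (_ : q + 1 = p), obj n p →+ obj n q
  d_d : ∀ {n : ℕ} {p q r : ℤ} (hq : q + 1 = p) (hr : r + 1 = q) (x : obj n p),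
    d hr (d hq x) = 0
  d_circ : ∀ {m n k : ℕ} {p p' q q' r r' : ℤ} (i : ℕ) (hi : i < m) (hk : k + 1 = m + n)
    (hr : p + q = r) (hp : p' + 1 = p) (hq : q' + 1 = q) (hr' : r' + 1 = r) (h₁ : p' + q = r')
    (h₂ : p + q' = r') (x : obj m p) (y : obj n q),
    d hr' (circ i hi hk hr x y) =
      circ i hi hk h₁ (d hp x) y + sgn p • circ i hi hk h₂ x (d hq y)

/-- A morphism of dg operads. -/
@[ext] structure DGOperad.Hom (P Q : DGOperad.{u}) extends
    GrOperad.Hom P.toGrOperad Q.toGrOperad where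
  map_d : ∀ {n : ℕ} {p q : ℤ} (h : q + 1 = p) (x : P.obj n p),
    map n q (P.d h x) = Q.d h (map n p x)

/-- The category of nonsymmetric dg operads over `ℤ`. -/
instance : Category DGOperad.{u} where
  Hom P Q := DGOperad.Hom P Q
  id P :=
    { map := fun _ _ => AddMonoidHom.id _
      map_one := rfl
      map_circ := fun _ _ _ _ _ _ => rfl
      map_d := fun _ _ => rfl }
  comp f g :=
    { map := fun n p => (g.map n p).comp (f.map n p)
      map_one := by simp [f.map_one, g.map_one]
      map_circ := fun i hi hk hr x y => by simp [f.map_circ, g.map_circ]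
      map_d := fun h x => by simp [f.map_d, g.map_d] }

section Curv

variable (Q : DGOperad.{u}) (κ : Q.obj 0 (-1)) (Q₀ : SubOperad Q.toGrOperad)

/-- `HasWeight Q κ Q₀ j x`: the operation `x` is a sum of operadic compositions of elements of `Q₀`
and of exactly `j` copies of `κ`.  When `Q` is the coproduct of `Q₀` and `[κ]`, the elements of
weight `j` form the weight `j` part `Q_j` of `Q`. -/
inductive HasWeight : ℕ → ∀ {n : ℕ} {p : ℤ}, Q.obj n p → Prop
  | of_mem {n : ℕ} {p : ℤ} (x : Q.obj n p) (hx : x ∈ Q₀.carrier n p) : HasWeight 0 x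
  | kappa : HasWeight 1 κ
  | zero (j n : ℕ) (p : ℤ) : HasWeight j (0 : Q.obj n p)
  | add {j n : ℕ} {p : ℤ} (x y : Q.obj n p) (hx : HasWeight j x) (hy : HasWeight j y) :
      HasWeight j (x + y)
  | neg {j n : ℕ} {p : ℤ} (x : Q.obj n p) (hx : HasWeight j x) : HasWeight j (-x)
  | circ {j j' m n k : ℕ} {p q r : ℤ} (i : ℕ) (hi : i < m) (hk : k + 1 = m + n)
      (hr : p + q = r) (x : Q.obj m p) (y : Q.obj n q) (hx : HasWeight j x)
      (hy : HasWeight j' y) : HasWeight (j + j') (Q.circ i hi hk hr x y)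

/-- The conditions on a quadruple `(Q, d_Q, κ, Q₀)` which define the objects of `Curv`. -/
structure IsCurv : Prop where
  /-- `κ` is not in `Q₀`.  (For the zero operad, where the identity operation vanishes, this cannot
  hold, and it is not required; for nonzero operads it is the plain condition.) -/
  kappa_notMem : Q.one ≠ 0 → κ ∉ Q₀.carrier 0 (-1)
  /-- The natural morphism `Q₀ ∨ [κ] ⟶ Q` is an isomorphism, i.e. `Q` is the coproduct of `Q₀` and
  of the operad `[κ]` freely generated by one operation of arity `0` and degree `-1`, in the
  category of graded operads (a morphism from `[κ]` to `X` is an element of `X(0)` of degree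
  `-1`). -/
  coproduct : ∀ (X : GrOperad.{u}) (g : GrOperad.Hom Q₀.toGrOperad X) (x : X.obj 0 (-1)),
    ∃! φ : GrOperad.Hom Q.toGrOperad X,
      (∀ (n : ℕ) (p : ℤ) (y : Q₀.carrier n p), φ.map n p y.1 = g.map n p y) ∧
        φ.map 0 (-1) κ = x
  /-- With respect to the weight grading, `d = d₀ + d₁` with `d_i(Q_j) ⊆ Q_{i+j}`. -/
  strict_mixed : ∀ (j n : ℕ) (p q : ℤ) (h : q + 1 = p) (x : Q.obj n p), HasWeight Q κ Q₀ j x →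
    ∃ y z : Q.obj n q, HasWeight Q κ Q₀ j y ∧ HasWeight Q κ Q₀ (j + 1) z ∧ Q.d h x = y + z
  /-- `d₁ κ = 0`, i.e. `d κ = d₀ κ` has weight one. -/
  d_kappa : HasWeight Q κ Q₀ 1 (Q.d (q := -2) (by norm_num) κ)

end Curv

/-- The objects of the category `Curv`. -/
structure Curv : Type (u + 1) where
  Q : DGOperad.{u}
  κ : Q.obj 0 (-1)
  Q₀ : SubOperad Q.toGrOperad
  isCurv : IsCurv Q κ Q₀

/-- A morphism in `Curv` is a morphism of dg operads which preserves `κ` and the sub-operad. -/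
@[ext] structure Curv.Hom (X Y : Curv.{u}) where
  hom : X.Q ⟶ Y.Q
  map_κ : hom.map 0 (-1) X.κ = Y.κ
  map_mem : ∀ (n : ℕ) (p : ℤ) (x : X.Q.obj n p), x ∈ X.Q₀.carrier n p →
    hom.map n p x ∈ Y.Q₀.carrier n p

instance : Category Curv.{u} where
  Hom X Y := Curv.Hom X Y
  id X := ⟨𝟙 X.Q, rfl, fun _ _ _ h => h⟩
  comp f g := ⟨f.hom ≫ g.hom, (congrArg _ f.map_κ).trans g.map_κ,
    fun n p x h => g.map_mem n p _ (f.map_mem n p x h)⟩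
  id_comp _ := Curv.Hom.ext (Category.id_comp _)
  comp_id _ := Curv.Hom.ext (Category.comp_id _)
  assoc _ _ _ := Curv.Hom.ext (Category.assoc _ _ _)

section FreeOperad

/-- Formal expressions in operations `μ n` (`n ≥ 0`) of arity `n` and degree `-1`. -/
inductive Pre : ℕ → ℤ → Type u
  | mu (n : ℕ) : Pre n (-1)
  | one : Pre 1 0
  | zero {n : ℕ} {p : ℤ} : Pre n p
  | add {n : ℕ} {p : ℤ} (x y : Pre n p) : Pre n p
  | neg {n : ℕ} {p : ℤ} (x : Pre n p) : Pre n p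
  | circ {m n k : ℕ} {p q r : ℤ} (i : ℕ) (hi : i < m) (hk : k + 1 = m + n) (hr : p + q = r)
      (x : Pre m p) (y : Pre n q) : Pre k r

/-- The sign `(-1)^e` applied to a formal expression. -/
def Pre.signed (e : ℤ) {n : ℕ} {p : ℤ} (x : Pre.{u} n p) : Pre.{u} n p :=
  if Even e then x else x.neg

/-- The congruence on formal expressions generated by the axioms of a graded operad. -/
inductive Rel : ∀ {n : ℕ} {p : ℤ}, Pre.{u} n p → Pre.{u} n p → Prop
  | refl {n : ℕ} {p : ℤ} (x : Pre n p) : Rel x x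
  | symm {n : ℕ} {p : ℤ} {x y : Pre n p} (h : Rel x y) : Rel y x
  | trans {n : ℕ} {p : ℤ} {x y z : Pre n p} (h : Rel x y) (h' : Rel y z) : Rel x z
  | add_congr {n : ℕ} {p : ℤ} {x x' y y' : Pre n p} (h : Rel x x') (h' : Rel y y') :
      Rel (x.add y) (x'.add y')
  | neg_congr {n : ℕ} {p : ℤ} {x x' : Pre n p} (h : Rel x x') : Rel x.neg x'.neg
  | circ_congr {m n k : ℕ} {p q r : ℤ} (i : ℕ) (hi : i < m) (hk : k + 1 = m + n)
      (hr : p + q = r) {x x' : Pre m p} {y y' : Pre n q} (h : Rel x x') (h' : Rel y y') :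
      Rel (Pre.circ i hi hk hr x y) (Pre.circ i hi hk hr x' y')
  | add_assoc {n : ℕ} {p : ℤ} (x y z : Pre n p) : Rel ((x.add y).add z) (x.add (y.add z))
  | add_comm {n : ℕ} {p : ℤ} (x y : Pre n p) : Rel (x.add y) (y.add x)
  | zero_add {n : ℕ} {p : ℤ} (x : Pre n p) : Rel (Pre.zero.add x) x
  | neg_add {n : ℕ} {p : ℤ} (x : Pre n p) : Rel (x.neg.add x) Pre.zero
  | circ_add {m n k : ℕ} {p q r : ℤ} (i : ℕ) (hi : i < m) (hk : k + 1 = m + n)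
      (hr : p + q = r) (x : Pre m p) (y y' : Pre n q) :
      Rel (Pre.circ i hi hk hr x (y.add y'))
        ((Pre.circ i hi hk hr x y).add (Pre.circ i hi hk hr x y'))
  | add_circ {m n k : ℕ} {p q r : ℤ} (i : ℕ) (hi : i < m) (hk : k + 1 = m + n)
      (hr : p + q = r) (x x' : Pre m p) (y : Pre n q) :
      Rel (Pre.circ i hi hk hr (x.add x') y)
        ((Pre.circ i hi hk hr x y).add (Pre.circ i hi hk hr x' y))
  | one_circ {n : ℕ} {p : ℤ} (h₀ : 0 < 1) (hk : n + 1 = 1 + n) (hr : 0 + p = p) (x : Pre n p) :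
      Rel (Pre.circ 0 h₀ hk hr Pre.one x) x
  | circ_one {n : ℕ} {p : ℤ} (i : ℕ) (hi : i < n) (hk : n + 1 = n + 1) (hr : p + 0 = p)
      (x : Pre n p) : Rel (Pre.circ i hi hk hr x Pre.one) x
  | circ_seq {m n l a b t : ℕ} {p q r pq qr s : ℤ} (i j : ℕ) (hi : i < m) (hj : j < n)
      (ha : a + 1 = m + n) (hpq : p + q = pq) (hij : i + j < a) (ht : t + 1 = a + l)
      (hs : pq + r = s) (hb : b + 1 = n + l) (hqr : q + r = qr) (ht' : t + 1 = m + b)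
      (hs' : p + qr = s) (x : Pre m p) (y : Pre n q) (z : Pre l r) :
      Rel (Pre.circ (i + j) hij ht hs (Pre.circ i hi ha hpq x y) z)
        (Pre.circ i hi ht' hs' x (Pre.circ j hj hb hqr y z))
  | circ_par {m n l a b t : ℕ} {p q r pq pr s : ℤ} (i k k' : ℕ) (hik : i < k) (hi : i < m)
      (hk : k < m) (ha : a + 1 = m + n) (hpq : p + q = pq) (hkk : k' + 1 = k + n) (hk' : k' < a)
      (ht : t + 1 = a + l) (hs : pq + r = s) (hb : b + 1 = m + l) (hpr : p + r = pr) (hib : i < b)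
      (ht' : t + 1 = b + n) (hs' : pr + q = s) (x : Pre m p) (y : Pre n q) (z : Pre l r) :
      Rel (Pre.circ k' hk' ht hs (Pre.circ i hi ha hpq x y) z)
        (Pre.signed (q * r) (Pre.circ i hib ht' hs' (Pre.circ k hk hb hpr x z) y))

instance preSetoid (n : ℕ) (p : ℤ) : Setoid (Pre.{u} n p) where
  r := Rel
  iseqv := ⟨Rel.refl, Rel.symm, Rel.trans⟩

/-- Operations of the free operad on the `μ n`. -/
def FreeObj (n : ℕ) (p : ℤ) : Type u := Quotient (preSetoid.{u} n p)

def FreeObj.mk {n : ℕ} {p : ℤ} (x : Pre.{u} n p) : FreeObj.{u} n p := Quotient.mk _ x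

theorem FreeObj.sound {n : ℕ} {p : ℤ} {x y : Pre.{u} n p} (h : Rel x y) :
    FreeObj.mk x = FreeObj.mk y := Quotient.sound h

theorem FreeObj.ind {n : ℕ} {p : ℤ} {motive : FreeObj.{u} n p → Prop}
    (h : ∀ x, motive (FreeObj.mk x)) (x : FreeObj.{u} n p) : motive x := Quotient.ind h x

instance (n : ℕ) (p : ℤ) : Zero (FreeObj.{u} n p) := ⟨FreeObj.mk Pre.zero⟩

instance (n : ℕ) (p : ℤ) : Add (FreeObj.{u} n p) :=
  ⟨Quotient.map₂ Pre.add (fun _ _ h _ _ h' => Rel.add_congr h h')⟩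

instance (n : ℕ) (p : ℤ) : Neg (FreeObj.{u} n p) :=
  ⟨Quotient.map Pre.neg (fun _ _ h => Rel.neg_congr h)⟩

instance (n : ℕ) (p : ℤ) : AddCommGroup (FreeObj.{u} n p) where
  nsmul := nsmulRec
  zsmul := zsmulRec
  add_assoc := by
    rintro ⟨x⟩ ⟨y⟩ ⟨z⟩
    exact FreeObj.sound (Rel.add_assoc x y z)
  zero_add := by
    rintro ⟨x⟩
    exact FreeObj.sound (Rel.zero_add x)
  add_zero := by
    rintro ⟨x⟩
    exact FreeObj.sound (Rel.trans (Rel.add_comm _ _) (Rel.zero_add x))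
  neg_add_cancel := by
    rintro ⟨x⟩
    exact FreeObj.sound (Rel.neg_add x)
  add_comm := by
    rintro ⟨x⟩ ⟨y⟩
    exact FreeObj.sound (Rel.add_comm x y)

theorem FreeObj.mk_add {n : ℕ} {p : ℤ} (x y : Pre.{u} n p) :
    FreeObj.mk (x.add y) = FreeObj.mk x + FreeObj.mk y := rfl

theorem FreeObj.mk_neg {n : ℕ} {p : ℤ} (x : Pre.{u} n p) :
    FreeObj.mk x.neg = -FreeObj.mk x := rfl

theorem FreeObj.mk_signed (e : ℤ) {n : ℕ} {p : ℤ} (x : Pre.{u} n p) :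
    FreeObj.mk (Pre.signed e x) = sgn e • FreeObj.mk x := by
  unfold Pre.signed sgn
  split_ifs <;> simp [FreeObj.mk_neg]

/-- The free graded operad on operations `μ n`, `n ≥ 0`, of arity `n` and degree `-1`. -/
def freeOperad : GrOperad.{u} where
  obj := FreeObj
  one := FreeObj.mk Pre.one
  circ i hi hk hr :=
    AddMonoidHom.mk' (fun x => AddMonoidHom.mk'
      (fun y => Quotient.map₂ (Pre.circ i hi hk hr)
        (fun _ _ h _ _ h' => Rel.circ_congr i hi hk hr h h') x y)
      (by
        rintro ⟨y⟩ ⟨y'⟩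
        induction x using FreeObj.ind with | h x => ?_
        exact FreeObj.sound (Rel.circ_add i hi hk hr x y y')))
      (by
        rintro ⟨x⟩ ⟨x'⟩
        ext ⟨y⟩
        exact FreeObj.sound (Rel.add_circ i hi hk hr x x' y))
  one_circ h₀ hk hr := by
    rintro ⟨x⟩
    exact FreeObj.sound (Rel.one_circ h₀ hk hr x)
  circ_one i hi hk hr := by
    rintro ⟨x⟩
    exact FreeObj.sound (Rel.circ_one i hi hk hr x)
  circ_seq i j hi hj ha hpq hij ht hs hb hqr ht' hs' := by
    rintro ⟨x⟩ ⟨y⟩ ⟨z⟩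
    exact FreeObj.sound (Rel.circ_seq i j hi hj ha hpq hij ht hs hb hqr ht' hs' x y z)
  circ_par i k k' hik hi hk ha hpq hkk hk' ht hs hb hpr hib ht' hs' := by
    rintro ⟨x⟩ ⟨y⟩ ⟨z⟩
    exact (FreeObj.sound (Rel.circ_par i k k' hik hi hk ha hpq hkk hk' ht hs hb hpr hib ht' hs'
      x y z)).trans (FreeObj.mk_signed _ _)

/-- The operation of the free operad given by a formal expression. -/
def fmk {n : ℕ} {p : ℤ} (x : Pre.{u} n p) : freeOperad.{u}.obj n p := FreeObj.mk x

theorem fmk_sound {n : ℕ} {p : ℤ} {x y : Pre.{u} n p} (h : Rel x y) : fmk x = fmk y :=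
  FreeObj.sound h

theorem fmk_ind {n : ℕ} {p : ℤ} {motive : freeOperad.{u}.obj n p → Prop}
    (h : ∀ x, motive (fmk x)) (x : freeOperad.{u}.obj n p) : motive x := FreeObj.ind h x

theorem fmk_one : fmk Pre.one = freeOperad.{u}.one := rfl

theorem fmk_zero {n : ℕ} {p : ℤ} : fmk (Pre.zero : Pre.{u} n p) = 0 := rfl

theorem fmk_add {n : ℕ} {p : ℤ} (x y : Pre.{u} n p) : fmk (x.add y) = fmk x + fmk y := rfl

theorem fmk_neg {n : ℕ} {p : ℤ} (x : Pre.{u} n p) : fmk x.neg = -fmk x := rfl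

theorem fmk_circ {m n k : ℕ} {p q r : ℤ} (i : ℕ) (hi : i < m) (hk : k + 1 = m + n)
    (hr : p + q = r) (x : Pre.{u} m p) (y : Pre.{u} n q) :
    fmk (Pre.circ i hi hk hr x y) = freeOperad.circ i hi hk hr (fmk x) (fmk y) := rfl

end FreeOperad

section CAinf

/-- Triples `(p, q, r)` of natural numbers with `p + q + r = n`. -/
@[ext] structure Triple (n : ℕ) where
  (p q r : ℕ)
  sum_eq : p + q + r = n

instance (n : ℕ) : Finite (Triple n) := by
  refine Finite.of_injective
    (fun t => ((⟨t.p, ?_⟩, ⟨t.q, ?_⟩, ⟨t.r, ?_⟩) : Fin (n + 1) × Fin (n + 1) × Fin (n + 1))) ?_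
  · have := t.sum_eq; omega
  · have := t.sum_eq; omega
  · have := t.sum_eq; omega
  · intro t t' h
    simp only [Prod.mk.injEq, Fin.mk.injEq] at h
    exact Triple.ext h.1 h.2.1 h.2.2

noncomputable instance (n : ℕ) : Fintype (Triple n) := Fintype.ofFinite _

/-- The sum `∑_{p+q+r=n} μ_{p+1+r} ∘_{p+1} μ_q`. -/
noncomputable def ainfSum (P : GrOperad.{u}) (μ : ∀ n, P.obj n (-1)) (n : ℕ) {s : ℤ}
    (hs : s = -2) : P.obj n s :=
  ∑ t : Triple n, P.circ (m := t.p + 1 + t.r) (n := t.q) t.p (by omega)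
    (by have := t.sum_eq; omega) (by omega) (μ (t.p + 1 + t.r)) (μ t.q)

/-- The generators `μ n`. -/
def freeMu (n : ℕ) : freeOperad.{u}.obj n (-1) := fmk (Pre.mu n)

/-- The derivation with `d μ_n = - ∑_{p+q+r=n} μ_{p+1+r} ∘_{p+1} μ_q`, on formal expressions. -/
noncomputable def dPre : ∀ {n : ℕ} {p : ℤ} (q : ℤ) (_ : q + 1 = p) (_ : Pre.{u} n p),
    freeOperad.{u}.obj n q
  | _, _, _, h, .mu n => -ainfSum freeOperad freeMu n (by omega)
  | _, _, _, _, .one => 0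
  | _, _, _, _, .zero => 0
  | _, _, q, h, .add x y => dPre q h x + dPre q h y
  | _, _, q, h, .neg x => -dPre q h x
  | _, _, _, h, @Pre.circ _ _ _ p q _ i hi hk hr x y =>
    freeOperad.circ i hi hk (by omega) (dPre (p - 1) (by omega) x) (fmk y) +
      sgn p • freeOperad.circ i hi hk (by omega) (fmk x) (dPre (q - 1) (by omega) y)

theorem dPre_circ {m n k : ℕ} {p q r p' q' r' : ℤ} (i : ℕ) (hi : i < m) (hk : k + 1 = m + n)
    (hr : p + q = r) (hp : p' + 1 = p) (hq : q' + 1 = q) (hr' : r' + 1 = r) (h₁ : p' + q = r')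
    (h₂ : p + q' = r') (x : Pre.{u} m p) (y : Pre.{u} n q) :
    dPre r' hr' (Pre.circ i hi hk hr x y) =
      freeOperad.circ i hi hk h₁ (dPre p' hp x) (fmk y) +
        sgn p • freeOperad.circ i hi hk h₂ (fmk x) (dPre q' hq y) := by
  obtain rfl : p' = p - 1 := by omega
  obtain rfl : q' = q - 1 := by omega
  rw [dPre]

theorem dPre_signed (e : ℤ) {n : ℕ} {p q : ℤ} (h : q + 1 = p) (x : Pre.{u} n p) :
    dPre q h (Pre.signed e x) = sgn e • dPre q h x := by
  unfold Pre.signed sgn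
  split_ifs <;> simp [dPre]

theorem dPre_rel {n : ℕ} {p : ℤ} {x y : Pre.{u} n p} (hxy : Rel x y) :
    ∀ (q : ℤ) (h : q + 1 = p), dPre q h x = dPre q h y := by
  induction hxy with
  | refl x => intros; rfl
  | symm _ ih => intro q h; exact (ih q h).symm
  | trans _ _ ih ih' => intro q h; exact (ih q h).trans (ih' q h)
  | add_congr _ _ ih ih' => intro q h; simp [dPre, ih q h, ih' q h]
  | neg_congr _ ih => intro q h; simp [dPre, ih q h]
  | circ_congr i hi hk hr h h' ih ih' =>
    intro q hq
    simp only [dPre, ih _ _, ih' _ _, fmk_sound h, fmk_sound h']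
  | add_assoc x y z => intro q h; simp [dPre, add_assoc]
  | add_comm x y => intro q h; simp [dPre, add_comm]
  | zero_add x => intro q h; simp [dPre]
  | neg_add x => intro q h; simp [dPre]
  | circ_add i hi hk hr x y y' =>
    intro q h
    simp only [dPre, fmk_add, map_add, smul_add]
    abel
  | add_circ i hi hk hr x x' y =>
    intro q h
    simp only [dPre, fmk_add, map_add, smul_add, AddMonoidHom.add_apply]
    abel
  | one_circ h₀ hk hr x =>
    intro q h
    rw [dPre_circ (p' := -1) (q' := q) 0 h₀ hk hr (by omega) h h (by omega) (by omega)]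
    have := freeOperad.one_circ h₀ hk (by omega) (dPre q h x)
    simp only [dPre, map_zero, AddMonoidHom.zero_apply, zero_add, fmk_one, this]
    simp [sgn]
  | circ_one i hi hk hr x =>
    intro q h
    rw [dPre_circ (p' := q) (q' := -1) i hi hk hr h (by omega) h (by omega) (by omega)]
    have := freeOperad.circ_one i hi hk (by omega) (dPre q h x)
    simp only [dPre, map_zero, smul_zero, add_zero]
    exact this
  | @circ_seq m n l a b t p q r pq qr s i j hi hj ha hpq hij ht hs hb hqr ht' hs' x y z =>
    intro s' h
    rw [dPre_circ (p' := pq - 1) (q' := r - 1) (i + j) hij ht hs (by omega) (by omega) (by omega) (by omega)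
        (by omega),
      dPre_circ (p' := p - 1) (q' := qr - 1) i hi ht' hs' (by omega) (by omega) (by omega) (by omega)
        (by omega),
      dPre_circ (p' := p - 1) (q' := q - 1) i hi ha hpq (by omega) (by omega) (by omega) (by omega)
        (by omega),
      dPre_circ (p' := q - 1) (q' := r - 1) j hj hb hqr (by omega) (by omega) (by omega) (by omega)
        (by omega)]
    simp only [fmk_circ, map_add, AddMonoidHom.add_apply, map_zsmul, smul_add,
      AddMonoidHom.smul_apply]
    rw [freeOperad.circ_seq (p := p - 1) (q := q) (r := r) (qr := qr) i j hi hj ha (by omega) hij ht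
        (by omega) hb (by omega) ht' (by omega),
      freeOperad.circ_seq (p := p) (q := q - 1) (r := r) (qr := qr - 1) i j hi hj ha (by omega) hij
        ht (by omega) hb (by omega) ht' (by omega),
      freeOperad.circ_seq (p := p) (q := q) (r := r - 1) (qr := qr - 1) i j hi hj ha (by omega) hij
        ht (by omega) hb (by omega) ht' (by omega), smul_smul, ← sgn_add, hpq, add_assoc]
  | @circ_par m n l a b t p q r pq pr s i k k' hik hi hk ha hpq hkk hk' ht hs hb hpr hib ht' hs'
      x y z =>
    intro s' h
    rw [dPre_signed,
      dPre_circ (p' := pq - 1) (q' := r - 1) k' hk' ht hs (by omega) (by omega) (by omega) (by omega)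
        (by omega),
      dPre_circ (p' := pr - 1) (q' := q - 1) i hib ht' hs' (by omega) (by omega) (by omega) (by omega)
        (by omega),
      dPre_circ (p' := p - 1) (q' := q - 1) i hi ha hpq (by omega) (by omega) (by omega) (by omega)
        (by omega),
      dPre_circ (p' := p - 1) (q' := r - 1) k hk hb hpr (by omega) (by omega) (by omega) (by omega)
        (by omega)]
    simp only [fmk_circ, map_add, AddMonoidHom.add_apply, map_zsmul, smul_add,
      AddMonoidHom.smul_apply]
    rw [freeOperad.circ_par (p := p - 1) (q := q) (r := r) (pr := pr - 1) i k k' hik hi hk ha (by omega) hkk hk' ht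
        (by omega) hb (by omega) hib ht' (by omega),
      freeOperad.circ_par (p := p) (q := q - 1) (r := r) (pr := pr) i k k' hik hi hk ha (by omega) hkk hk' ht
        (by omega) hb (by omega) hib ht' (by omega),
      freeOperad.circ_par (p := p) (q := q) (r := r - 1) (pr := pr - 1) i k k' hik hi hk ha (by omega) hkk hk' ht
        (by omega) hb (by omega) hib ht' (by omega)]
    simp only [smul_smul, ← sgn_add]
    rw [sgn_congr (a := p + (q - 1) * r) (b := q * r + pr) ⟨-r, by rw [← hpr]; ring⟩,
      sgn_congr (a := pq + q * (r - 1)) (b := q * r + p) ⟨0, by rw [← hpq]; ring⟩]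
    abel

/-- The differential of the curved A-infinity operad. -/
noncomputable def freeD {n : ℕ} {p q : ℤ} (h : q + 1 = p) :
    freeOperad.{u}.obj n p →+ freeOperad.{u}.obj n q :=
  AddMonoidHom.mk' (fun x => Quotient.lift (dPre q h) (fun _ _ hxy => dPre_rel hxy q h) x) (by
    rintro ⟨x⟩ ⟨y⟩
    change dPre q h (x.add y) = _
    rw [dPre])

theorem freeD_mk {n : ℕ} {p q : ℤ} (h : q + 1 = p) (x : Pre.{u} n p) :
    freeD h (fmk x) = dPre q h x := rfl

theorem freeD_mu (n : ℕ) {q : ℤ} (h : q + 1 = -1) :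
    freeD h (freeMu.{u} n) = -ainfSum freeOperad freeMu n (by omega) := by
  rw [freeMu, freeD_mk, dPre]

theorem freeD_circ {m n k : ℕ} {p p' q q' r r' : ℤ} (i : ℕ) (hi : i < m) (hk : k + 1 = m + n)
    (hr : p + q = r) (hp : p' + 1 = p) (hq : q' + 1 = q) (hr' : r' + 1 = r) (h₁ : p' + q = r')
    (h₂ : p + q' = r') (x : freeOperad.{u}.obj m p) (y : freeOperad.{u}.obj n q) :
    freeD hr' (freeOperad.circ i hi hk hr x y) =
      freeOperad.circ i hi hk h₁ (freeD hp x) y +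
        sgn p • freeOperad.circ i hi hk h₂ x (freeD hq y) := by
  induction x using fmk_ind with | h x => ?_
  induction y using fmk_ind with | h y => ?_
  exact dPre_circ i hi hk hr hp hq hr' h₁ h₂ x y

/-- Quintuples of natural numbers with sum `n`. -/
@[ext] structure Quint (n : ℕ) where
  (a b c d e : ℕ)
  sum_eq : a + b + c + d + e = n

instance (n : ℕ) : Finite (Quint n) := by
  refine Finite.of_injective (fun t => ((⟨t.a, ?_⟩, ⟨t.b, ?_⟩, ⟨t.c, ?_⟩, ⟨t.d, ?_⟩, ⟨t.e, ?_⟩) :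
      Fin (n + 1) × Fin (n + 1) × Fin (n + 1) × Fin (n + 1) × Fin (n + 1))) ?_
  iterate 5 (have := t.sum_eq; omega)
  intro t t' h
  simp only [Prod.mk.injEq, Fin.mk.injEq] at h
  exact Quint.ext h.1 h.2.1 h.2.2.1 h.2.2.2.1 h.2.2.2.2

noncomputable instance (n : ℕ) : Fintype (Quint n) := Fintype.ofFinite _

theorem sigmaTriple_ext {n : ℕ} {f : Triple n → ℕ} : ∀ {u v : Σ t : Triple n, Triple (f t)},
    u.1.p = v.1.p → u.1.q = v.1.q → u.1.r = v.1.r → u.2.p = v.2.p → u.2.q = v.2.q →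
    u.2.r = v.2.r → u = v := by
  rintro ⟨⟨p, q, r, h⟩, s⟩ ⟨⟨p', q', r', h'⟩, s'⟩ h₁ h₂ h₃ h₄ h₅ h₆
  dsimp only at h₁ h₂ h₃
  subst h₁ h₂ h₃
  obtain rfl : s = s' := Triple.ext h₄ h₅ h₆
  rfl

/-- The ways to insert two operations, one into the other, into a third one. -/
def nestedR {n : ℕ} (t : Quint n) : Σ t : Triple n, Triple t.q :=
  ⟨⟨t.a, t.b + t.c + t.d, t.e, by have := t.sum_eq; omega⟩, ⟨t.b, t.c, t.d, rfl⟩⟩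

theorem nestedR_bijective {n : ℕ} : Function.Bijective (nestedR (n := n)) := by
  constructor
  · intro t t' h
    have h₁ := congrArg (fun z => z.1.p) h
    have h₂ := congrArg (fun z => z.1.r) h
    have h₃ := congrArg (fun z => z.2.p) h
    have h₄ := congrArg (fun z => z.2.q) h
    have h₅ := congrArg (fun z => z.2.r) h
    exact Quint.ext h₁ h₃ h₄ h₅ h₂
  · rintro ⟨⟨p, q, r, h⟩, ⟨p', q', r', h'⟩⟩
    dsimp only at h'
    exact ⟨⟨p, p', q', r', r, by omega⟩, sigmaTriple_ext rfl h' rfl rfl rfl rfl⟩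

/-- The ways to insert two operations successively into a third one: the second one into the first
one, to the right of it, or to the left of it. -/
def nestedL {n : ℕ} : Quint n ⊕ Quint n ⊕ Quint n → Σ t : Triple n, Triple (t.p + 1 + t.r)
  | .inl t => ⟨⟨t.a + t.b, t.c, t.d + t.e, by have := t.sum_eq; omega⟩,
      ⟨t.a, t.b + 1 + t.d, t.e, by dsimp only; omega⟩⟩
  | .inr (.inl t) => ⟨⟨t.a + t.b + t.c, t.d, t.e, by have := t.sum_eq; omega⟩,
      ⟨t.a, t.b, t.c + 1 + t.e, by dsimp only; omega⟩⟩
  | .inr (.inr t) => ⟨⟨t.a, t.b, t.c + t.d + t.e, by have := t.sum_eq; omega⟩,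
      ⟨t.a + 1 + t.c, t.d, t.e, by dsimp only; omega⟩⟩

theorem nestedL_bijective {n : ℕ} : Function.Bijective (nestedL (n := n)) := by
  constructor
  · intro t t' h
    have h₁ := congrArg (fun z => z.1.p) h
    have h₂ := congrArg (fun z => z.1.q) h
    have h₃ := congrArg (fun z => z.1.r) h
    have h₄ := congrArg (fun z => z.2.p) h
    have h₅ := congrArg (fun z => z.2.q) h
    have h₆ := congrArg (fun z => z.2.r) h
    rcases t with t | t | t <;> rcases t' with t' | t' | t' <;>
      simp only [nestedL] at h₁ h₂ h₃ h₄ h₅ h₆ <;>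
      first
      | (exfalso; omega)
      | (congr 1; ext <;> omega)
      | (congr 2; ext <;> omega)
  · rintro ⟨⟨p, q, r, h⟩, ⟨p', q', r', h'⟩⟩
    dsimp only at h'
    rcases lt_or_ge p p' with h₁ | h₁
    · exact ⟨.inr (.inr ⟨p, q, p' - p - 1, q', r', by omega⟩), sigmaTriple_ext rfl rfl
        (by simp only [nestedL]; omega) (by simp only [nestedL]; omega) rfl rfl⟩
    · rcases lt_or_ge p (p' + q') with h₂ | h₂
      · exact ⟨.inl ⟨p', p - p', q, q' - 1 - (p - p'), r', by omega⟩, sigmaTriple_ext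
          (by simp only [nestedL]; omega) rfl (by simp only [nestedL]; omega) rfl
          (by simp only [nestedL]; omega) rfl⟩
      · exact ⟨.inr (.inl ⟨p', q', p - p' - q', q, r, by omega⟩), sigmaTriple_ext
          (by simp only [nestedL]; omega) rfl rfl rfl rfl (by simp only [nestedL]; omega)⟩

theorem ainf_par (P : GrOperad.{u}) (μ : ∀ n, P.obj n (-1)) {b d m m' k₁ k₂ t i k k' : ℕ} {s : ℤ}
    (hm : m = m') (hik : i < k) (hkk : k' + 1 = k + b) (hi : i < m) (hk : k < m')
    (ha : k₁ + 1 = m + b) (hk' : k' < k₁) (ht : t + 1 = k₁ + d) (hb : k₂ + 1 = m' + d)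
    (hib : i < k₂) (ht' : t + 1 = k₂ + b) (h₂ : (-1 : ℤ) + -1 = -2) (hs : (-2 : ℤ) + -1 = s) :
    P.circ k' hk' ht hs (P.circ i hi ha h₂ (μ m) (μ b)) (μ d) +
      P.circ i hib ht' hs (P.circ k hk hb h₂ (μ m') (μ d)) (μ b) = 0 := by
  subst hm
  rw [P.circ_par i k k' hik hi hk ha h₂ hkk hk' ht hs hb h₂ hib ht' hs]
  simp [sgn]

/-- The terms of `∑ (μ ∘ μ) ∘ μ` and of `∑ μ ∘ (μ ∘ μ)` agree up to cancellation. -/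
theorem ainf_square (P : GrOperad.{u}) (μ : ∀ n, P.obj n (-1)) (n : ℕ) {s : ℤ}
    (hs : (-2 : ℤ) + -1 = s) (hs' : (-1 : ℤ) + -2 = s) :
    ∑ t : Triple n, P.circ (m := t.p + 1 + t.r) (n := t.q) (k := n) t.p (by omega)
        (by have := t.sum_eq; omega) hs (ainfSum P μ (t.p + 1 + t.r) rfl) (μ t.q) =
      ∑ t : Triple n, P.circ (m := t.p + 1 + t.r) (n := t.q) (k := n) t.p (by omega)
        (by have := t.sum_eq; omega) hs' (μ (t.p + 1 + t.r)) (ainfSum P μ t.q rfl) := by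
  simp only [ainfSum, map_sum, AddMonoidHom.finsetSum_apply]
  rw [← Fintype.sum_sigma' (α := fun t : Triple n => Triple (t.p + 1 + t.r)),
    ← Fintype.sum_sigma' (α := fun t : Triple n => Triple t.q),
    ← nestedL_bijective.sum_comp, ← nestedR_bijective.sum_comp,
    Fintype.sum_sum_type, Fintype.sum_sum_type, ← Finset.sum_add_distrib]
  refine (congrArg₂ (· + ·) ?_ ?_).trans (add_zero _)
  rotate_left
  · refine Finset.sum_eq_zero (fun t _ => ?_)
    simp only [nestedL]
    exact ainf_par P μ (by omega) (by omega) (by omega) _ _ _ _ _ _ _ _ _ _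
  · refine Finset.sum_congr rfl (fun t _ => ?_)
    simp only [nestedL, nestedR]
    exact P.circ_seq t.a t.b _ _ _ _ _ _ _ _ _ _ _ _ _ _

theorem freeD_freeD {n : ℕ} {p : ℤ} (x : Pre.{u} n p) : ∀ {q r : ℤ} (hq : q + 1 = p)
    (hr : r + 1 = q), freeD hr (freeD hq (fmk x)) = 0 := by
  induction x with
  | mu n =>
    intro q r hq hr
    change freeD hr (freeD hq (freeMu n)) = 0
    obtain rfl : q = -2 := by omega
    rw [freeD_mu, map_neg, neg_eq_zero]
    have key := ainf_square freeOperad freeMu n (s := r) (by omega) (by omega)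
    rw [← sub_eq_zero] at key
    rw [ainfSum, map_sum, ← neg_eq_zero, ← key, ← Finset.sum_sub_distrib, ← Finset.sum_neg_distrib]
    refine Finset.sum_congr rfl (fun t _ => ?_)
    rw [freeD_circ (p' := -2) (q' := -2) _ _ _ _ (by norm_num) (by norm_num) _ (by omega)
      (by omega), freeD_mu, freeD_mu]
    simp only [map_neg, AddMonoidHom.neg_apply]
    simp [sgn, sub_eq_add_neg]
    exact add_comm _ _
  | one =>
    intro q r hq hr
    rw [freeD_mk, dPre, map_zero]
  | zero =>
    intro q r hq hr
    rw [freeD_mk, dPre, map_zero]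
  | add x y ihx ihy =>
    intro q r hq hr
    rw [fmk_add, map_add, map_add, ihx, ihy, add_zero]
  | neg x ih =>
    intro q r hq hr
    rw [fmk_neg, map_neg, map_neg, ih, neg_zero]
  | @circ m n k p q s i hi hk hr x y ihx ihy =>
    intro s' s'' h h'
    rw [fmk_circ, freeD_circ (p' := p - 1) (q' := q - 1) i hi hk hr (by omega) (by omega) h
        (by omega) (by omega), map_add, map_zsmul,
      freeD_circ (p := p - 1) (q := q) (p' := p - 2) (q' := q - 1) i hi hk _ (by omega) (by omega)
        h' (by omega) (by omega),
      freeD_circ (p := p) (q := q - 1) (p' := p - 1) (q' := q - 2) i hi hk _ (by omega) (by omega)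
        h' (by omega) (by omega), ihx, ihy]
    have e : sgn p = -sgn (p - 1) := by rw [← sgn_succ]; congr 1; ring
    simp [e]

/-- The curved A-infinity operad: the free operad on operations `μ n`, `n ≥ 0`, of arity `n` and
degree `-1`, with the differential `d μ_n = - ∑_{p+q+r=n} μ_{p+1+r} ∘_{p+1} μ_q`. -/
noncomputable def cAinf : DGOperad.{u} where
  toGrOperad := freeOperad
  d h := freeD h
  d_d hq hr x := by
    induction x using fmk_ind with | h x => ?_
    exact freeD_freeD x hq hr
  d_circ i hi hk hr hp hq hr' h₁ h₂ x y := freeD_circ i hi hk hr hp hq hr' h₁ h₂ x y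

/-- The generators of the curved A-infinity operad. -/
noncomputable def cAinf.mu (n : ℕ) : cAinf.{u}.obj n (-1) := freeMu n

/-- The sub-operad of the curved A-infinity operad generated by the `μ n` with `n > 0`. -/
noncomputable def cAinf.sub : SubOperad cAinf.{u}.toGrOperad :=
  SubOperad.closure (fun n p => {x | 0 < n ∧ ∃ h : p = -1, x = h ▸ cAinf.mu n})

end CAinf

section Hat

/-- The letters of the words below: an empty slot (an input) or one of the operations `α`, `κ`. -/
inductive Letter
  | slot
  | al
  | ka
  deriving DecidableEq

open Letter

/-- The number of occurrences of `κ` in a word, as an integer. -/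
def kap (w : List Letter) : ℤ := (w.count ka : ℤ)

@[simp] theorem kap_nil : kap [] = 0 := rfl

@[simp] theorem kap_append (v w : List Letter) : kap (v ++ w) = kap v + kap w := by
  simp [kap]

@[simp] theorem kap_slot (w : List Letter) : kap (slot :: w) = kap w := by simp [kap]

@[simp] theorem kap_al (w : List Letter) : kap (al :: w) = kap w := by simp [kap]

@[simp] theorem kap_ka (w : List Letter) : kap (ka :: w) = kap w + 1 := by simp [kap]

/-- The words which can be inserted into an operation of arity `N` and degree `q` so as to give an
operation of arity `n` and degree `p` (here `α` has degree `0` and `κ` has degree `-1`). -/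
@[ext] structure Word (n : ℕ) (p : ℤ) (N : ℕ) (q : ℤ) where
  w : List Letter
  slots_eq : w.count slot = n
  length_eq : w.length = N
  degree_eq : p + kap w = q

/-- The operations of arity `n` and degree `p` of the completed coproduct of `P` and of the operad
`T` freely generated by the arity zero operations `α` of degree `0` and `κ` of degree `-1`.

The coproduct of `P` and `T` is the composite `P ∘ T`: every operation is uniquely a finite sum of
operations `c_w(w)`, where `w = ℓ₁ ⋯ ℓ_N` is a word in the letters "slot", `α`, `κ`, the coefficient
`c_w` is in `P(N)`, and `c_w(w)` is `c_w` with the letters `α`, `κ` of `w` inserted, from left to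
right, into the corresponding inputs.  The completion with respect to the number of `α`, taken in
each weight (number of `κ`), consists of the families `(c_w)_w` which vanish on all words with more
than `B` letters `κ`, for some `B`; in other words it is the direct sum over the number of `κ` of
the product over the number of `α`. -/
def hatObj (P : GrOperad.{u}) (n : ℕ) (p : ℤ) :
    AddSubgroup (∀ (N : ℕ) (q : ℤ), Word n p N q → P.obj N q) where
  carrier := {x | ∃ B : ℤ, ∀ (N : ℕ) (q : ℤ) (w : Word n p N q), B < kap w.w → x N q w = 0}
  zero_mem' := ⟨0, fun _ _ _ _ => rfl⟩
  add_mem' := by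
    rintro x y ⟨B, hB⟩ ⟨B', hB'⟩
    refine ⟨max B B', fun N q w h => ?_⟩
    rw [Pi.add_apply, Pi.add_apply, Pi.add_apply, hB N q w (lt_of_le_of_lt (le_max_left _ _) h),
      hB' N q w (lt_of_le_of_lt (le_max_right _ _) h), add_zero]
  neg_mem' := by
    rintro x ⟨B, hB⟩
    refine ⟨B, fun N q w h => ?_⟩
    rw [Pi.neg_apply, Pi.neg_apply, Pi.neg_apply, hB N q w h, neg_zero]

/-- The ways to write `w = A v B` with `i` slots in `A` and `n` slots in `v`. -/
@[ext] structure Split (w : List Letter) (i n : ℕ) where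
  (A v B : List Letter)
  eq : A ++ v ++ B = w
  hA : A.count slot = i
  hv : v.count slot = n

instance (w : List Letter) (i n : ℕ) : Finite (Split w i n) := by
  refine Finite.of_injective (fun t => ((⟨t.A.length, ?_⟩, ⟨t.v.length, ?_⟩) :
      Fin (w.length + 1) × Fin (w.length + 1))) ?_
  · have := congrArg List.length t.eq
    simp only [List.length_append] at this
    omega
  · have := congrArg List.length t.eq
    simp only [List.length_append] at this
    omega
  · intro t t' h
    simp only [Prod.mk.injEq, Fin.mk.injEq] at h
    have e := t.eq.trans t'.eq.symm
    rw [List.append_assoc, List.append_assoc] at e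
    obtain ⟨e₁, e₂⟩ := List.append_inj e h.1
    obtain ⟨e₃, e₄⟩ := List.append_inj e₂ h.2
    exact Split.ext e₁ e₃ e₄

noncomputable instance (w : List Letter) (i n : ℕ) : Fintype (Split w i n) := Fintype.ofFinite _

/-- The word `A slot B` of a splitting. -/
def Split.left {m n k i N : ℕ} {r s : ℤ} {w : Word k r N s} (hk : k + 1 = m + n)
    (t : Split w.w i n) (p : ℤ) : Word m p (t.A.length + 1 + t.B.length) (p + (kap t.A + kap t.B))
    where
  w := t.A ++ slot :: t.B
  slots_eq := by
    have h := congrArg (List.count slot) t.eq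
    have hv := t.hv
    rw [w.slots_eq] at h
    simp only [List.count_append, List.count_cons_self] at *
    omega
  length_eq := by
    simp only [List.length_append, List.length_cons]
    omega
  degree_eq := by simp

/-- The word `v` of a splitting. -/
def Split.mid {w : List Letter} {i n : ℕ} (t : Split w i n) (q : ℤ) :
    Word n q t.v.length (q + kap t.v) := ⟨t.v, t.hv, rfl, rfl⟩

theorem Split.arity {n k i N : ℕ} {r s : ℤ} {w : Word k r N s} (t : Split w.w i n) :
    N + 1 = (t.A.length + 1 + t.B.length) + t.v.length := by
  have h := congrArg List.length t.eq
  rw [w.length_eq] at h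
  simp only [List.length_append] at h
  omega

theorem Split.degree {n k i N : ℕ} {p q r s : ℤ} {w : Word k r N s} (hr : p + q = r)
    (t : Split w.w i n) : (p + (kap t.A + kap t.B)) + (q + kap t.v) = s := by
  have h := congrArg kap t.eq
  have h' := w.degree_eq
  simp only [kap_append] at h
  omega

/-- Partial composition in the completed coproduct:
`c(A slot B) ∘ e(v) = ± (c ∘ e)(A v B)`, where the sign is the Koszul sign for moving `e` past the
letters of `A` and `B`, and then `v` past the letters of `B`. -/
noncomputable def hatCircFun (P : GrOperad.{u}) {m n k : ℕ} {p q r : ℤ} (i : ℕ)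
    (hk : k + 1 = m + n) (hr : p + q = r) (x : hatObj P m p) (y : hatObj P n q) (N : ℕ) (s : ℤ)
    (w : Word k r N s) : P.obj N s :=
  ∑ t : Split w.w i n,
    sgn ((q + kap t.v) * (kap t.A + kap t.B) + kap t.v * kap t.B) •
      P.circ t.A.length (by omega) t.arity (t.degree hr)
        (x.1 _ _ (t.left hk p)) (y.1 _ _ (t.mid q))

theorem hatCircFun_mem (P : GrOperad.{u}) {m n k : ℕ} {p q r : ℤ} (i : ℕ)
    (hk : k + 1 = m + n) (hr : p + q = r) (x : hatObj P m p) (y : hatObj P n q) :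
    hatCircFun P i hk hr x y ∈ hatObj P k r := by
  obtain ⟨B, hB⟩ := x.2
  obtain ⟨B', hB'⟩ := y.2
  refine ⟨B + B', fun N s w h => Finset.sum_eq_zero (fun t _ => ?_)⟩
  have e := congrArg kap t.eq
  simp only [kap_append] at e
  by_cases h₁ : B < kap t.A + kap t.B
  · rw [hB _ _ _ (by simpa [Split.left] using h₁), map_zero, AddMonoidHom.zero_apply, smul_zero]
  · rw [hB' _ _ _ (by dsimp only [Split.mid]; omega), map_zero, smul_zero]

/-- The unit of `P`, with free indices. -/
def GrOperad.oneAt (P : GrOperad.{u}) {N : ℕ} {q : ℤ} (hN : N = 1) (hq : q = 0) : P.obj N q :=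
  hN ▸ hq ▸ P.one

noncomputable def hatCirc (P : GrOperad.{u}) {m n k : ℕ} {p q r : ℤ} (i : ℕ)
    (hk : k + 1 = m + n) (hr : p + q = r) : hatObj P m p →+ hatObj P n q →+ hatObj P k r :=
  AddMonoidHom.mk' (fun x => AddMonoidHom.mk'
    (fun y => ⟨hatCircFun P i hk hr x y, hatCircFun_mem P i hk hr x y⟩)
    (fun y y' => by
      ext N s w
      simp [hatCircFun, Finset.sum_add_distrib]))
    (fun x x' => by
      ext y N s w
      simp [hatCircFun, Finset.sum_add_distrib])

theorem hatCirc_apply (P : GrOperad.{u}) {m n k : ℕ} {p q r : ℤ} (i : ℕ)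
    (hk : k + 1 = m + n) (hr : p + q = r) (x : hatObj P m p) (y : hatObj P n q) (N : ℕ) (s : ℤ)
    (w : Word k r N s) : (hatCirc P i hk hr x y).1 N s w =
  ∑ t : Split w.w i n,
    sgn ((q + kap t.v) * (kap t.A + kap t.B) + kap t.v * kap t.B) •
      P.circ t.A.length (by omega) t.arity (t.degree hr)
        (x.1 _ _ (t.left hk p)) (y.1 _ _ (t.mid q)) := rfl

theorem Word.unit_index {N : ℕ} {q : ℤ} {w : Word 1 0 N q} (h : w.w = [slot]) :
    N = 1 ∧ q = 0 := by
  obtain ⟨w, h₁, h₂, h₃⟩ := w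
  dsimp only at h
  subst h
  simp at h₂ h₃
  omega

/-- The identity operation of the completed coproduct. -/
def hatOne (P : GrOperad.{u}) : hatObj P 1 0 :=
  ⟨fun _ _ w => if h : w.w = [slot] then P.oneAt (Word.unit_index h).1 (Word.unit_index h).2 else 0,
    0, fun N q w h => dif_neg (fun h' => by
      rw [h'] at h
      simp at h)⟩

theorem GrOperad.circ_oneAt (P : GrOperad.{u}) {m n k : ℕ} {p q r : ℤ} (i : ℕ) (hi : i < m)
    (hk : k + 1 = m + n) (hr : p + q = r) (hn : n = 1) (hq : q = 0) (x : P.obj m p)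
    (x' : P.obj k r) (hx : HEq x x') : P.circ i hi hk hr x (P.oneAt hn hq) = x' := by
  subst hn hq
  obtain rfl : k = m := by omega
  obtain rfl : r = p := by omega
  obtain rfl := eq_of_heq hx
  exact P.circ_one i hi hk hr x

theorem GrOperad.oneAt_circ (P : GrOperad.{u}) {m n k : ℕ} {p q r : ℤ} (i : ℕ) (hi : i < m)
    (hk : k + 1 = m + n) (hr : p + q = r) (hm : m = 1) (hp : p = 0) (x : P.obj n q)
    (x' : P.obj k r) (hx : HEq x x') : P.circ i hi hk hr (P.oneAt hm hp) x = x' := by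
  subst hm hp
  obtain rfl : k = n := by omega
  obtain rfl : r = q := by omega
  obtain rfl : i = 0 := by omega
  obtain rfl := eq_of_heq hx
  exact P.one_circ hi hk hr x

/-- Equality of elements with possibly different indices. -/
structure SameOp (P : GrOperad.{u}) {N N' : ℕ} {q q' : ℤ} (x : P.obj N q) (x' : P.obj N' q') :
    Prop where
  arity : N = N'
  degree : q = q'
  heq : HEq x x'

theorem hat_same {P : GrOperad.{u}} {n : ℕ} {p : ℤ} (x : hatObj P n p) {N N' : ℕ} {q q' : ℤ}
    (w : Word n p N q) (w' : Word n p N' q') (h : w.w = w'.w) :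
    SameOp P (x.1 N q w) (x.1 N' q' w') := by
  obtain ⟨w, h₁, h₂, h₃⟩ := w
  obtain ⟨w', h₁', h₂', h₃'⟩ := w'
  dsimp only at h
  subst h h₂ h₃ h₂' h₃'
  exact ⟨rfl, rfl, HEq.rfl⟩

theorem GrOperad.circ_seq' (P : GrOperad.{u}) {m n l a m' n' l' b t : ℕ}
    {p q r pq p' q' r' qr s : ℤ} {i i' j k : ℕ} (hii : i' = i) (hkj : k = i + j) (hi : i < m)
    (ha : a + 1 = m + n) (hpq : p + q = pq) (hk : k < a) (ht : t + 1 = a + l)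
    (hs : pq + r = s) (hi' : i' < m') (hj : j < n') (hb : b + 1 = n' + l') (hqr : q' + r' = qr)
    (ht' : t + 1 = m' + b) (hs' : p' + qr = s) {x : P.obj m p} {y : P.obj n q} {z : P.obj l r}
    {x' : P.obj m' p'} {y' : P.obj n' q'} {z' : P.obj l' r'} (hx : SameOp P x x')
    (hy : SameOp P y y') (hz : SameOp P z z') :
    P.circ k hk ht hs (P.circ i hi ha hpq x y) z =
      P.circ i' hi' ht' hs' x' (P.circ j hj hb hqr y' z') := by
  obtain ⟨rfl, rfl, hx⟩ := hx
  obtain ⟨rfl, rfl, hy⟩ := hy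
  obtain ⟨rfl, rfl, hz⟩ := hz
  obtain rfl := eq_of_heq hx
  obtain rfl := eq_of_heq hy
  obtain rfl := eq_of_heq hz
  subst hii hkj
  exact P.circ_seq _ _ _ _ _ _ _ _ _ _ _ _ _ _ _ _

theorem GrOperad.circ_par' (P : GrOperad.{u}) {m n l a m' n' l' b t : ℕ}
    {p q r pq p' q' r' pr s : ℤ} {i i' k k' : ℕ} (hii : i' = i) (hik : i < k)
    (hkk : k' + 1 = k + n) (hi : i < m)
    (ha : a + 1 = m + n) (hpq : p + q = pq) (hk' : k' < a) (ht : t + 1 = a + l)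
    (hs : pq + r = s) (hk : k < m') (hb : b + 1 = m' + l') (hpr : p' + r' = pr) (hi' : i' < b)
    (ht' : t + 1 = b + n') (hs' : pr + q' = s) {x : P.obj m p} {y : P.obj n q} {z : P.obj l r}
    {x' : P.obj m' p'} {y' : P.obj n' q'} {z' : P.obj l' r'} (hx : SameOp P x x')
    (hy : SameOp P y y') (hz : SameOp P z z') {c c' : ℤ} (hc : c * sgn (q * r) = c') :
    c • P.circ k' hk' ht hs (P.circ i hi ha hpq x y) z =
      c' • P.circ i' hi' ht' hs' (P.circ k hk hb hpr x' z') y' := by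
  obtain ⟨rfl, rfl, hx⟩ := hx
  obtain ⟨rfl, rfl, hy⟩ := hy
  obtain ⟨rfl, rfl, hz⟩ := hz
  obtain rfl := eq_of_heq hx
  obtain rfl := eq_of_heq hy
  obtain rfl := eq_of_heq hz
  subst hii
  rw [← hc, mul_smul, P.circ_par i' k k' hik _ _ _ _ hkk]

theorem exists_slot {w : List Letter} : ∀ {i : ℕ}, i < w.count slot →
    ∃ A B : List Letter, A ++ slot :: B = w ∧ A.count slot = i := by
  induction w with
  | nil => intro i h; simp at h
  | cons c w ih =>
    intro i h
    by_cases hc : c = slot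
    · subst hc
      rcases i with _ | i
      · exact ⟨[], w, rfl, rfl⟩
      · obtain ⟨A, B, h₁, h₂⟩ := ih (i := i) (by simpa using h)
        exact ⟨slot :: A, B, by simp [h₁], by simp [h₂]⟩
    · obtain ⟨A, B, h₁, h₂⟩ := ih (i := i) (by simpa [List.count_cons_of_ne hc] using h)
      exact ⟨c :: A, B, by simp [h₁], by simp [List.count_cons_of_ne hc, h₂]⟩

theorem slot_inj {A B A' B' : List Letter} (h : A ++ slot :: B = A' ++ slot :: B')
    (hA : A.count slot = A'.count slot) : A = A' ∧ B = B' := by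
  rcases List.append_eq_append_iff.1 h with ⟨C, rfl, hC⟩ | ⟨C, rfl, hC⟩
  · rcases C with _ | ⟨c, C⟩
    · simpa using hC
    · simp only [List.cons_append, List.cons.injEq] at hC
      obtain ⟨rfl, hC⟩ := hC
      simp at hA
      try omega
  · rcases C with _ | ⟨c, C⟩
    · simpa using hC.symm
    · simp only [List.cons_append, List.cons.injEq] at hC
      obtain ⟨rfl, hC⟩ := hC
      simp at hA
      try omega

theorem hat_circ_one (P : GrOperad.{u}) {n : ℕ} {p : ℤ} (i : ℕ) (hi : i < n)
    (hk : n + 1 = n + 1) (hr : p + 0 = p) (x : hatObj P n p) :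
    hatCirc P i hk hr x (hatOne P) = x := by
  ext N s w
  rw [hatCirc_apply]
  obtain ⟨A, B, hAB, hA⟩ := exists_slot (w := w.w) (i := i) (by rw [w.slots_eq]; exact hi)
  rw [Fintype.sum_eq_single (⟨A, [slot], B, by simpa using hAB, hA, by simp⟩ : Split w.w i 1)]
  · simp only [hatOne, Split.mid, dif_pos]
    have e : sgn ((0 + kap [slot]) * (kap A + kap B) + kap [slot] * kap B) = 1 := by
      simp [sgn]
    rw [e, one_smul]
    exact P.circ_oneAt _ _ _ _ _ _ _ _ (hat_same x _ _ hAB).heq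
  · intro t ht
    have hv : t.v ≠ [slot] := by
      intro hv
      apply ht
      have e := t.eq.trans hAB.symm
      rw [hv] at e
      obtain ⟨e₁, e₂⟩ := slot_inj (by simpa using e) (t.hA.trans hA.symm)
      exact Split.ext e₁ hv e₂
    simp only [hatOne]
    rw [dif_neg (show ¬(t.mid 0).w = [slot] from hv), map_zero, smul_zero]

theorem hat_one_circ (P : GrOperad.{u}) {n : ℕ} {p : ℤ}
    (hk : n + 1 = 1 + n) (hr : 0 + p = p) (x : hatObj P n p) :
    hatCirc P 0 hk hr (hatOne P) x = x := by
  ext N s w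
  rw [hatCirc_apply]
  rw [Fintype.sum_eq_single (⟨[], w.w, [], by simp, rfl, w.slots_eq⟩ : Split w.w 0 n)]
  · simp only [hatOne, Split.left, List.nil_append, dif_pos]
    have e : sgn ((p + kap w.w) * (kap [] + kap []) + kap w.w * kap []) = 1 := by
      simp [sgn]
    rw [e, one_smul]
    refine P.oneAt_circ _ _ _ _ _ _ _ _ (SameOp.heq (P := P) ?_)
    exact hat_same x _ _ rfl
  · intro t ht
    have hv : t.A ++ slot :: t.B ≠ [slot] := by
      intro hv
      apply ht
      have h := congrArg List.length hv
      simp only [List.length_append, List.length_cons, List.length_nil] at h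
      have h₁ : t.A = [] := List.length_eq_zero_iff.1 (by omega)
      have h₂ : t.B = [] := List.length_eq_zero_iff.1 (by omega)
      refine Split.ext h₁ ?_ h₂
      have e := t.eq
      rw [h₁, h₂] at e
      simpa using e
    simp only [hatOne]
    rw [dif_neg (show ¬(t.left hk 0).w = [slot] from hv), map_zero, AddMonoidHom.zero_apply,
      smul_zero]

theorem slot_in_mid {a v b A B : List Letter} (h : a ++ v ++ b = A ++ slot :: B)
    (h₁ : a.count slot ≤ A.count slot) (h₂ : A.count slot < a.count slot + v.count slot) :
    ∃ C D, A = a ++ C ∧ v = C ++ slot :: D ∧ B = D ++ b := by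
  obtain ⟨C, D, rfl, hC⟩ := exists_slot (w := v) (i := A.count slot - a.count slot) (by omega)
  obtain ⟨e₁, e₂⟩ := slot_inj (A := a ++ C) (B := D ++ b) (A' := A) (B' := B)
    (by simpa using h) (by simp only [List.count_append]; omega)
  exact ⟨C, D, e₁.symm, rfl, e₂.symm⟩

theorem slot_in_left {a v b A B : List Letter} (h : a ++ v ++ b = A ++ slot :: B)
    (h₁ : A.count slot < a.count slot) :
    ∃ C, a = A ++ slot :: C ∧ B = C ++ v ++ b := by
  obtain ⟨C, D, rfl, hC⟩ := exists_slot h₁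
  obtain ⟨e₁, e₂⟩ := slot_inj (A := C) (B := D ++ v ++ b) (A' := A) (B' := B)
    (by simpa using h) hC
  exact ⟨D, by rw [e₁], e₂.symm⟩

theorem slot_in_right {a v b A B : List Letter} (h : a ++ v ++ b = A ++ slot :: B)
    (h₁ : a.count slot + v.count slot ≤ A.count slot) :
    ∃ C, A = a ++ v ++ C ∧ b = C ++ slot :: B := by
  have e := congrArg (List.count slot) h
  simp only [List.count_append, List.count_cons_self] at e
  obtain ⟨C, D, rfl, hC⟩ := exists_slot (w := b)
    (i := A.count slot - a.count slot - v.count slot) (by omega)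
  obtain ⟨e₁, e₂⟩ := slot_inj (A := a ++ v ++ C) (B := D) (A' := A) (B' := B)
    (by simpa using h) (by simp only [List.count_append]; omega)
  exact ⟨C, e₁.symm, by rw [e₂]⟩

/-- The ways to write `w = A C v D B` with prescribed numbers of slots. -/
@[ext] structure Nest (w : List Letter) (i j n l : ℕ) where
  (A C v D B : List Letter)
  eq : A ++ C ++ v ++ D ++ B = w
  hA : A.count slot = i
  hC : C.count slot = j
  hD : C.count slot + 1 + D.count slot = n
  hv : v.count slot = l

theorem sigmaSplit_ext {w : List Letter} {i n i' n' : ℕ} {f : Split w i n → List Letter} :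
    ∀ {u v : Σ t : Split w i n, Split (f t) i' n'},
    u.1.A = v.1.A → u.1.v = v.1.v → u.1.B = v.1.B → u.2.A = v.2.A → u.2.v = v.2.v →
    u.2.B = v.2.B → u = v := by
  rintro ⟨⟨A, x, B, h, hA, hv⟩, s⟩ ⟨⟨A', x', B', h', hA', hv'⟩, s'⟩ h₁ h₂ h₃ h₄ h₅ h₆
  dsimp only at h₁ h₂ h₃
  subst h₁ h₂ h₃
  obtain rfl : s = s' := Split.ext h₄ h₅ h₆
  rfl

def Nest.toL {w : List Letter} {i j n l : ℕ} (e : Nest w i j n l) :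
    Σ t : Split w (i + j) l, Split (t.A ++ slot :: t.B) i n :=
  ⟨⟨e.A ++ e.C, e.v, e.D ++ e.B, by simpa using e.eq, by simp [e.hA, e.hC], e.hv⟩,
    ⟨e.A, e.C ++ slot :: e.D, e.B, by simp, e.hA, by
      have := e.hD
      simp only [List.count_append, List.count_cons_self]
      omega⟩⟩

theorem Nest.toL_bijective {w : List Letter} {i j n l : ℕ} (hj : j < n) :
    Function.Bijective (Nest.toL (w := w) (i := i) (j := j) (n := n) (l := l)) := by
  constructor
  · intro e e' h
    have h₁ : e.A = e'.A := congrArg (fun z => z.2.A) h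
    have h₂ : e.v = e'.v := congrArg (fun z => z.1.v) h
    have h₃ : e.B = e'.B := congrArg (fun z => z.2.B) h
    have h₄ : e.A ++ e.C = e'.A ++ e'.C := congrArg (fun z => z.1.A) h
    have h₅ : e.D ++ e.B = e'.D ++ e'.B := congrArg (fun z => z.1.B) h
    rw [h₁] at h₄
    rw [h₃] at h₅
    exact Nest.ext h₁ (List.append_cancel_left h₄) h₂ (List.append_cancel_right h₅) h₃
  · rintro ⟨⟨A', v', B', h', hA', hv'⟩, ⟨A, v, B, h, hA, hv⟩⟩
    dsimp only at h
    obtain ⟨C, D, e₁, e₂, e₃⟩ := slot_in_mid h (by omega) (by omega)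
    subst e₁ e₂ e₃
    refine ⟨⟨A, C, v', D, B, by simpa using h', hA, ?_, ?_, hv'⟩,
      sigmaSplit_ext rfl rfl rfl rfl rfl rfl⟩
    · simp only [List.count_append] at hA'
      omega
    · simp only [List.count_append, List.count_cons_self] at hv
      omega

def Nest.toR {w : List Letter} {i j n l b : ℕ} (hb : b + 1 = n + l) (e : Nest w i j n l) :
    Σ t : Split w i b, Split t.v j l :=
  ⟨⟨e.A, e.C ++ e.v ++ e.D, e.B, by simpa using e.eq, e.hA, by
      have := e.hD
      have := e.hv
      simp only [List.count_append]
      omega⟩,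
    ⟨e.C, e.v, e.D, rfl, e.hC, e.hv⟩⟩

theorem Nest.toR_bijective {w : List Letter} {i j n l b : ℕ} (hb : b + 1 = n + l) :
    Function.Bijective (Nest.toR (w := w) (i := i) (j := j) (n := n) (l := l) hb) := by
  constructor
  · intro e e' h
    exact Nest.ext (congrArg (fun z => z.1.A) h) (congrArg (fun z => z.2.A) h)
      (congrArg (fun z => z.2.v) h) (congrArg (fun z => z.2.B) h) (congrArg (fun z => z.1.B) h)
  · rintro ⟨⟨A', v', B', h', hA', hv'⟩, ⟨A, v, B, h, hA, hv⟩⟩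
    dsimp only at h
    subst h
    refine ⟨⟨A', A, v, B, B', by simpa using h', hA', hA, ?_, hv⟩,
      sigmaSplit_ext rfl rfl rfl rfl rfl rfl⟩
    simp only [List.count_append] at hv'
    omega

instance (w : List Letter) (i j n l : ℕ) : Finite (Nest w i j n l) := by
  rcases n with _ | n
  · have : IsEmpty (Nest w i j 0 l) := ⟨fun e => by have := e.hD; omega⟩
    infer_instance
  · exact Finite.of_injective _ (Nest.toR_bijective (b := n + l) (by omega)).1

noncomputable instance (w : List Letter) (i j n l : ℕ) : Fintype (Nest w i j n l) :=
  Fintype.ofFinite _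

theorem hat_circ_seq (P : GrOperad.{u}) {m n l a b t : ℕ} {p q r pq qr s : ℤ} (i j : ℕ)
    (hj : j < n) (ha : a + 1 = m + n) (hpq : p + q = pq) (ht : t + 1 = a + l)
    (hs : pq + r = s) (hb : b + 1 = n + l) (hqr : q + r = qr) (ht' : t + 1 = m + b)
    (hs' : p + qr = s) (x : hatObj P m p) (y : hatObj P n q) (z : hatObj P l r) :
    hatCirc P (i + j) ht hs (hatCirc P i ha hpq x y) z =
      hatCirc P i ht' hs' x (hatCirc P j hb hqr y z) := by
  ext N d w
  simp only [hatCirc_apply, map_sum, map_zsmul, AddMonoidHom.finsetSum_apply,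
    AddMonoidHom.smul_apply, Finset.smul_sum, smul_smul]
  rw [← Fintype.sum_sigma' (α := fun t : Split w.w (i + j) l => Split (t.left ht pq).w i n),
    ← Fintype.sum_sigma' (α := fun t : Split w.w i b => Split (t.mid qr).w j l)]
  refine ((Nest.toL_bijective hj).sum_comp _).symm.trans
    (Eq.trans ?_ ((Nest.toR_bijective (n := n) hb).sum_comp _))
  refine Finset.sum_congr rfl (fun e _ => ?_)
  refine congrArg₂ _ ?_ ?_
  · rw [← sgn_add, ← sgn_add]
    congr 1
    simp only [Nest.toL, Nest.toR, kap_append, kap_slot]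
    subst hqr
    ring
  · exact P.circ_seq' rfl (by simp [Nest.toL, Nest.toR]) _ _ _ _ _ _ _ _ _ _ _ _
      (hat_same x _ _ rfl) (hat_same y _ _ rfl) (hat_same z _ _ rfl)

/-- The ways to write `w = A v C u D` with prescribed numbers of slots. -/
@[ext] structure Par (w : List Letter) (i k n l : ℕ) where
  (A v C u D : List Letter)
  eq : A ++ v ++ C ++ u ++ D = w
  hA : A.count slot = i
  hC : A.count slot + 1 + C.count slot = k
  hv : v.count slot = n
  hu : u.count slot = l

def Par.toL {w : List Letter} {i k k' n l : ℕ} (hkk : k' + 1 = k + n) (e : Par w i k n l) :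
    Σ t : Split w k' l, Split (t.A ++ slot :: t.B) i n :=
  ⟨⟨e.A ++ e.v ++ e.C, e.u, e.D, by simpa using e.eq, by
      have := e.hC
      have := e.hv
      simp only [List.count_append]
      omega, e.hu⟩,
    ⟨e.A, e.v, e.C ++ slot :: e.D, by simp, e.hA, e.hv⟩⟩

theorem Par.toL_bijective {w : List Letter} {i k k' n l : ℕ} (hik : i < k)
    (hkk : k' + 1 = k + n) :
    Function.Bijective (Par.toL (w := w) (i := i) (l := l) hkk) := by
  constructor
  · intro e e' h
    have h₁ : e.A = e'.A := congrArg (fun z => z.2.A) h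
    have h₂ : e.v = e'.v := congrArg (fun z => z.2.v) h
    have h₃ : e.A ++ e.v ++ e.C = e'.A ++ e'.v ++ e'.C := congrArg (fun z => z.1.A) h
    rw [h₁, h₂] at h₃
    exact Par.ext h₁ h₂ (List.append_cancel_left h₃) (congrArg (fun z => z.1.v) h)
      (congrArg (fun z => z.1.B) h)
  · rintro ⟨⟨A', v', B', h', hA', hv'⟩, ⟨A, v, B, h, hA, hv⟩⟩
    dsimp only at h
    obtain ⟨C, e₁, e₂⟩ := slot_in_right h (by omega)
    subst e₁ e₂
    refine ⟨⟨A, v, C, v', B', by simpa using h', hA, ?_, hv, hv'⟩,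
      sigmaSplit_ext rfl rfl rfl rfl rfl rfl⟩
    simp only [List.count_append] at hA'
    omega

def Par.toR {w : List Letter} {i k n l : ℕ} (e : Par w i k n l) :
    Σ t : Split w i n, Split (t.A ++ slot :: t.B) k l :=
  ⟨⟨e.A, e.v, e.C ++ e.u ++ e.D, by simpa using e.eq, e.hA, e.hv⟩,
    ⟨e.A ++ slot :: e.C, e.u, e.D, by simp, by
      have := e.hC
      simp only [List.count_append, List.count_cons_self]
      omega, e.hu⟩⟩

theorem Par.toR_injective {w : List Letter} {i k n l : ℕ} :
    Function.Injective (Par.toR (w := w) (i := i) (k := k) (n := n) (l := l)) := by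
  intro e e' h
  have h₁ : e.A = e'.A := congrArg (fun z => z.1.A) h
  have h₃ : e.A ++ slot :: e.C = e'.A ++ slot :: e'.C := congrArg (fun z => z.2.A) h
  rw [h₁] at h₃
  exact Par.ext h₁ (congrArg (fun z => z.1.v) h)
    (List.cons.inj (List.append_cancel_left h₃)).2 (congrArg (fun z => z.2.v) h)
    (congrArg (fun z => z.2.B) h)

instance (w : List Letter) (i k n l : ℕ) : Finite (Par w i k n l) :=
  Finite.of_injective _ Par.toR_injective

theorem Par.toR_bijective {w : List Letter} {i k n l : ℕ} (hik : i < k) :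
    Function.Bijective (Par.toR (w := w) (i := i) (k := k) (n := n) (l := l)) := by
  refine ⟨Par.toR_injective, ?_⟩
  rintro ⟨⟨A', v', B', h', hA', hv'⟩, ⟨A, v, B, h, hA, hv⟩⟩
  dsimp only at h
  obtain ⟨C, e₁, e₂⟩ := slot_in_left h (by omega)
  subst e₁ e₂
  refine ⟨⟨A', v', C, v, B, by simpa using h', hA', ?_, hv', hv⟩,
    sigmaSplit_ext rfl rfl rfl rfl rfl rfl⟩
  simp only [List.count_append, List.count_cons_self] at hA
  omega

noncomputable instance (w : List Letter) (i k n l : ℕ) : Fintype (Par w i k n l) :=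
  Fintype.ofFinite _

theorem hat_circ_par (P : GrOperad.{u}) {m n l a b t : ℕ} {p q r pq pr s : ℤ} (i k k' : ℕ)
    (hik : i < k) (ha : a + 1 = m + n) (hpq : p + q = pq) (hkk : k' + 1 = k + n)
    (ht : t + 1 = a + l) (hs : pq + r = s) (hb : b + 1 = m + l) (hpr : p + r = pr)
    (ht' : t + 1 = b + n) (hs' : pr + q = s) (x : hatObj P m p) (y : hatObj P n q)
    (z : hatObj P l r) :
    hatCirc P k' ht hs (hatCirc P i ha hpq x y) z =
      sgn (q * r) • hatCirc P i ht' hs' (hatCirc P k hb hpr x z) y := by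
  ext N d w
  change _ = sgn (q * r) • (hatCirc P i ht' hs' (hatCirc P k hb hpr x z) y).1 N d w
  simp only [hatCirc_apply, map_sum, map_zsmul, AddMonoidHom.finsetSum_apply,
    AddMonoidHom.smul_apply, Finset.smul_sum, smul_smul]
  rw [← Fintype.sum_sigma' (α := fun t : Split w.w k' l => Split (t.left ht pq).w i n),
    ← Fintype.sum_sigma' (α := fun t : Split w.w i n => Split (t.left ht' pr).w k l)]
  refine ((Par.toL_bijective hik hkk).sum_comp _).symm.trans
    (Eq.trans ?_ ((Par.toR_bijective hik).sum_comp _))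
  refine Finset.sum_congr rfl (fun e _ => ?_)
  refine P.circ_par' rfl ?_ ?_ _ _ _ _ _ _ _ _ _ _ _ _
      (hat_same x _ _ ?_) (hat_same y _ _ rfl) (hat_same z _ _ rfl) ?_
  · simp only [Par.toL, Par.toR, List.length_append, List.length_cons]
    omega
  · simp only [Par.toL, Par.toR, List.length_append, List.length_cons]
    omega
  · simp [Par.toL, Par.toR, Split.left]
  · rw [← sgn_add, ← sgn_add, ← sgn_add, ← sgn_add]
    refine sgn_congr ⟨(r * kap e.v), ?_⟩
    simp only [Par.toL, Par.toR, kap_append, kap_slot]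
    ring

/-- The completed coproduct of the graded operads `P` and `T`. -/
noncomputable def GrOperad.hat (P : GrOperad.{u}) : GrOperad.{u} where
  obj n p := hatObj P n p
  one := hatOne P
  circ i _ hk hr := hatCirc P i hk hr
  one_circ _ hk hr x := hat_one_circ P hk hr x
  circ_one i hi hk hr x := hat_circ_one P i hi hk hr x
  circ_seq i j _ hj ha hpq _ ht hs hb hqr ht' hs' x y z :=
    hat_circ_seq P i j hj ha hpq ht hs hb hqr ht' hs' x y z
  circ_par i k k' hik _ _ ha hpq hkk _ ht hs hb hpr _ ht' hs' x y z :=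
    hat_circ_par P i k k' hik ha hpq hkk ht hs hb hpr ht' hs' x y z

/-- The ways to write `w = A κ B`. -/
@[ext] structure KSplit (w : List Letter) where
  (A B : List Letter)
  eq : A ++ ka :: B = w

instance (w : List Letter) : Finite (KSplit w) := by
  refine Finite.of_injective (fun t => (⟨t.A.length, ?_⟩ : Fin w.length)) ?_
  · have := congrArg List.length t.eq
    simp only [List.length_append, List.length_cons] at this
    omega
  · intro t t' h
    obtain ⟨e₁, e₂⟩ := List.append_inj (t.eq.trans t'.eq.symm) (by simpa using h)
    exact KSplit.ext e₁ (List.cons.inj e₂).2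

noncomputable instance (w : List Letter) : Fintype (KSplit w) := Fintype.ofFinite _

/-- The same word, for an operation of degree one higher. -/
def Word.up {n N : ℕ} {p p' q : ℤ} (hp : p' + 1 = p) (w : Word n p' N q) : Word n p N (q + 1) :=
  ⟨w.w, w.slots_eq, w.length_eq, by have := w.degree_eq; omega⟩

/-- The word `A α B` obtained by replacing one letter `κ` by `α`. -/
def KSplit.word {n N : ℕ} {p p' q : ℤ} (hp : p' + 1 = p) {w : Word n p' N q} (t : KSplit w.w) :
    Word n p N q where
  w := t.A ++ al :: t.B
  slots_eq := by
    have h := congrArg (List.count slot) t.eq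
    rw [w.slots_eq] at h
    simpa using h
  length_eq := by
    have h := congrArg List.length t.eq
    rw [w.length_eq] at h
    simpa using h
  degree_eq := by
    have h := congrArg kap t.eq
    have h' := w.degree_eq
    simp only [kap_append, kap_ka, kap_al] at *
    omega

/-- The differential `d_P + d_T` of the completed coproduct, where `d_T α = κ`:
`d (c(w)) = (d_P c)(w) + ∑_{w = A α B} ± c(A κ B)`, where the sign is the Koszul sign for moving
`d_T` past `c` and the letters of `A`. -/
noncomputable def hatDFun (P : DGOperad.{u}) {n : ℕ} {p p' : ℤ} (hp : p' + 1 = p)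
    (x : hatObj P.toGrOperad n p) (N : ℕ) (q : ℤ) (w : Word n p' N q) : P.obj N q :=
  P.d rfl (x.1 _ _ (w.up hp)) +
    ∑ t : KSplit w.w, sgn (p + (kap t.A + kap t.B) + kap t.A) • x.1 _ _ (t.word hp)

theorem hatDFun_mem (P : DGOperad.{u}) {n : ℕ} {p p' : ℤ} (hp : p' + 1 = p)
    (x : hatObj P.toGrOperad n p) : hatDFun P hp x ∈ hatObj P.toGrOperad n p' := by
  obtain ⟨B, hB⟩ := x.2
  refine ⟨B + 1, fun N q w h => ?_⟩
  unfold hatDFun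
  rw [hB _ _ (w.up hp) (show B < kap w.w by omega), map_zero, zero_add]
  refine Finset.sum_eq_zero (fun t _ => ?_)
  have e := congrArg kap t.eq
  simp only [kap_append, kap_ka] at e
  rw [hB _ _ (t.word hp) (by simp only [KSplit.word, kap_append, kap_al]; omega), smul_zero]

noncomputable def hatD (P : DGOperad.{u}) {n : ℕ} {p p' : ℤ} (hp : p' + 1 = p) :
    hatObj P.toGrOperad n p →+ hatObj P.toGrOperad n p' :=
  AddMonoidHom.mk' (fun x => ⟨hatDFun P hp x, hatDFun_mem P hp x⟩) (fun x y => by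
    ext N q w
    simp only [hatDFun, AddSubgroup.coe_add, Pi.add_apply, map_add, smul_add,
      Finset.sum_add_distrib]
    abel)

theorem hatD_apply (P : DGOperad.{u}) {n : ℕ} {p p' : ℤ} (hp : p' + 1 = p)
    (x : hatObj P.toGrOperad n p) (N : ℕ) (q : ℤ) (w : Word n p' N q) :
    (hatD P hp x).1 N q w = P.d rfl (x.1 _ _ (w.up hp)) +
      ∑ t : KSplit w.w, sgn (p + (kap t.A + kap t.B) + kap t.A) • x.1 _ _ (t.word hp) := rfl

theorem SameOp.eq {P : GrOperad.{u}} {N : ℕ} {q : ℤ} {x x' : P.obj N q} (h : SameOp P x x') :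
    x = x' := eq_of_heq h.heq

/-- The ways to write `w = A κ C κ B`. -/
@[ext] structure KK (w : List Letter) where
  (A C B : List Letter)
  eq : A ++ ka :: (C ++ ka :: B) = w

def KK.toS {w : List Letter} : KK w ⊕ KK w → Σ t : KSplit w, KSplit (t.A ++ al :: t.B)
  | .inl e => ⟨⟨e.A, e.C ++ ka :: e.B, e.eq⟩, ⟨e.A ++ al :: e.C, e.B, by simp⟩⟩
  | .inr e => ⟨⟨e.A ++ ka :: e.C, e.B, by simpa using e.eq⟩, ⟨e.A, e.C ++ al :: e.B, by simp⟩⟩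

theorem letter_cases {c : Letter} {a b A B : List Letter} (h : a ++ b = A ++ c :: B) :
    (∃ C, a = A ++ c :: C ∧ B = C ++ b) ∨ ∃ C, A = a ++ C ∧ b = C ++ c :: B := by
  rcases List.append_eq_append_iff.1 h with ⟨C, e, hC⟩ | ⟨C, e, hC⟩
  · exact Or.inr ⟨C, e, hC⟩
  · rcases C with _ | ⟨c', C⟩
    · exact Or.inr ⟨[], by simpa using e.symm, by simpa using hC.symm⟩
    · simp only [List.cons_append, List.cons.injEq] at hC
      obtain ⟨rfl, hC⟩ := hC
      exact Or.inl ⟨C, e, hC⟩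

theorem letter_cases' {c c' : Letter} (hc : c' ≠ c) {a b A B : List Letter}
    (h : a ++ c' :: b = A ++ c :: B) :
    (∃ C, a = A ++ c :: C ∧ B = C ++ c' :: b) ∨ ∃ C, A = a ++ c' :: C ∧ b = C ++ c :: B := by
  rcases letter_cases h with h | ⟨C, e, hC⟩
  · exact Or.inl h
  · rcases C with _ | ⟨d, C⟩
    · simp only [List.nil_append, List.cons.injEq] at hC
      exact absurd hC.1 hc
    · simp only [List.cons_append, List.cons.injEq] at hC
      obtain ⟨rfl, hC⟩ := hC
      exact Or.inr ⟨C, e, hC⟩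

theorem sigmaKK_ext {w : List Letter} {f : KSplit w → List Letter} :
    ∀ {u v : Σ t : KSplit w, KSplit (f t)},
    u.1.A = v.1.A → u.1.B = v.1.B → u.2.A = v.2.A → u.2.B = v.2.B → u = v := by
  rintro ⟨⟨A, B, h⟩, s⟩ ⟨⟨A', B', h'⟩, s'⟩ h₁ h₂ h₃ h₄
  dsimp only at h₁ h₂
  subst h₁ h₂
  obtain rfl : s = s' := KSplit.ext h₃ h₄
  rfl

theorem KK.toS_bijective {w : List Letter} : Function.Bijective (KK.toS (w := w)) := by
  constructor
  · intro e e' h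
    have h₁ := congrArg (fun z => z.1.A) h
    have h₂ := congrArg (fun z => z.1.B) h
    have h₃ := congrArg (fun z => z.2.A) h
    have h₄ := congrArg (fun z => z.2.B) h
    rcases e with e | e <;> rcases e' with e' | e' <;> simp only [KK.toS] at h₁ h₂ h₃ h₄
    · rw [h₁] at h₃
      exact congrArg _ (KK.ext h₁ (List.cons.inj (List.append_cancel_left h₃)).2 h₄)
    · have l₁ := congrArg List.length h₁
      have l₃ := congrArg List.length h₃
      simp only [List.length_append, List.length_cons] at l₁ l₃
      omega
    · have l₁ := congrArg List.length h₁
      have l₃ := congrArg List.length h₃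
      simp only [List.length_append, List.length_cons] at l₁ l₃
      omega
    · rw [h₃] at h₁
      exact congrArg _ (KK.ext h₃ (List.cons.inj (List.append_cancel_left h₁)).2 h₂)
  · rintro ⟨⟨A, B, h⟩, ⟨A', B', h'⟩⟩
    dsimp only at h'
    rcases letter_cases' (by decide) h'.symm with ⟨C, e₁, e₂⟩ | ⟨C, e₁, e₂⟩
    · subst e₁ e₂
      exact ⟨.inr ⟨A', C, B, by simpa using h⟩, sigmaKK_ext rfl rfl rfl rfl⟩
    · subst e₁ e₂
      exact ⟨.inl ⟨A, C, B', h⟩, sigmaKK_ext rfl rfl rfl rfl⟩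

instance (w : List Letter) : Finite (KK w) :=
  Finite.of_injective _ (KK.toS_bijective.1.comp Sum.inl_injective)

noncomputable instance (w : List Letter) : Fintype (KK w) := Fintype.ofFinite _

theorem DGOperad.d_same (P : DGOperad.{u}) {N N' : ℕ} {p p' q q' : ℤ} (hp : q + 1 = p)
    (hp' : q' + 1 = p') {x : P.obj N p} {x' : P.obj N' p'} (h : SameOp P.toGrOperad x x') :
    SameOp P.toGrOperad (P.d hp x) (P.d hp' x') := by
  obtain ⟨rfl, rfl, h⟩ := h
  obtain rfl := eq_of_heq h
  obtain rfl : q = q' := by omega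
  exact ⟨rfl, rfl, HEq.rfl⟩

theorem hatD_hatD (P : DGOperad.{u}) {n : ℕ} {p q r : ℤ} (hq : q + 1 = p) (hr : r + 1 = q)
    (x : hatObj P.toGrOperad n p) : hatD P hr (hatD P hq x) = 0 := by
  ext N s w
  simp only [hatD_apply, map_add, P.d_d, zero_add, map_sum, map_zsmul, smul_add,
    Finset.sum_add_distrib, Finset.smul_sum, smul_smul]
  rw [← add_assoc, ← Fintype.sum_sigma' (α := fun t : KSplit w.w => KSplit (t.word hr).w)]
  refine (congrArg₂ (· + ·) ?_ ?_).trans (add_zero _)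
  · refine Eq.trans (Finset.sum_add_distrib (s := (Finset.univ : Finset (KSplit w.w)))).symm
      (Finset.sum_eq_zero (fun t _ => ?_))
    rw [(P.d_same rfl rfl (hat_same x (KSplit.word hq (w := w.up hr) t) ((t.word hr).up hq)
      rfl)).eq, ← add_smul]
    have e : sgn (p + (kap t.A + kap t.B) + kap t.A) + sgn (q + (kap t.A + kap t.B) + kap t.A)
        = 0 := by
      rw [← hq, show q + 1 + (kap t.A + kap t.B) + kap t.A
        = q + (kap t.A + kap t.B) + kap t.A + 1 by ring, sgn_succ]
      ring
    rw [e, zero_smul]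
  · refine (KK.toS_bijective.sum_comp _).symm.trans ?_
    rw [Fintype.sum_sum_type, ← Finset.sum_add_distrib]
    refine Finset.sum_eq_zero (fun e _ => ?_)
    rw [(hat_same x (KSplit.word hq (w := KSplit.word hr (KK.toS (.inl e)).1) (KK.toS (.inl e)).2)
      (KSplit.word hq (w := KSplit.word hr (KK.toS (.inr e)).1) (KK.toS (.inr e)).2)
      (by simp [KSplit.word, KK.toS])).eq, ← add_smul]
    refine (congrArg (fun c : ℤ => c • _) ?_).trans (zero_smul _ _)
    rw [← sgn_add, ← sgn_add]
    simp only [KK.toS, kap_append, kap_ka, kap_al]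
    rw [← neg_neg (sgn _), ← sgn_succ, neg_add_eq_zero]
    refine sgn_congr ⟨0, ?_⟩
    ring

/-- The ways to write `w = A κ A' v B` with prescribed numbers of slots. -/
@[ext] structure K₁ (w : List Letter) (i n : ℕ) where
  (A A' v B : List Letter)
  eq : A ++ ka :: A' ++ v ++ B = w
  hA : (A ++ A').count slot = i
  hv : v.count slot = n

/-- The ways to write `w = A v κ v' B` with prescribed numbers of slots. -/
@[ext] structure K₂ (w : List Letter) (i n : ℕ) where
  (A v v' B : List Letter)
  eq : A ++ (v ++ ka :: v') ++ B = w
  hA : A.count slot = i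
  hv : (v ++ v').count slot = n

/-- The ways to write `w = A v B κ B'` with prescribed numbers of slots. -/
@[ext] structure K₃ (w : List Letter) (i n : ℕ) where
  (A v B B' : List Letter)
  eq : A ++ v ++ (B ++ ka :: B') = w
  hA : A.count slot = i
  hv : v.count slot = n

def K₁.toL {w : List Letter} {i n : ℕ} (e : K₁ w i n) :
    Σ t : KSplit w, Split (t.A ++ al :: t.B) i n :=
  ⟨⟨e.A, e.A' ++ e.v ++ e.B, by simpa using e.eq⟩,
    ⟨e.A ++ al :: e.A', e.v, e.B, by simp, by simpa using e.hA, e.hv⟩⟩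

def K₂.toL {w : List Letter} {i n : ℕ} (e : K₂ w i n) :
    Σ t : KSplit w, Split (t.A ++ al :: t.B) i n :=
  ⟨⟨e.A ++ e.v, e.v' ++ e.B, by simpa using e.eq⟩,
    ⟨e.A, e.v ++ al :: e.v', e.B, by simp, e.hA, by simpa using e.hv⟩⟩

def K₃.toL {w : List Letter} {i n : ℕ} (e : K₃ w i n) :
    Σ t : KSplit w, Split (t.A ++ al :: t.B) i n :=
  ⟨⟨e.A ++ e.v ++ e.B, e.B', by simpa using e.eq⟩,
    ⟨e.A, e.v, e.B ++ al :: e.B', by simp, e.hA, e.hv⟩⟩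

def KtoL {w : List Letter} {i n : ℕ} :
    K₁ w i n ⊕ K₂ w i n ⊕ K₃ w i n → Σ t : KSplit w, Split (t.A ++ al :: t.B) i n
  | .inl e => e.toL
  | .inr (.inl e) => e.toL
  | .inr (.inr e) => e.toL

theorem sigmaKS_ext {w : List Letter} {i n : ℕ} {f : KSplit w → List Letter} :
    ∀ {u v : Σ t : KSplit w, Split (f t) i n}, u.1.A = v.1.A → u.1.B = v.1.B →
      u.2.A = v.2.A → u.2.v = v.2.v → u.2.B = v.2.B → u = v := by
  rintro ⟨⟨A, B, h⟩, s⟩ ⟨⟨A', B', h'⟩, s'⟩ h₁ h₂ h₃ h₄ h₅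
  dsimp only at h₁ h₂
  subst h₁ h₂
  obtain rfl : s = s' := Split.ext h₃ h₄ h₅
  rfl

theorem sigmaSK_ext {w : List Letter} {i n : ℕ} {f : Split w i n → List Letter} :
    ∀ {u v : Σ t : Split w i n, KSplit (f t)}, u.1.A = v.1.A → u.1.v = v.1.v →
      u.1.B = v.1.B → u.2.A = v.2.A → u.2.B = v.2.B → u = v := by
  rintro ⟨⟨A, x, B, h, hA, hx⟩, s⟩ ⟨⟨A', x', B', h', hA', hx'⟩, s'⟩ h₁ h₂ h₃ h₄ h₅
  dsimp only at h₁ h₂ h₃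
  subst h₁ h₂ h₃
  obtain rfl : s = s' := KSplit.ext h₄ h₅
  rfl

theorem KtoL_bijective {w : List Letter} {i n : ℕ} :
    Function.Bijective (KtoL (w := w) (i := i) (n := n)) := by
  constructor
  · intro e e' h
    have h₁ := congrArg (fun z => z.1.A) h
    have h₂ := congrArg (fun z => z.1.B) h
    have h₃ := congrArg (fun z => z.2.A) h
    have h₄ := congrArg (fun z => z.2.v) h
    have h₅ := congrArg (fun z => z.2.B) h
    have l₁ := congrArg List.length h₁
    have l₃ := congrArg List.length h₃
    have l₄ := congrArg List.length h₄
    rcases e with e | e | e <;> rcases e' with e' | e' | e' <;>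
      simp only [KtoL, K₁.toL, K₂.toL, K₃.toL, List.length_append, List.length_cons]
        at h₁ h₂ h₃ h₄ h₅ l₁ l₃ l₄ <;> first | (exfalso; omega) | skip
    · rw [h₁] at h₃
      exact congrArg _ (K₁.ext h₁ (List.cons.inj (List.append_cancel_left h₃)).2 h₄ h₅)
    · rw [h₃] at h₁
      rw [h₅] at h₂
      exact congrArg _ (congrArg _ (K₂.ext h₃ (List.append_cancel_left h₁)
        (List.append_cancel_right h₂) h₅))
    · rw [h₃, h₄] at h₁
      exact congrArg _ (congrArg _ (K₃.ext h₃ h₄ (List.append_cancel_left h₁) h₂))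
  · rintro ⟨⟨A', B', h'⟩, ⟨A, v, B, h, hA, hv⟩⟩
    dsimp only at h
    rw [List.append_assoc] at h
    rcases letter_cases h with ⟨C, e₁, e₂⟩ | ⟨C, e₁, e₂⟩
    · subst e₁ e₂
      exact ⟨.inl ⟨A', C, v, B, by simpa using h', by simpa using hA, hv⟩,
        sigmaKS_ext rfl (by simp [KtoL, K₁.toL]) rfl rfl rfl⟩
    · subst e₁
      rcases letter_cases e₂ with ⟨D, e₃, e₄⟩ | ⟨D, e₃, e₄⟩
      · subst e₃ e₄
        exact ⟨.inr (.inl ⟨A, C, D, B, by simpa using h', hA, by simpa using hv⟩),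
          sigmaKS_ext rfl rfl rfl rfl rfl⟩
      · subst e₃ e₄
        exact ⟨.inr (.inr ⟨A, v, D, B', by simpa using h', hA, hv⟩),
          sigmaKS_ext (by simp [KtoL, K₃.toL]) rfl rfl rfl rfl⟩

instance (w : List Letter) (i n : ℕ) : Finite (K₁ w i n) :=
  Finite.of_injective _ (KtoL_bijective.1.comp Sum.inl_injective)

instance (w : List Letter) (i n : ℕ) : Finite (K₂ w i n) :=
  Finite.of_injective _ (KtoL_bijective.1.comp (Sum.inr_injective.comp Sum.inl_injective))

instance (w : List Letter) (i n : ℕ) : Finite (K₃ w i n) :=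
  Finite.of_injective _ (KtoL_bijective.1.comp (Sum.inr_injective.comp Sum.inr_injective))

noncomputable instance (w : List Letter) (i n : ℕ) : Fintype (K₁ w i n) := Fintype.ofFinite _

noncomputable instance (w : List Letter) (i n : ℕ) : Fintype (K₂ w i n) := Fintype.ofFinite _

noncomputable instance (w : List Letter) (i n : ℕ) : Fintype (K₃ w i n) := Fintype.ofFinite _

def K₁.toR {w : List Letter} {i n : ℕ} (e : K₁ w i n) :
    Σ t : Split w i n, KSplit (t.A ++ slot :: t.B) :=
  ⟨⟨e.A ++ ka :: e.A', e.v, e.B, e.eq, by simpa using e.hA, e.hv⟩,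
    ⟨e.A, e.A' ++ slot :: e.B, by simp⟩⟩

def K₃.toR {w : List Letter} {i n : ℕ} (e : K₃ w i n) :
    Σ t : Split w i n, KSplit (t.A ++ slot :: t.B) :=
  ⟨⟨e.A, e.v, e.B ++ ka :: e.B', e.eq, e.hA, e.hv⟩, ⟨e.A ++ slot :: e.B, e.B', by simp⟩⟩

def K₂.toR {w : List Letter} {i n : ℕ} (e : K₂ w i n) : Σ t : Split w i n, KSplit t.v :=
  ⟨⟨e.A, e.v ++ ka :: e.v', e.B, e.eq, e.hA, by simpa using e.hv⟩, ⟨e.v, e.v', rfl⟩⟩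

def KtoR {w : List Letter} {i n : ℕ} :
    K₁ w i n ⊕ K₃ w i n → Σ t : Split w i n, KSplit (t.A ++ slot :: t.B)
  | .inl e => e.toR
  | .inr e => e.toR

theorem KtoR_bijective {w : List Letter} {i n : ℕ} :
    Function.Bijective (KtoR (w := w) (i := i) (n := n)) := by
  constructor
  · intro e e' h
    have h₁ := congrArg (fun z => z.1.A) h
    have h₂ := congrArg (fun z => z.1.v) h
    have h₃ := congrArg (fun z => z.1.B) h
    have h₄ := congrArg (fun z => z.2.A) h
    have h₅ := congrArg (fun z => z.2.B) h
    have l₁ := congrArg List.length h₁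
    have l₄ := congrArg List.length h₄
    rcases e with e | e <;> rcases e' with e' | e' <;>
      simp only [KtoR, K₁.toR, K₃.toR, List.length_append, List.length_cons]
        at h₁ h₂ h₃ h₄ h₅ l₁ l₄ <;> first | (exfalso; omega) | skip
    · rw [h₄] at h₁
      exact congrArg _ (K₁.ext h₄ (List.cons.inj (List.append_cancel_left h₁)).2 h₂ h₃)
    · rw [h₁] at h₄
      exact congrArg _ (K₃.ext h₁ h₂ (List.cons.inj (List.append_cancel_left h₄)).2 h₅)
  · rintro ⟨⟨A, v, B, h, hA, hv⟩, ⟨A', B', h'⟩⟩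
    dsimp only at h'
    rcases letter_cases' (by decide) h'.symm with ⟨C, e₁, e₂⟩ | ⟨C, e₁, e₂⟩
    · subst e₁ e₂
      exact ⟨.inl ⟨A', C, v, B, h, by simpa using hA, hv⟩, sigmaSK_ext rfl rfl rfl rfl rfl⟩
    · subst e₁ e₂
      exact ⟨.inr ⟨A, v, C, B', h, hA, hv⟩, sigmaSK_ext rfl rfl rfl rfl rfl⟩

theorem K₂.toR_bijective {w : List Letter} {i n : ℕ} :
    Function.Bijective (K₂.toR (w := w) (i := i) (n := n)) := by
  constructor
  · intro e e' h
    exact K₂.ext (congrArg (fun z => z.1.A) h) (congrArg (fun z => z.2.A) h)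
      (congrArg (fun z => z.2.B) h) (congrArg (fun z => z.1.B) h)
  · rintro ⟨⟨A, v, B, h, hA, hv⟩, ⟨A', B', h'⟩⟩
    dsimp only at h'
    subst h'
    exact ⟨⟨A, A', B', B, h, hA, by simpa using hv⟩, sigmaSK_ext rfl rfl rfl rfl rfl⟩

theorem GrOperad.circ_same (P : GrOperad.{u}) {m n k m' n' : ℕ} {p q r p' q' : ℤ} {i i' : ℕ}
    (hii : i = i') (hi : i < m) (hk : k + 1 = m + n) (hr : p + q = r) (hi' : i' < m')
    (hk' : k + 1 = m' + n') (hr' : p' + q' = r) {x : P.obj m p} {y : P.obj n q}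
    {x' : P.obj m' p'} {y' : P.obj n' q'} (hx : SameOp P x x') (hy : SameOp P y y') :
    P.circ i hi hk hr x y = P.circ i' hi' hk' hr' x' y' := by
  obtain ⟨rfl, rfl, hx⟩ := hx
  obtain ⟨rfl, rfl, hy⟩ := hy
  obtain rfl := eq_of_heq hx
  obtain rfl := eq_of_heq hy
  subst hii
  rfl

theorem hatD_circ (P : DGOperad.{u}) {m n k : ℕ} {p p' q q' r r' : ℤ} (i : ℕ)
    (hk : k + 1 = m + n)
    (hr : p + q = r) (hp : p' + 1 = p) (hq : q' + 1 = q) (hr' : r' + 1 = r) (h₁ : p' + q = r')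
    (h₂ : p + q' = r') (x : hatObj P.toGrOperad m p) (y : hatObj P.toGrOperad n q) :
    hatD P hr' (hatCirc P.toGrOperad i hk hr x y) =
      hatCirc P.toGrOperad i hk h₁ (hatD P hp x) y +
        sgn p • hatCirc P.toGrOperad i hk h₂ x (hatD P hq y) := by
  ext N s w
  change _ = (hatCirc P.toGrOperad i hk h₁ (hatD P hp x) y).1 N s w +
    sgn p • (hatCirc P.toGrOperad i hk h₂ x (hatD P hq y)).1 N s w
  simp only [hatCirc_apply, hatD_apply, map_add, AddMonoidHom.add_apply, map_sum, map_zsmul,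
    AddMonoidHom.finsetSum_apply, AddMonoidHom.smul_apply, smul_add, Finset.sum_add_distrib,
    Finset.smul_sum, smul_smul]
  rw [← Fintype.sum_sigma' (α := fun t : KSplit w.w => Split (t.word hr').w i n),
    ← Fintype.sum_sigma' (α := fun t : Split w.w i n => KSplit (t.left hk p').w),
    ← Fintype.sum_sigma' (α := fun t : Split w.w i n => KSplit (t.mid q').w)]
  rw [add_add_add_comm]
  refine congrArg₂ (· + ·) ?_ ?_
  · refine Eq.trans ?_ (Finset.sum_add_distrib (s := (Finset.univ : Finset (Split w.w i n))))
    refine Finset.sum_congr rfl (fun t _ => ?_)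
    rw [P.d_circ (p' := p' + (kap t.A + kap t.B)) (q' := q' + kap t.v) _ _ _ _ (by omega)
      (by omega) rfl (by have := Split.degree h₁ t; omega)
      (by have := Split.degree h₂ t; omega), smul_add, smul_smul]
    refine congrArg₂ (· + ·) (congrArg₂ _ rfl ?_) (congrArg₂ _ ?_ ?_)
    · exact P.circ_same rfl _ _ _ _ _ _ (P.d_same _ _ (hat_same x _ _ rfl)) (hat_same y _ _ rfl)
    · rw [← sgn_add, ← sgn_add]
      refine sgn_congr ⟨kap t.A + kap t.B, ?_⟩
      rw [← hq]
      ring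
    · exact P.circ_same rfl _ _ _ _ _ _ (hat_same x _ _ rfl) (P.d_same _ _ (hat_same y _ _ rfl))
  · refine (KtoL_bijective.sum_comp _).symm.trans
      (Eq.trans ?_ (congrArg₂ (· + ·) (KtoR_bijective.sum_comp _) (K₂.toR_bijective.sum_comp _)))
    rw [Fintype.sum_sum_type, Fintype.sum_sum_type, Fintype.sum_sum_type, add_assoc]
    refine congrArg₂ (· + ·) ?_ ((add_comm _ _).trans (congrArg₂ (· + ·) ?_ ?_))
    · refine Finset.sum_congr rfl (fun e _ => congrArg₂ _ ?_ ?_)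
      · simp only [← sgn_add]
        refine sgn_congr ⟨0, ?_⟩
        simp only [KtoL, KtoR, K₁.toL, K₁.toR, kap_append, kap_slot, kap_al, kap_ka]
        rw [← hr, ← hq]
        ring
      · exact P.circ_same (by simp [KtoL, KtoR, K₁.toL, K₁.toR]) _ _ _ _ _ _ (hat_same x _ _ (by simp [Split.left, KSplit.word, KtoL, KtoR, K₁.toL, K₁.toR]))
          (hat_same y _ _ (by simp [Split.mid, KSplit.word, KtoL, KtoR, K₁.toL, K₁.toR]))
    · refine Finset.sum_congr rfl (fun e _ => congrArg₂ _ ?_ ?_)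
      · simp only [← sgn_add]
        refine sgn_congr ⟨0, ?_⟩
        simp only [KtoL, KtoR, K₃.toL, K₃.toR, kap_append, kap_slot, kap_al, kap_ka]
        rw [← hr, ← hq]
        ring
      · exact P.circ_same rfl _ _ _ _ _ _ (hat_same x _ _ (by simp [Split.left, KSplit.word, KtoL, KtoR, K₃.toL, K₃.toR]))
          (hat_same y _ _ (by simp [Split.mid, KSplit.word, KtoL, KtoR, K₃.toL, K₃.toR]))
    · refine Finset.sum_congr rfl (fun e _ => congrArg₂ _ ?_ ?_)
      · simp only [← sgn_add]
        refine sgn_congr ⟨kap e.A, ?_⟩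
        simp only [KtoL, K₂.toL, K₂.toR, kap_append, kap_al, kap_ka]
        rw [← hr, ← hq]
        ring
      · exact P.circ_same rfl _ _ _ _ _ _ (hat_same x _ _ (by simp [Split.left, KSplit.word, KtoL, K₂.toL, K₂.toR]))
          (hat_same y _ _ (by simp [Split.mid, KSplit.word, KtoL, K₂.toL, K₂.toR]))

/-- The completed coproduct of the dg operads `P` and `T`, with the differential `d_P + d_T`. -/
noncomputable def DGOperad.hat (P : DGOperad.{u}) : DGOperad.{u} where
  toGrOperad := P.toGrOperad.hat
  d h := hatD P h
  d_d hq hr x := hatD_hatD P hq hr x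
  d_circ i _ hk hr hp hq hr' h₁ h₂ x y := hatD_circ P i hk hr hp hq hr' h₁ h₂ x y

theorem mem_of_split {w : List Letter} {i n : ℕ} (t : Split w i n) (h : ka ∈ w) :
    ka ∈ t.A ++ slot :: t.B ∨ ka ∈ t.v := by
  rw [← t.eq] at h
  simp only [List.mem_append, List.mem_cons] at *
  tauto

/-- The sub-operad `P ∨̂ [α]` of the completed coproduct: no `κ` occurs. -/
noncomputable def hatAlpha (P : GrOperad.{u}) : SubOperad P.hat where
  carrier n p :=
    { carrier := {x : hatObj P n p | ∀ (N : ℕ) (q : ℤ) (w : Word n p N q), ka ∈ w.w →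
        x.1 N q w = 0}
      zero_mem' := fun _ _ _ _ => rfl
      add_mem' := fun {x y} hx hy N q w h => by
        change x.1 N q w + y.1 N q w = 0
        rw [hx N q w h, hy N q w h, add_zero]
      neg_mem' := fun {x} hx N q w h => by
        change -x.1 N q w = 0
        rw [hx N q w h, neg_zero] }
  one_mem := fun N q w h => dif_neg (fun h' => by
    rw [h'] at h
    simp at h)
  circ_mem := fun {m n k p q r} i hi hk hr x y hx hy N s w h => by
    refine (hatCirc_apply P i hk hr x y N s w).trans (Finset.sum_eq_zero (fun t _ => ?_))
    rcases mem_of_split t h with h' | h'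
    · rw [hx _ _ (t.left hk p) h', map_zero, AddMonoidHom.zero_apply, smul_zero]
    · rw [hy _ _ (t.mid q) h', map_zero, smul_zero]

theorem Word.kappa_index {N : ℕ} {q : ℤ} {w : Word 0 (-1) N q} (h : w.w = [ka]) :
    N = 1 ∧ q = 0 := by
  have h₂ := w.length_eq
  have h₃ := w.degree_eq
  rw [h] at h₂ h₃
  simp at h₂ h₃
  omega

theorem Word.alpha_index {N : ℕ} {q : ℤ} {w : Word 0 (-1) N q} (h : w.w = List.replicate N al) :
    -1 = q := by
  have h₃ := w.degree_eq
  rw [h] at h₃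
  simpa [kap, List.count_replicate] using h₃

/-- The operation `κ` of the completed coproduct. -/
def hatKappa (P : GrOperad.{u}) : hatObj P 0 (-1) :=
  ⟨fun _ _ w => if h : w.w = [ka] then
      P.oneAt (Word.kappa_index h).1 (Word.kappa_index h).2 else 0,
    1, fun N q w h => dif_neg (fun h' => by
      rw [h'] at h
      simp at h)⟩

/-- The operation `∑_{k ≥ 0} μ_k(α, …, α)` of the completed coproduct. -/
def hatMC (P : GrOperad.{u}) (μ : ∀ k, P.obj k (-1)) : hatObj P 0 (-1) :=
  ⟨fun N _ w => if h : w.w = List.replicate N al then (Word.alpha_index h) ▸ μ N else 0,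
    0, fun N q w h => dif_neg (fun h' => by
      rw [h'] at h
      simp [kap, List.count_replicate] at h)⟩

theorem GrOperad.Hom.map_same {P Q : GrOperad.{u}} (f : GrOperad.Hom P Q) {N N' : ℕ} {q q' : ℤ}
    {x : P.obj N q} {x' : P.obj N' q'} (h : SameOp P x x') :
    SameOp Q (f.map N q x) (f.map N' q' x') := by
  obtain ⟨rfl, rfl, h⟩ := h
  obtain rfl := eq_of_heq h
  exact ⟨rfl, rfl, HEq.rfl⟩

theorem GrOperad.Hom.map_oneAt {P Q : GrOperad.{u}} (f : GrOperad.Hom P Q) {N : ℕ} {q : ℤ}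
    (hN : N = 1) (hq : q = 0) : f.map N q (P.oneAt hN hq) = Q.oneAt hN hq := by
  subst hN hq
  exact f.map_one

/-- The map `f ∨ 1_T` on operations: apply `f` to all coefficients. -/
def hatMapFun {P Q : GrOperad.{u}} (f : GrOperad.Hom P Q) (n : ℕ) (p : ℤ) :
    hatObj P n p →+ hatObj Q n p :=
  AddMonoidHom.mk' (fun x => ⟨fun N q w => f.map N q (x.1 N q w), by
      obtain ⟨B, hB⟩ := x.2
      exact ⟨B, fun N q w h => (congrArg (f.map N q) (hB N q w h)).trans (map_zero _)⟩⟩)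
    (fun x y => by
      ext N q w
      exact map_add (f.map N q) _ _)

/-- The morphism `f ∨ 1_T` between completed coproducts. -/
noncomputable def hatMap {P Q : DGOperad.{u}} (f : P ⟶ Q) : P.hat ⟶ Q.hat where
  map n p := hatMapFun f.toHom n p
  map_one := by
    refine Subtype.ext (funext fun N => funext fun q => funext fun w => ?_)
    change f.map N q (dite _ _ _) = dite _ _ _
    split_ifs
    · exact f.toHom.map_oneAt _ _
    · exact map_zero _
  map_circ i hi hk hr x y := by
    refine Subtype.ext (funext fun N => funext fun q => funext fun w => ?_)
    change f.map N q (∑ t : Split w.w i _, _) = ∑ t : Split w.w i _, _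
    rw [map_sum]
    refine Finset.sum_congr rfl (fun t _ => ?_)
    rw [map_zsmul, f.map_circ]
    rfl
  map_d h x := by
    refine Subtype.ext (funext fun N => funext fun q => funext fun w => ?_)
    change f.map N q (_ + ∑ t : KSplit w.w, _) = _ + ∑ t : KSplit w.w, _
    rw [map_add, f.map_d, map_sum]
    refine congrArg₂ _ rfl (Finset.sum_congr rfl (fun t _ => ?_))
    rw [map_zsmul]
    rfl

/-- The word consisting of `n` slots. -/
def slotWord (n : ℕ) (p : ℤ) : Word n p n p :=
  ⟨List.replicate n slot, by simp, by simp, by simp [kap, List.count_replicate]⟩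

theorem hatCirc_slotWord (P : GrOperad.{u}) {m n k : ℕ} {p q r : ℤ} (i : ℕ) (hi : i < m)
    (hk : k + 1 = m + n) (hr : p + q = r) (x : hatObj P m p) (y : hatObj P n q) :
    (hatCirc P i hk hr x y).1 k r (slotWord k r) =
      P.circ i hi hk hr (x.1 m p (slotWord m p)) (y.1 n q (slotWord n q)) := by
  rw [hatCirc_apply]
  have e : List.replicate i slot ++ List.replicate n slot ++ List.replicate (m - 1 - i) slot =
      (slotWord k r).w := by
    simp only [slotWord, List.replicate_append_replicate]
    congr 1
    omega
  rw [Fintype.sum_eq_single (⟨List.replicate i slot, List.replicate n slot,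
    List.replicate (m - 1 - i) slot, e, by simp, by simp⟩ : Split (slotWord k r).w i n)]
  · have h0 : ∀ j, kap (List.replicate j slot) = 0 := fun j => by
      simp [kap, List.count_replicate]
    simp only [h0]
    rw [show sgn ((q + 0) * (0 + 0) + 0 * 0) = 1 by simp [sgn], one_smul]
    refine P.circ_same (by simp) _ _ _ _ _ _ (hat_same x _ (slotWord m p) ?_)
      (hat_same y _ (slotWord n q) rfl)
    simp only [Split.left, slotWord, ← List.replicate_succ, List.replicate_append_replicate]
    congr 1
    omega
  · intro t ht
    exfalso
    apply ht
    have hall : ∀ c ∈ t.A ++ t.v ++ t.B, c = slot := by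
      rw [t.eq]
      exact fun c hc => List.eq_of_mem_replicate hc
    have hr' : ∀ l : List Letter, (∀ c ∈ l, c = slot) → l = List.replicate (l.count slot) slot :=
      fun l hl => by
        rw [List.count_eq_length.2 (fun c hc => (hl c hc).symm)]
        exact List.eq_replicate_of_mem hl
    have hA := hr' t.A (fun c hc => hall c (by simp [hc]))
    have hv := hr' t.v (fun c hc => hall c (by simp [hc]))
    have hB := hr' t.B (fun c hc => hall c (by simp [hc]))
    have hc := congrArg (List.count slot) t.eq
    rw [(slotWord k r).slots_eq] at hc
    simp only [List.count_append, t.hA, t.hv] at hc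
    rw [t.hA] at hA
    rw [t.hv] at hv
    rw [show t.B.count slot = m - 1 - i by omega] at hB
    exact Split.ext hA hv hB

theorem hatD_slotWord (P : DGOperad.{u}) {n : ℕ} {p q : ℤ} (h : q + 1 = p)
    (x : hatObj P.toGrOperad n p) :
    (hatD P h x).1 n q (slotWord n q) = P.d h (x.1 n p (slotWord n p)) := by
  rw [hatD_apply]
  have : IsEmpty (KSplit (slotWord n q).w) := ⟨fun t => by
    have h' : ka ∈ (slotWord n q).w := by
      rw [← t.eq]
      simp
    simpa [slotWord] using List.eq_of_mem_replicate h'⟩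
  rw [Finset.univ_eq_empty, Finset.sum_empty, add_zero]
  refine SameOp.eq (P.d_same _ _ ?_)
  exact hat_same x _ _ rfl

theorem hatOne_slotWord (P : GrOperad.{u}) : (hatOne P).1 1 0 (slotWord 1 0) = P.one := by
  unfold hatOne
  dsimp only
  rw [dif_pos (show (slotWord 1 0).w = [slot] from rfl)]
  rfl

/-- The morphism `1_P ∨ 0` from the completed coproduct to `P`: `α` and `κ` are sent to zero. -/
noncomputable def hatCounit (P : DGOperad.{u}) : P.hat ⟶ P where
  map n p := AddMonoidHom.mk' (fun x : hatObj P.toGrOperad n p => x.1 n p (slotWord n p))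
    (fun _ _ => rfl)
  map_one := hatOne_slotWord P.toGrOperad
  map_circ i hi hk hr x y := hatCirc_slotWord P.toGrOperad i hi hk hr x y
  map_d h x := hatD_slotWord P h x

end Hat

section Functors

open Limits

/-- The image of `μ k` under the structure morphism of a dg operad under `cA∞`. -/
noncomputable def underMu (P : Under cAinf.{u}) (k : ℕ) : P.right.obj k (-1) :=
  (show cAinf ⟶ P.right from P.hom).map k (-1) (cAinf.mu k)

/-- The element `κ + ∑_{k ≥ 0} μ_k(α, …, α)`. -/
noncomputable def twistedKappa (P : Under cAinf.{u}) : P.right.hat.obj 0 (-1) :=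
  hatKappa P.right.toGrOperad + hatMC P.right.toGrOperad (underMu P)

/-- The quadruple `(cA∞, d, μ₀, ⟨μ_i⟩_{i > 0})`. -/
noncomputable def cAinfCurv (h : IsCurv cAinf.{u} (cAinf.mu 0) cAinf.sub) : Curv.{u} :=
  ⟨cAinf, cAinf.mu 0, cAinf.sub, h⟩

/-- The forgetful functor from `Curv` to dg operads under `cA∞`: an object `(Q, d_Q, κ, Q₀)` is sent
to the dg operad `(Q, d_Q)`, with the structure morphism underlying the unique morphism in `Curv`
from the initial object. -/
noncomputable def forgetful {h : IsCurv cAinf.{u} (cAinf.mu 0) cAinf.sub}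
    (init : IsInitial (cAinfCurv h)) : Curv.{u} ⥤ Under cAinf.{u} where
  obj X := Under.mk (Y := X.Q) (Curv.Hom.hom (init.to X))
  map {X Y} f := Under.homMk (Curv.Hom.hom f)
    (congrArg Curv.Hom.hom (init.hom_ext (init.to X ≫ f) (init.to Y)))

theorem hatMap_twistedKappa {P P' : Under cAinf.{u}} (f : P ⟶ P') :
    (hatMap f.right).map 0 (-1) (twistedKappa P) = twistedKappa P' := by
  have hμ : ∀ k, f.right.toHom.map k (-1) (underMu P k) = underMu P' k := fun k =>
    congrArg (fun g : cAinf ⟶ P'.right => g.map k (-1) (cAinf.mu k)) (Under.w f)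
  refine Subtype.ext (funext fun N => funext fun q => funext fun w => ?_)
  change f.right.toHom.map N q (dite _ _ _ + dite _ _ _) = dite _ _ _ + dite _ _ _
  rw [map_add]
  refine congrArg₂ _ ?_ ?_
  · split_ifs
    · exact f.right.toHom.map_oneAt _ _
    · exact map_zero _
  · split_ifs with h
    · obtain rfl := Word.alpha_index h
      exact hμ N
    · exact map_zero _

/-- The functor `P ↦ (P ∨̂ T, d_P + d_T, κ + ∑ μ_k(α, …, α), P ∨̂ [α])`, `f ↦ f ∨ 1_T`. -/
noncomputable def twisting
    (h : ∀ P : Under cAinf.{u},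
      IsCurv P.right.hat (twistedKappa P) (hatAlpha P.right.toGrOperad)) :
    Under cAinf.{u} ⥤ Curv.{u} where
  obj P := ⟨P.right.hat, twistedKappa P, hatAlpha P.right.toGrOperad, h P⟩
  map f := ⟨hatMap f.right, hatMap_twistedKappa f, fun n p x hx N q w hw => by
    change f.right.toHom.map N q _ = 0
    rw [hx N q w hw, map_zero]⟩

end Functors

end CurvedOperad

open CurvedOperad

namespace CurvedOperad

open Letter

/-! Everything rests on an operator of differentiation. If `(Q, d, κ, Q₀)` is an object of `Curv`,
the weight one part of `d x`, for `x` in `Q₀`, can be written in exactly one way as `± ∑ D_a x ∘ κ`,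
where `D_a x` lies in `Q₀` and has a new input with `a` inputs on its left (`IsCurv.der`, `d_eq`,
`der_unique`). Uniqueness uses the freeness of `Q` over `Q₀` and `κ`: the coproduct property,
applied to the completed coproduct of `Q₀` with `T`, gives a morphism out of `Q` whose coefficients
recover `c` from `c ∘ κ`. The Leibniz rule for `d` gives one for `D` (`der_circ`), and the weight
two part of `d² = 0`, where `d₁ κ = 0` enters, says that new inputs may be created in any order
(`der_der`). Morphisms of `Curv` commute with `D` (`map_der`).

Initiality. Put `μ₀ = κ`, define `μ₁` by `d κ = -μ₁ ∘ κ`, and let `μ_{n+1} = D_0 μ_n`. By the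
commutation of the `D_a`, every `D_a` sends `μ_n` to `μ_{n+1}` when `n ≥ 1` (`der_mu`). Let `e_n` be
the defect of the `n`-th curved A-infinity relation. It vanishes for `n = 0`; for `n ≥ 1` it lies in
`Q₀`, because the weight one terms cancel. If `e_k = 0` for `k ≤ n`, then `d² μ_n = 0` together with
the formal cancellation of cubic terms leaves `∑ e_{n+1} ∘ κ = 0`, so that `e_{n+1} = 0` (`d_mu`).
Hence there is a morphism out of the curved A-infinity operad. It is the only one, since its
generators are its own `μ_n` (`cAinf_mu_eq`) and morphisms preserve the `μ_n` (`map_mu`).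

The quadruple `R(P)`. Splitting off the leftmost `κ` shows that the completed coproduct is freely
generated by `κ` over the part without `κ` (`hat_coproduct`). Translating `κ` by the element `m = ∑
μ_k(α, …, α)` of that part preserves this property, and makes `d κ` homogeneous of weight one
(`hatD_hatTwist`). The operator `D_a` of `R(P)` replaces an `α` by a slot (`hat_der`).

The adjunction. An operation of `P` completed by `α` is therefore a Taylor series: its coefficients
are the values of the counit on its iterated derivatives, and it vanishes as soon as all of these do
(`hat_coinduction`). A morphism `F` to `R(P)` over `f` commutes with `D`, so it is determined by `f`
(`hatLift_unique`), and its value at `x` in `Q₀` has to be the series with coefficients `f(D ⋯ D x)`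
(`hatTaylor`). That this formula respects units, compositions and differentials is shown by
coinduction: the defect of each identity belongs to a family of operations which the counit kills
and which is stable under `D` up to sums (`hatTaylor_one`, `hatTaylor_circ`, `exists_hatLift`). -/

theorem sgn_zero : sgn 0 = 1 := by simp [sgn]

theorem sgn_one : sgn 1 = -1 := by simp [sgn]

theorem sgn_neg_one : sgn (-1) = -1 := by simp [sgn]

theorem sgn_neg (a : ℤ) : sgn (-a) = sgn a := sgn_congr ⟨-a, by ring⟩

theorem sgn_smul_sgn_smul {A : Type*} [AddCommGroup A] (a : ℤ) (x : A) :
    sgn a • sgn a • x = x := by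
  rw [smul_smul, sgn_mul_self, one_smul]

theorem sgn_add_smul {A : Type*} [AddCommGroup A] (a b : ℤ) (x : A) :
    sgn (a + b) • sgn a • sgn b • x = x := by
  rw [smul_smul (sgn a), ← sgn_add, sgn_smul_sgn_smul]

/-! ### Transport along equalities of indices, morphisms and sub-operads -/

/-- Transport of operations along equalities of indices. -/
def GrOperad.cast (P : GrOperad.{u}) {N N' : ℕ} {q q' : ℤ} (hN : N = N') (hq : q = q') :
    P.obj N q →+ P.obj N' q' := by
  subst hN hq
  exact AddMonoidHom.id _

@[simp] theorem GrOperad.cast_rfl (P : GrOperad.{u}) {N : ℕ} {q : ℤ} (hN : N = N) (hq : q = q)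
    (x : P.obj N q) : P.cast hN hq x = x := rfl

/-- Composition of morphisms of graded operads. -/
def GrOperad.Hom.comp {P Q R : GrOperad.{u}} (g : GrOperad.Hom Q R) (f : GrOperad.Hom P Q) :
    GrOperad.Hom P R where
  map n p := (g.map n p).comp (f.map n p)
  map_one := by simp [f.map_one, g.map_one]
  map_circ i hi hk hr x y := by simp [f.map_circ, g.map_circ]

/-- The identity morphism of a graded operad. -/
def GrOperad.Hom.id (P : GrOperad.{u}) : GrOperad.Hom P P where
  map _ _ := AddMonoidHom.id _
  map_one := rfl
  map_circ _ _ _ _ _ _ := rfl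

/-- The inclusion of a sub-operad. -/
def SubOperad.incl {P : GrOperad.{u}} (S : SubOperad P) : GrOperad.Hom S.toGrOperad P where
  map n p := (S.carrier n p).subtype
  map_one := rfl
  map_circ _ _ _ _ _ _ := rfl

/-- The restriction of the codomain of a morphism to a sub-operad. -/
def GrOperad.Hom.codRestrict {P Q : GrOperad.{u}} (f : GrOperad.Hom P Q) (S : SubOperad Q)
    (hf : ∀ n p x, f.map n p x ∈ S.carrier n p) : GrOperad.Hom P S.toGrOperad where
  map n p := (f.map n p).codRestrict (S.carrier n p) (hf n p)
  map_one := Subtype.ext f.map_one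
  map_circ i hi hk hr x y := Subtype.ext (f.map_circ i hi hk hr x y)

/-- The sub-operad on which two morphisms agree. -/
def GrOperad.Hom.eqSub {P Q : GrOperad.{u}} (f g : GrOperad.Hom P Q) : SubOperad P where
  carrier n p := (f.map n p).eqLocus (g.map n p)
  one_mem := f.map_one.trans g.map_one.symm
  circ_mem i hi hk hr x y hx hy := by
    change f.map _ _ _ = g.map _ _ _
    rw [f.map_circ, g.map_circ, show f.map _ _ x = g.map _ _ x from hx,
      show f.map _ _ y = g.map _ _ y from hy]

/-- The Leibniz rule for `1 ∘ 1 = 1` reads `d 1 = d 1 + d 1`. -/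
theorem DGOperad.d_one (P : DGOperad.{u}) {q : ℤ} (h : q + 1 = 0) : P.d h P.one = 0 := by
  obtain rfl : q = -1 := by omega
  have e := P.d_circ (r' := -1) 0 zero_lt_one (rfl : 1 + 1 = 1 + 1) (add_zero (0 : ℤ)) h h h (by omega)
    (by omega) P.one P.one
  rw [P.one_circ, P.circ_one, sgn_zero, one_smul, P.one_circ] at e
  simpa using e

/-! ### Commuting a nullary insertion with another insertion -/

section Kappa

variable (P : GrOperad.{u}) (κ : P.obj 0 (-1))

/-- Insertion of an operation to the right of an inserted nullary operation. -/
theorem GrOperad.circ_kappa_le {m n l a t : ℕ} {p q p' r s : ℤ} (i k : ℕ) (hki : k ≤ i)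
    (hk : k < m) (hl : l + 1 = m + 0) (hp' : p + -1 = p') (hi : i < l) (ht : t + 1 = l + n)
    (hs : p' + q = s) (hi' : i + 1 < m) (ha : a + 1 = m + n) (hr : p + q = r) (hka : k < a)
    (ht' : t + 1 = a + 0) (hs' : r + -1 = s) (c : P.obj m p) (y : P.obj n q) :
    P.circ i hi ht hs (P.circ k hk hl hp' c κ) y =
      sgn q • P.circ k hka ht' hs' (P.circ (i + 1) hi' ha hr c y) κ := by
  rw [P.circ_par k (i + 1) i (by omega) hk hi' hl hp' (by omega) hi ht hs ha hr hka ht' hs']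
  congr 1
  rw [neg_one_mul, sgn_neg]

/-- Insertion of an operation to the left of an inserted nullary operation. -/
theorem GrOperad.circ_kappa_gt {m n l a t : ℕ} {p q p' r s : ℤ} (i k k' : ℕ) (hik : i < k)
    (hkk : k' + 1 = k + n)
    (hk : k < m) (hl : l + 1 = m + 0) (hp' : p + -1 = p') (hi : i < l) (ht : t + 1 = l + n)
    (hs : p' + q = s) (hi' : i < m) (ha : a + 1 = m + n) (hr : p + q = r) (hka : k' < a)
    (ht' : t + 1 = a + 0) (hs' : r + -1 = s) (c : P.obj m p) (y : P.obj n q) :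
    P.circ i hi ht hs (P.circ k hk hl hp' c κ) y =
      sgn q • P.circ k' hka ht' hs' (P.circ i hi' ha hr c y) κ := by
  rw [P.circ_par i k k' hik hi' hk ha hr hkk hka ht' hs' hl hp' hi ht hs, smul_smul,
    mul_neg_one, sgn_neg, sgn_mul_self, one_smul]

end Kappa

/-! ### Coefficients of an insertion of `κ` in the completed coproduct -/

/-- The word `A slot B` obtained by replacing one letter `κ` by a slot. -/
def KSplit.slotted {k m N : ℕ} {p r s : ℤ} (hk : k + 1 = m + 0) (hr : p + -1 = r)
    {w : Word k r N s} (t : KSplit w.w) : Word m p N s where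
  w := t.A ++ slot :: t.B
  slots_eq := by
    have h := congrArg (List.count slot) t.eq
    rw [w.slots_eq] at h
    simp at h ⊢
    omega
  length_eq := by
    have h := congrArg List.length t.eq
    rw [w.length_eq] at h
    simpa using h
  degree_eq := by
    have h := congrArg kap t.eq
    have h' := w.degree_eq
    simp only [kap_append, kap_ka, kap_slot] at *
    omega

theorem hatKappa_ka (P : GrOperad.{u}) {N : ℕ} {q : ℤ} (w : Word 0 (-1) N q) (h : w.w = [ka]) :
    (hatKappa P).1 N q w = P.oneAt (Word.kappa_index h).1 (Word.kappa_index h).2 := dif_pos h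

theorem hatKappa_ne (P : GrOperad.{u}) {N : ℕ} {q : ℤ} (w : Word 0 (-1) N q) (h : w.w ≠ [ka]) :
    (hatKappa P).1 N q w = 0 := dif_neg h

/-- `hatKappa` has the unit as coefficient of the one-letter word `κ` and zero elsewhere, so only
the splittings `A κ B` survive. The unit has degree zero, hence the only Koszul sign left comes from
moving the letter `κ` past those of `B`. -/
theorem hatCirc_kappa (P : GrOperad.{u}) {m k : ℕ} {p r : ℤ} (i : ℕ)
    (hk : k + 1 = m + 0) (hr : p + -1 = r) (y : hatObj P m p) (N : ℕ) (s : ℤ)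
    (w : Word k r N s) :
    (hatCirc P i hk hr y (hatKappa P)).1 N s w =
      ∑ t : KSplit w.w, if t.A.count slot = i then sgn (kap t.B) • y.1 N s (t.slotted hk hr)
        else 0 := by
  rw [hatCirc_apply, ← Finset.sum_filter]
  refine Eq.trans ?_ (Finset.sum_coe_sort (Finset.univ.filter _) _)
  symm
  refine Fintype.sum_of_injective
    (fun t : ↥(Finset.univ.filter fun t : KSplit w.w => t.A.count slot = i) =>
      (⟨t.1.A, [ka], t.1.B, by simpa using t.1.eq, (Finset.mem_filter.1 t.2).2, rfl⟩ :
      Split w.w i 0)) ?_ _ _ ?_ ?_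
  · intro t t' h
    exact Subtype.ext (KSplit.ext (congrArg Split.A h) (congrArg Split.B h))
  · intro t ht
    have hv : t.v ≠ [ka] := fun hv => ht ⟨⟨⟨t.A, t.B, by have := t.eq; rw [hv] at this; simpa using this⟩,
      Finset.mem_filter.2 ⟨Finset.mem_univ _, t.hA⟩⟩, Split.ext rfl hv.symm rfl⟩
    rw [hatKappa_ne P (t.mid (-1)) hv, map_zero, smul_zero]
  · intro t
    refine congrArg₂ _ ?_ ?_
    · congr 1
      simp
    · rw [hatKappa_ka P _ rfl]
      refine (P.circ_oneAt _ _ _ _ _ _ _ _ (SameOp.heq (P := P) ?_)).symm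
      exact hat_same y _ _ rfl

/-- The value of `y ∘ κ` on a word all of whose relevant letters `κ` but the first one do not
contribute. -/
theorem hatCirc_kappa_single (P : GrOperad.{u}) {m k : ℕ} {p r : ℤ} (i : ℕ)
    (hk : k + 1 = m + 0) (hr : p + -1 = r) (y : hatObj P m p) {N : ℕ} {s : ℤ}
    (w : Word k r N s) (t : KSplit w.w)
    (h : ∀ t' : KSplit w.w, t' ≠ t → t'.A.count slot = i → y.1 N s (t'.slotted hk hr) = 0) :
    (hatCirc P i hk hr y (hatKappa P)).1 N s w =
      if t.A.count slot = i then sgn (kap t.B) • y.1 N s (t.slotted hk hr) else 0 := by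
  rw [hatCirc_kappa]
  refine Fintype.sum_eq_single t (fun t' ht' => ?_)
  split_ifs with hi
  · rw [h t' ht' hi, smul_zero]
  · rfl

theorem hatCirc_kappa_eq_zero (P : GrOperad.{u}) {m k : ℕ} {p r : ℤ} (i : ℕ)
    (hk : k + 1 = m + 0) (hr : p + -1 = r) (y : hatObj P m p) {N : ℕ} {s : ℤ}
    (w : Word k r N s)
    (h : ∀ t' : KSplit w.w, t'.A.count slot = i → y.1 N s (t'.slotted hk hr) = 0) :
    (hatCirc P i hk hr y (hatKappa P)).1 N s w = 0 := by
  rw [hatCirc_kappa]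
  refine Finset.sum_eq_zero (fun t' _ => ?_)
  split_ifs with hi
  · rw [h t' hi, smul_zero]
  · rfl

theorem KSplit.ka_mem {w : List Letter} (t : KSplit w) : ka ∈ w := by
  rw [← t.eq]
  simp

/-- Two decompositions of a word at a letter `κ` are equal or ordered. -/
theorem ka_cases {A B A' B' : List Letter} (h : A ++ ka :: B = A' ++ ka :: B') :
    (A = A' ∧ B = B') ∨ (∃ C, A = A' ++ ka :: C ∧ B' = C ++ ka :: B) ∨
      ∃ C, A' = A ++ ka :: C ∧ B = C ++ ka :: B' := by
  rcases letter_cases h with ⟨C, e₁, e₂⟩ | ⟨C, e₁, e₂⟩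
  · exact Or.inr (Or.inl ⟨C, e₁, e₂⟩)
  · rcases C with _ | ⟨c, C⟩
    · simp only [List.nil_append, List.cons.injEq, true_and, List.append_nil] at e₁ e₂
      exact Or.inl ⟨e₁.symm, e₂⟩
    · simp only [List.cons_append, List.cons.injEq] at e₂
      obtain ⟨rfl, e₂⟩ := e₂
      exact Or.inr (Or.inr ⟨C, e₁, e₂⟩)

theorem kap_eq_zero {w : List Letter} (h : ka ∉ w) : kap w = 0 := by
  simp [kap, List.count_eq_zero_of_not_mem h]

theorem ka_notMem_of_kap {w : List Letter} (h : kap w = 0) : ka ∉ w := by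
  simpa [kap, List.count_eq_zero] using h

theorem kap_replicate_slot (j : ℕ) : kap (List.replicate j slot) = 0 := by
  simp [kap, List.count_replicate]

theorem ka_notMem_replicate_slot (j : ℕ) : ka ∉ List.replicate j slot := fun h => by
  simpa using List.eq_of_mem_replicate h

/-- The value of `y ∘ κ` on a word with exactly one letter `κ`. -/
theorem hatCirc_kappa_one (P : GrOperad.{u}) {m k : ℕ} {p r : ℤ} (i : ℕ)
    (hk : k + 1 = m + 0) (hr : p + -1 = r) (y : hatObj P m p) {N : ℕ} {s : ℤ}
    (w : Word k r N s) (w' : Word m p N s) (A B : List Letter) (hw : w.w = A ++ ka :: B)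
    (hw' : w'.w = A ++ slot :: B) (hA : ka ∉ A) (hB : ka ∉ B) :
    (hatCirc P i hk hr y (hatKappa P)).1 N s w = if A.count slot = i then y.1 N s w' else 0 := by
  rw [hatCirc_kappa_single P i hk hr y w ⟨A, B, hw.symm⟩]
  · rw [kap_eq_zero hB, sgn_zero, one_smul]
    split_ifs
    · exact (hat_same y _ _ hw'.symm).eq
    · rfl
  · rintro ⟨A', B', e⟩ ht _
    exfalso
    rcases ka_cases (e.trans hw) with ⟨rfl, rfl⟩ | ⟨C, -, rfl⟩ | ⟨C, rfl, -⟩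
    · exact ht rfl
    · exact hB (by simp)
    · exact hA (by simp)

/-! ### The inclusion of an operad into its completed coproduct -/

section Incl

variable (P : GrOperad.{u})

theorem Word.slots_index {n : ℕ} {p : ℤ} {N : ℕ} {q : ℤ} {w : Word n p N q}
    (h : w.w = List.replicate n slot) : n = N ∧ p = q := by
  have h₂ := w.length_eq
  have h₃ := w.degree_eq
  rw [h] at h₂ h₃
  rw [kap_replicate_slot] at h₃
  simp at h₂ h₃
  exact ⟨h₂, h₃⟩

/-- The inclusion of `P` into the completed coproduct, on operations. -/
def hatInclFun (n : ℕ) (p : ℤ) : P.obj n p →+ hatObj P n p :=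
  AddMonoidHom.mk' (fun x => ⟨fun N q w => if h : w.w = List.replicate n slot then
      P.cast (Word.slots_index h).1 (Word.slots_index h).2 x else 0, 0, fun N q w hw =>
      dif_neg (fun h' => by
        rw [h', kap_replicate_slot] at hw
        exact lt_irrefl _ hw)⟩)
    (fun x y => by
      ext N q w
      by_cases h : w.w = List.replicate n slot <;> simp [h])

theorem hatInclFun_ne {n : ℕ} {p : ℤ} (x : P.obj n p) {N : ℕ} {q : ℤ} (w : Word n p N q)
    (h : w.w ≠ List.replicate n slot) : (hatInclFun P n p x).1 N q w = 0 := dif_neg h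

theorem hatInclFun_slots {n : ℕ} {p : ℤ} (x : P.obj n p) (w : Word n p n p)
    (h : w.w = List.replicate n slot) : (hatInclFun P n p x).1 n p w = x := dif_pos h

theorem eq_replicate_slot {w : List Letter} {n : ℕ} (hn : w.count slot = n)
    (h : ∀ c ∈ w, c = slot) : w = List.replicate n slot := by
  rw [← hn, List.count_eq_length.2 (fun c hc => (h c hc).symm)]
  exact List.eq_replicate_of_mem h

/-- The inclusion of `P` into the completed coproduct. -/
noncomputable def hatIncl : GrOperad.Hom P P.hat where
  map n p := hatInclFun P n p
  map_one := by
    refine Subtype.ext (funext fun N => funext fun q => funext fun w => ?_)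
    change (hatInclFun P 1 0 P.one).1 N q w = (hatOne P).1 N q w
    by_cases h : w.w = [slot]
    · obtain ⟨rfl, rfl⟩ := Word.unit_index h
      obtain rfl : w = slotWord 1 0 := Word.ext h
      rw [hatOne_slotWord, hatInclFun_slots P _ _ rfl]
    · rw [hatInclFun_ne P _ _ h]
      unfold hatOne
      dsimp only
      rw [dif_neg h]
  map_circ {m n k p q r} i hi hk hr x y := by
    refine Subtype.ext (funext fun N => funext fun s => funext fun w => ?_)
    change (hatInclFun P k r _).1 N s w =
      (hatCirc P i hk hr (hatInclFun P m p x) (hatInclFun P n q y)).1 N s w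
    by_cases h : w.w = List.replicate k slot
    · obtain ⟨rfl, rfl⟩ := Word.slots_index h
      obtain rfl : w = slotWord k r := Word.ext h
      rw [hatCirc_slotWord P i hi, hatInclFun_slots P _ _ rfl, hatInclFun_slots P _ _ rfl,
        hatInclFun_slots P _ _ rfl]
    · rw [hatInclFun_ne P _ _ h, hatCirc_apply]
      refine (Finset.sum_eq_zero (fun t _ => ?_)).symm
      by_cases h₁ : (t.left hk p).w = List.replicate m slot
      · by_cases h₂ : (t.mid q).w = List.replicate n slot
        · refine absurd (eq_replicate_slot w.slots_eq (fun c hc => ?_)) h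
          rw [← t.eq] at hc
          simp only [Split.left, Split.mid] at h₁ h₂
          have h₁' : ∀ c ∈ t.A ++ slot :: t.B, c = slot := fun c hc => by
            rw [h₁] at hc
            exact List.eq_of_mem_replicate hc
          simp only [List.mem_append] at hc
          rcases hc with (hc | hc) | hc
          · exact h₁' c (by simp [hc])
          · rw [h₂] at hc
            exact List.eq_of_mem_replicate hc
          · exact h₁' c (by simp [hc])
        · rw [hatInclFun_ne P _ _ h₂, map_zero, smul_zero]
      · rw [hatInclFun_ne P _ _ h₁, map_zero, AddMonoidHom.zero_apply, smul_zero]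

end Incl

/-- The coefficient of a word, as a homomorphism. -/
noncomputable def hatEval (P : GrOperad.{u}) {n : ℕ} {p : ℤ} {N : ℕ} {q : ℤ} (w : Word n p N q) :
    P.hat.obj n p →+ P.obj N q :=
  AddMonoidHom.mk' (fun x : hatObj P n p => x.1 N q w) (fun _ _ => rfl)

/-- The word with one letter `κ` in position `a` and otherwise only slots. -/
def kWord (a b : ℕ) {n N : ℕ} {p q : ℤ} (hn : a + b = n) (hN : N = n + 1) (hq : q = p + 1) :
    Word n p N q where
  w := List.replicate a slot ++ ka :: List.replicate b slot
  slots_eq := by simpa using hn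
  length_eq := by simp; omega
  degree_eq := by simp [kap_replicate_slot]; omega

/-- The word with two letters `κ` and otherwise only slots. -/
def kkWord (a b c : ℕ) {n N : ℕ} {p q : ℤ} (hn : a + b + c = n) (hN : N = n + 2)
    (hq : q = p + 2) : Word n p N q where
  w := List.replicate a slot ++ ka :: (List.replicate b slot ++ ka :: List.replicate c slot)
  slots_eq := by simp; omega
  length_eq := by simp; omega
  degree_eq := by simp [kap_replicate_slot]; omega

/-! ### Coefficients of operations of low weight -/

namespace IsCurv

variable {Q : DGOperad.{u}} {κ : Q.obj 0 (-1)} {Q₀ : SubOperad Q.toGrOperad}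

theorem hom_ext (h : IsCurv Q κ Q₀) {X : GrOperad.{u}} {φ ψ : GrOperad.Hom Q.toGrOperad X}
    (h₀ : ∀ n p x, x ∈ Q₀.carrier n p → φ.map n p x = ψ.map n p x)
    (hκ : φ.map 0 (-1) κ = ψ.map 0 (-1) κ) : φ = ψ :=
  (h.coproduct X (φ.comp Q₀.incl) (φ.map 0 (-1) κ)).unique ⟨fun _ _ _ => rfl, rfl⟩
    ⟨fun n p y => (h₀ n p y.1 y.2).symm, hκ.symm⟩

/-- A retraction argument: the coproduct property gives a morphism to `S` whose composite with the
inclusion is the identity by `hom_ext`. So `Q` is generated by `Q₀` and `κ`. -/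
theorem mem_of_sub (h : IsCurv Q κ Q₀) (S : SubOperad Q.toGrOperad)
    (h₀ : ∀ n p x, x ∈ Q₀.carrier n p → x ∈ S.carrier n p) (hκ : κ ∈ S.carrier 0 (-1))
    {n : ℕ} {p : ℤ} (x : Q.obj n p) : x ∈ S.carrier n p := by
  obtain ⟨φ, ⟨h₁, h₂⟩, -⟩ := h.coproduct S.toGrOperad
    (Q₀.incl.codRestrict S (fun n p x => h₀ n p x.1 x.2)) ⟨κ, hκ⟩
  have e : S.incl.comp φ = GrOperad.Hom.id _ := h.hom_ext
    (fun n p x hx => congrArg (S.incl.map n p) (h₁ n p ⟨x, hx⟩))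
    (congrArg (S.incl.map 0 (-1)) h₂)
  have e' : S.incl.map n p (φ.map n p x) = x :=
    congrArg (fun f : GrOperad.Hom Q.toGrOperad Q.toGrOperad => f.map n p x) e
  rw [← e']
  exact (φ.map n p x).2

/-- The expansion of the operations of `Q` as linear combinations of words in `κ` and slots, with
coefficients in `Q₀`. -/
noncomputable def expansion (h : IsCurv Q κ Q₀) :
    GrOperad.Hom Q.toGrOperad Q₀.toGrOperad.hat :=
  (h.coproduct _ (hatIncl Q₀.toGrOperad) (hatKappa Q₀.toGrOperad)).choose

theorem expansion_coe (h : IsCurv Q κ Q₀) {n : ℕ} {p : ℤ} (x : Q₀.carrier n p) :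
    h.expansion.map n p x.1 = (hatIncl Q₀.toGrOperad).map n p x :=
  (h.coproduct _ (hatIncl Q₀.toGrOperad) (hatKappa Q₀.toGrOperad)).choose_spec.1.1 n p x

theorem expansion_kappa (h : IsCurv Q κ Q₀) :
    h.expansion.map 0 (-1) κ = hatKappa Q₀.toGrOperad :=
  (h.coproduct _ (hatIncl Q₀.toGrOperad) (hatKappa Q₀.toGrOperad)).choose_spec.1.2

/-- The coefficient of a word in the expansion of an operation. -/
noncomputable def coeff (h : IsCurv Q κ Q₀) {n : ℕ} {p : ℤ} {N : ℕ} {q : ℤ} (w : Word n p N q) :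
    Q.obj n p →+ Q.obj N q :=
  (Q₀.incl.map N q).comp ((hatEval Q₀.toGrOperad w).comp (h.expansion.map n p))

theorem coeff_mem (h : IsCurv Q κ Q₀) {n : ℕ} {p : ℤ} {N : ℕ} {q : ℤ} (w : Word n p N q)
    (x : Q.obj n p) : h.coeff w x ∈ Q₀.carrier N q :=
  (hatEval Q₀.toGrOperad w (h.expansion.map n p x)).2

theorem coeff_ne (h : IsCurv Q κ Q₀) {n : ℕ} {p : ℤ} {N : ℕ} {q : ℤ} (w : Word n p N q)
    (hw : w.w ≠ List.replicate n slot) {x : Q.obj n p} (hx : x ∈ Q₀.carrier n p) :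
    h.coeff w x = 0 := by
  have e : hatEval Q₀.toGrOperad w (h.expansion.map n p x) = 0 := by
    rw [h.expansion_coe ⟨x, hx⟩]
    exact hatInclFun_ne Q₀.toGrOperad _ w hw
  exact congrArg (Q₀.incl.map N q) e

theorem coeff_ka (h : IsCurv Q κ Q₀) {n : ℕ} {p : ℤ} {N : ℕ} {q : ℤ} (w : Word n p N q)
    (hw : ka ∈ w.w) {x : Q.obj n p} (hx : x ∈ Q₀.carrier n p) : h.coeff w x = 0 :=
  h.coeff_ne w (fun e => ka_notMem_replicate_slot n (e ▸ hw)) hx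

theorem coeff_slots (h : IsCurv Q κ Q₀) {n : ℕ} {p : ℤ} (w : Word n p n p)
    (hw : w.w = List.replicate n slot) {x : Q.obj n p} (hx : x ∈ Q₀.carrier n p) :
    h.coeff w x = x := by
  have e : hatEval Q₀.toGrOperad w (h.expansion.map n p x) = ⟨x, hx⟩ := by
    rw [h.expansion_coe ⟨x, hx⟩]
    exact hatInclFun_slots Q₀.toGrOperad _ w hw
  exact congrArg (Q₀.incl.map n p) e

theorem expansion_circ_kappa (h : IsCurv Q κ Q₀) {m k : ℕ} {p r : ℤ} (i : ℕ) (hi : i < m)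
    (hk : k + 1 = m + 0) (hr : p + -1 = r) (z : Q.obj m p) :
    h.expansion.map k r (Q.circ i hi hk hr z κ) =
      hatCirc Q₀.toGrOperad i hk hr (h.expansion.map m p z) (hatKappa Q₀.toGrOperad) := by
  rw [h.expansion.map_circ, h.expansion_kappa]
  rfl

theorem coeff_circ_kappa_one (h : IsCurv Q κ Q₀) {m k : ℕ} {p r : ℤ} (i : ℕ) (hi : i < m)
    (hk : k + 1 = m + 0) (hr : p + -1 = r) (z : Q.obj m p) {N : ℕ} {s : ℤ}
    (w : Word k r N s) (w' : Word m p N s) (A B : List Letter) (hw : w.w = A ++ ka :: B)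
    (hw' : w'.w = A ++ slot :: B) (hA : ka ∉ A) (hB : ka ∉ B) :
    h.coeff w (Q.circ i hi hk hr z κ) = if A.count slot = i then h.coeff w' z else 0 := by
  have e := hatCirc_kappa_one Q₀.toGrOperad i hk hr (h.expansion.map m p z) w w' A B hw hw' hA hB
  rw [← h.expansion_circ_kappa i hi] at e
  refine (congrArg (Q₀.incl.map N s) e).trans ?_
  split_ifs
  · rfl
  · exact map_zero _

/-- Either of the two letters `κ` of the word may be the inserted one. The first has to be moved
past the second, whence the minus sign. -/
theorem coeff_circ_kappa_two (h : IsCurv Q κ Q₀) {m k : ℕ} {p r : ℤ} (i : ℕ) (hi : i < m)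
    (hk : k + 1 = m + 0) (hr : p + -1 = r) (z : Q.obj m p) {N : ℕ} {s : ℤ}
    (w : Word k r N s) (w₁ w₂ : Word m p N s) (A C B : List Letter)
    (hw : w.w = A ++ ka :: (C ++ ka :: B)) (hw₁ : w₁.w = A ++ slot :: (C ++ ka :: B))
    (hw₂ : w₂.w = A ++ ka :: (C ++ slot :: B)) (hA : ka ∉ A) (hC : ka ∉ C) (hB : ka ∉ B) :
    h.coeff w (Q.circ i hi hk hr z κ) =
      -(if A.count slot = i then h.coeff w₁ z else 0) +
        if A.count slot + C.count slot = i then h.coeff w₂ z else 0 := by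
  let y : hatObj Q₀.toGrOperad m p := h.expansion.map m p z
  let t₁ : KSplit w.w := ⟨A, C ++ ka :: B, hw.symm⟩
  let t₂ : KSplit w.w := ⟨A ++ ka :: C, B, by rw [hw]; simp⟩
  have h₁₂ : t₁ ≠ t₂ := fun e => by
    have := congrArg (fun t => t.A.length) e
    simp [t₁, t₂] at this
  have key : (hatCirc Q₀.toGrOperad i hk hr y (hatKappa Q₀.toGrOperad)).1 N s w =
      -(if A.count slot = i then y.1 N s w₁ else 0) +
        if A.count slot + C.count slot = i then y.1 N s w₂ else 0 := by
    rw [hatCirc_kappa, Fintype.sum_eq_add t₁ t₂ h₁₂]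
    · refine congrArg₂ _ ?_ ?_
      · dsimp only [t₁]
        split_ifs
        · rw [show kap (C ++ ka :: B) = 1 by simp [kap_eq_zero hC, kap_eq_zero hB], sgn_one,
            neg_one_smul]
          exact congrArg Neg.neg (hat_same y _ _ hw₁.symm).eq
        · rw [neg_zero]
      · dsimp only [t₂]
        rw [kap_eq_zero hB, sgn_zero, one_smul,
          show (A ++ ka :: C).count slot = A.count slot + C.count slot by simp]
        split_ifs
        · exact (hat_same y _ _ (by rw [hw₂]; simp [KSplit.slotted])).eq
        · rfl
    -- `A`, `C` and `B` contain no `κ`, so the word has no third splitting at a letter `κ`.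
    · rintro ⟨A', B', e⟩ ⟨ht₁, ht₂⟩
      exfalso
      rcases ka_cases (e.trans hw) with ⟨rfl, rfl⟩ | ⟨D, rfl, e'⟩ | ⟨D, rfl, -⟩
      · exact ht₁ rfl
      · rcases ka_cases e' with ⟨rfl, rfl⟩ | ⟨D', rfl, -⟩ | ⟨D', -, rfl⟩
        · exact ht₂ rfl
        · exact hC (by simp)
        · exact hB (by simp)
      · exact hA (by simp)
  refine (congrArg (Q₀.incl.map N s) ((congrArg (hatEval Q₀.toGrOperad w)
    (h.expansion_circ_kappa i hi hk hr z)).trans key)).trans ?_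
  rw [map_add, map_neg]
  refine congrArg₂ _ (congrArg _ ?_) ?_
  · split_ifs
    · rfl
    · exact map_zero _
  · split_ifs
    · rfl
    · exact map_zero _

/-- The coefficient in `Q₀` of the weight one words. -/
noncomputable def pick (h : IsCurv Q κ Q₀) (a : ℕ) {n n' : ℕ} {p p' : ℤ} (ha : a < n')
    (hn : n' = n + 1) (hp : p' = p + 1) : Q.obj n p →+ Q.obj n' p' :=
  h.coeff (kWord a (n - a) (by omega) hn hp)

theorem pick_mem (h : IsCurv Q κ Q₀) (a : ℕ) {n n' : ℕ} {p p' : ℤ} (ha : a < n')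
    (hn : n' = n + 1) (hp : p' = p + 1) (x : Q.obj n p) :
    h.pick a ha hn hp x ∈ Q₀.carrier n' p' := h.coeff_mem _ _

theorem pick_of_mem (h : IsCurv Q κ Q₀) (a : ℕ) {n n' : ℕ} {p p' : ℤ} (ha : a < n')
    (hn : n' = n + 1) (hp : p' = p + 1) {x : Q.obj n p} (hx : x ∈ Q₀.carrier n p) :
    h.pick a ha hn hp x = 0 := h.coeff_ka _ (by simp [kWord]) hx

theorem pick_circ_kappa (h : IsCurv Q κ Q₀) (a : ℕ) {n n' : ℕ} {p p' : ℤ} (ha : a < n')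
    (hn : n' = n + 1) (hp : p' = p + 1) (i : ℕ) (hi : i < n') (hk : n + 1 = n' + 0)
    (hr : p' + -1 = p) {c : Q.obj n' p'} (hc : c ∈ Q₀.carrier n' p') :
    h.pick a ha hn hp (Q.circ i hi hk hr c κ) = if a = i then c else 0 := by
  unfold pick
  rw [h.coeff_circ_kappa_one i hi hk hr c _ (slotWord n' p') _ _ rfl _
    (ka_notMem_replicate_slot _) (ka_notMem_replicate_slot _), h.coeff_slots _ rfl hc]
  · simp
  · simp only [slotWord, ← List.replicate_succ, List.replicate_append_replicate]
    congr 1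
    omega

/-- This is the independence of the insertions of `κ`: coefficients taken from `Q₀` can be read off
from a sum of insertions. It makes the expansion of the weight one part of `d` unique. -/
theorem pick_sum (h : IsCurv Q κ Q₀) (a : ℕ) {n n' : ℕ} {p p' : ℤ} (ha : a < n')
    (hn : n' = n + 1) (hp : p' = p + 1) (hk : n + 1 = n' + 0)
    (hr : p' + -1 = p) (c : Fin n' → Q.obj n' p') (hc : ∀ i, c i ∈ Q₀.carrier n' p') :
    h.pick a ha hn hp (∑ i : Fin n', Q.circ i.1 i.2 hk hr (c i) κ) = c ⟨a, ha⟩ := by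
  rw [map_sum, Fintype.sum_eq_single ⟨a, ha⟩]
  · rw [h.pick_circ_kappa _ _ _ _ _ _ _ _ (hc _), if_pos rfl]
  · intro i hi
    rw [h.pick_circ_kappa _ _ _ _ _ _ _ _ (hc _), if_neg (fun e => hi (Fin.ext e.symm))]

end IsCurv

/-! ### Weights zero and one -/

section WeightOne

variable {Q : DGOperad.{u}} (κ : Q.obj 0 (-1)) (Q₀ : SubOperad Q.toGrOperad)

/-- The subgroup generated by the operations `c ∘ κ`, where `c` is in `Q₀`. -/
def weightOne (n : ℕ) (p : ℤ) : AddSubgroup (Q.obj n p) :=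
  AddSubgroup.closure {z | ∃ (i : ℕ) (hi : i < n + 1) (c : Q.obj (n + 1) (p + 1)),
    c ∈ Q₀.carrier (n + 1) (p + 1) ∧ z = Q.circ i hi (by omega) (by omega) c κ}

theorem circ_kappa_mem_weightOne {n n' : ℕ} {p p' : ℤ} (i : ℕ) (hi : i < n')
    (hk : n + 1 = n' + 0) (hr : p' + -1 = p) {c : Q.obj n' p'} (hc : c ∈ Q₀.carrier n' p') :
    Q.circ i hi hk hr c κ ∈ weightOne κ Q₀ n p := by
  obtain rfl : n' = n + 1 := by omega
  obtain rfl : p' = p + 1 := by omega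
  exact AddSubgroup.subset_closure ⟨i, hi, c, hc, rfl⟩

theorem zsmul_sgn_mem {A : Type*} [AddCommGroup A] {S : AddSubgroup A} {x : A} (e : ℤ)
    (hx : x ∈ S) : sgn e • x ∈ S := S.zsmul_mem hx _

/-- An operation inserted after `κ` can be inserted before it instead, at the price of a sign and a
shift of one of the two positions; it is then absorbed into the coefficient in `Q₀`. -/
theorem weightOne_circ {m n k : ℕ} {p q r : ℤ} (i : ℕ) (hi : i < m) (hk : k + 1 = m + n)
    (hr : p + q = r) {x : Q.obj m p} {y : Q.obj n q} (hx : x ∈ weightOne κ Q₀ m p)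
    (hy : y ∈ Q₀.carrier n q) : Q.circ i hi hk hr x y ∈ weightOne κ Q₀ k r := by
  induction hx using AddSubgroup.closure_induction with
  | mem x hx =>
    obtain ⟨j, hj, c, hc, rfl⟩ := hx
    rcases le_or_gt j i with hji | hij
    · rw [Q.circ_kappa_le κ i j hji hj _ _ hi hk hr (by omega) (a := k + 1) (r := r + 1) (by omega)
        (by omega) (by omega) (by omega) (by omega)]
      exact zsmul_sgn_mem _ (circ_kappa_mem_weightOne κ Q₀ _ _ _ _ (Q₀.circ_mem _ _ _ _ _ _ hc hy))
    · rw [Q.circ_kappa_gt κ i j (j + n - 1) hij (by omega) hj _ _ hi hk hr (by omega) (a := k + 1)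
        (r := r + 1) (by omega) (by omega) (by omega) (by omega) (by omega)]
      exact zsmul_sgn_mem _ (circ_kappa_mem_weightOne κ Q₀ _ _ _ _ (Q₀.circ_mem _ _ _ _ _ _ hc hy))
  | zero =>
    rw [map_zero]
    exact zero_mem _
  | add x x' _ _ h h' =>
    rw [map_add]
    exact add_mem h h'
  | neg x _ h =>
    rw [map_neg]
    exact neg_mem h

theorem circ_weightOne {m n k : ℕ} {p q r : ℤ} (i : ℕ) (hi : i < m) (hk : k + 1 = m + n)
    (hr : p + q = r) {x : Q.obj m p} {y : Q.obj n q} (hx : x ∈ Q₀.carrier m p)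
    (hy : y ∈ weightOne κ Q₀ n q) : Q.circ i hi hk hr x y ∈ weightOne κ Q₀ k r := by
  induction hy using AddSubgroup.closure_induction with
  | mem y hy =>
    obtain ⟨j, hj, c, hc, rfl⟩ := hy
    rw [← Q.circ_seq i j hi hj (a := k + 1) (pq := r + 1) (by omega) (by omega) (by omega) (by omega)
      (by omega)]
    exact circ_kappa_mem_weightOne κ Q₀ _ _ _ _ (Q₀.circ_mem _ _ _ _ _ _ hx hc)
  | zero =>
    rw [map_zero]
    exact zero_mem _
  | add x x' _ _ h h' =>
    rw [map_add]
    exact add_mem h h'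
  | neg x _ h =>
    rw [map_neg]
    exact neg_mem h

/-- In a composition of total weight zero both factors lie in `Q₀`; in total weight one exactly one
of them carries the `κ`, and the two lemmas above apply. Higher weights need no description of this
kind. -/
theorem HasWeight.mem {κ : Q.obj 0 (-1)} {Q₀ : SubOperad Q.toGrOperad} {j n : ℕ} {p : ℤ}
    {x : Q.obj n p} (hx : HasWeight Q κ Q₀ j x) :
    (j = 0 → x ∈ Q₀.carrier n p) ∧ (j = 1 → x ∈ weightOne κ Q₀ n p) := by
  induction hx with
  | of_mem x hx => exact ⟨fun _ => hx, fun h => absurd h (by omega)⟩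
  | kappa =>
    refine ⟨fun h => absurd h (by omega), fun _ => ?_⟩
    -- `κ = 1 ∘ κ` is itself an insertion of `κ` into an element of `Q₀`.
    have e := circ_kappa_mem_weightOne κ Q₀ (n := 0) (p := -1) 0 zero_lt_one (by omega) (by omega) Q₀.one_mem
    rwa [Q.one_circ] at e
  | zero => exact ⟨fun _ => zero_mem _, fun _ => zero_mem _⟩
  | add x y _ _ h h' => exact ⟨fun e => add_mem (h.1 e) (h'.1 e), fun e => add_mem (h.2 e) (h'.2 e)⟩
  | neg x _ h => exact ⟨fun e => neg_mem (h.1 e), fun e => neg_mem (h.2 e)⟩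
  | @circ j j' m n k p q r i hi hk hr x y _ _ h h' =>
    refine ⟨fun e => Q₀.circ_mem _ _ _ _ _ _ (h.1 (by omega)) (h'.1 (by omega)), fun e => ?_⟩
    rcases Nat.eq_zero_or_pos j with hj | hj
    · exact circ_weightOne κ Q₀ _ _ _ _ (h.1 hj) (h'.2 (by omega))
    · exact weightOne_circ κ Q₀ _ _ _ _ (h.2 (by omega)) (h'.1 (by omega))

theorem HasWeight.of_weightOne {κ : Q.obj 0 (-1)} {Q₀ : SubOperad Q.toGrOperad} {n : ℕ} {p : ℤ}
    {x : Q.obj n p} (hx : x ∈ weightOne κ Q₀ n p) : HasWeight Q κ Q₀ 1 x := by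
  induction hx using AddSubgroup.closure_induction with
  | mem y hy =>
    obtain ⟨j, hj, c, hc, rfl⟩ := hy
    have e := HasWeight.circ (Q := Q) j hj (by omega) (by omega) c κ (.of_mem c hc)
      (.kappa (Q₀ := Q₀)) (k := n) (r := p)
    rwa [zero_add] at e
  | zero => exact .zero _ _ _
  | add x x' _ _ h h' => exact .add _ _ h h'
  | neg x _ h => exact .neg _ h

/-- It is enough to check the conditions on the differential on `Q₀` and on `κ`. -/
theorem strict_mixed_of {κ : Q.obj 0 (-1)} {Q₀ : SubOperad Q.toGrOperad}
    (h₀ : ∀ (n : ℕ) (p q : ℤ) (h : q + 1 = p) (x : Q.obj n p), x ∈ Q₀.carrier n p →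
      ∃ y z : Q.obj n q, y ∈ Q₀.carrier n q ∧ z ∈ weightOne κ Q₀ n q ∧ Q.d h x = y + z)
    (hκ : HasWeight Q κ Q₀ 1 (Q.d (q := -2) (by norm_num) κ)) (j n : ℕ) (p q : ℤ)
    (h : q + 1 = p) (x : Q.obj n p) (hx : HasWeight Q κ Q₀ j x) :
    ∃ y z : Q.obj n q, HasWeight Q κ Q₀ j y ∧ HasWeight Q κ Q₀ (j + 1) z ∧ Q.d h x = y + z := by
  induction hx generalizing q with
  | of_mem x hx =>
    obtain ⟨y, z, hy, hz, e⟩ := h₀ _ _ q h x hx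
    exact ⟨y, z, .of_mem y hy, .of_weightOne hz, e⟩
  | kappa =>
    obtain rfl : q = -2 := by omega
    -- All of `d κ` has weight one, so its component of weight two is zero.
    exact ⟨_, 0, hκ, .zero _ _ _, (add_zero _).symm⟩
  | zero => exact ⟨0, 0, .zero _ _ _, .zero _ _ _, by simp⟩
  | add x y _ _ ih ih' =>
    obtain ⟨a, b, ha, hb, e⟩ := ih q h
    obtain ⟨a', b', ha', hb', e'⟩ := ih' q h
    refine ⟨a + a', b + b', .add _ _ ha ha', .add _ _ hb hb', ?_⟩
    rw [map_add, e, e', add_add_add_comm]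
  | neg x _ ih =>
    obtain ⟨a, b, ha, hb, e⟩ := ih q h
    refine ⟨-a, -b, .neg _ ha, .neg _ hb, ?_⟩
    rw [map_neg, e, neg_add]
  | @circ j j' m n k p p' r i hi hk hr x y hx hy ih ih' =>
    obtain ⟨a, b, ha, hb, e⟩ := ih (p - 1) (by omega)
    obtain ⟨a', b', ha', hb', e'⟩ := ih' (p' - 1) (by omega)
    have hs : ∀ {j n : ℕ} {q : ℤ} {z : Q.obj n q}, HasWeight Q κ Q₀ j z →
        HasWeight Q κ Q₀ j (sgn p • z) := fun {j n q z} hz => by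
      unfold sgn
      split_ifs
      · simpa using hz
      · simpa using hz.neg
    refine ⟨Q.circ i hi hk (by omega) a y + sgn p • Q.circ i hi hk (by omega) x a',
      Q.circ i hi hk (by omega) b y + sgn p • Q.circ i hi hk (by omega) x b',
      .add _ _ (.circ _ _ _ _ _ _ ha hy) (hs (.circ _ _ _ _ _ _ hx ha')), .add _ _ ?_ (hs ?_), ?_⟩
    · have := HasWeight.circ i hi hk (r := q) (by omega) b y hb hy
      rwa [show j + 1 + j' = j + j' + 1 by omega] at this
    · have := HasWeight.circ i hi hk (r := q) (by omega) x b' hx hb'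
      rwa [← add_assoc] at this
    · rw [Q.d_circ i hi hk hr (p' := p - 1) (q' := p' - 1) (by omega) (by omega) h (by omega)
        (by omega), e, e']
      simp only [map_add, AddMonoidHom.add_apply, smul_add]
      abel

end WeightOne

/-! ### The operators `D_a`, their relations, and the operations `μ_n` of an object of `Curv` -/

namespace IsCurv

variable {Q : DGOperad.{u}} {κ : Q.obj 0 (-1)} {Q₀ : SubOperad Q.toGrOperad}

/-- Both sides are additive in `z`, and for a generator `c ∘ κ` exactly one coefficient is nonzero.
-/
theorem eq_sum_pick (h : IsCurv Q κ Q₀) {n n' : ℕ} {p p' : ℤ}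
    (hn : n' = n + 1) (hp : p' = p + 1) (hk : n + 1 = n' + 0)
    (hr : p' + -1 = p) {z : Q.obj n p} (hz : z ∈ weightOne κ Q₀ n p) :
    z = ∑ i : Fin n', Q.circ i.1 i.2 hk hr (h.pick i.1 i.2 hn hp z) κ := by
  induction hz using AddSubgroup.closure_induction with
  | mem z hz =>
    obtain ⟨j, hj, c, hc, rfl⟩ := hz
    subst hn hp
    rw [Fintype.sum_eq_single ⟨j, hj⟩]
    · rw [h.pick_circ_kappa _ _ _ _ _ _ _ _ hc, if_pos rfl]
    · intro i hi
      rw [h.pick_circ_kappa _ _ _ _ _ _ _ _ hc, if_neg (fun e => hi (Fin.ext e)), map_zero,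
        AddMonoidHom.zero_apply]
  | zero => simp
  | add x y _ _ hx hy =>
    simp only [map_add, AddMonoidHom.add_apply, Finset.sum_add_distrib]
    rw [← hx, ← hy]
  | neg x _ hx =>
    simp only [map_neg, AddMonoidHom.neg_apply, Finset.sum_neg_distrib]
    rw [← hx]

/-- The operations `D_a x` with `d x = d₀ x + (-1)^p ∑ D_a x ∘ κ` for `x` in `Q₀` of degree `p`. -/
noncomputable def der (h : IsCurv Q κ Q₀) (a : ℕ) {n n' : ℕ} {p : ℤ} (ha : a < n')
    (hn : n' = n + 1) : Q.obj n p →+ Q.obj n' p :=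
  sgn p • (h.pick a ha hn (by omega)).comp (Q.d (q := p - 1) (by omega))

theorem der_eq (h : IsCurv Q κ Q₀) (a : ℕ) {n n' : ℕ} {p q : ℤ} (ha : a < n')
    (hn : n' = n + 1) (hq : q + 1 = p) (x : Q.obj n p) :
    h.der a ha hn x = sgn p • h.pick a ha hn hq.symm (Q.d hq x) := by
  obtain rfl : q = p - 1 := by omega
  rfl

theorem der_mem (h : IsCurv Q κ Q₀) (a : ℕ) {n n' : ℕ} {p : ℤ} (ha : a < n')
    (hn : n' = n + 1) (x : Q.obj n p) : h.der a ha hn x ∈ Q₀.carrier n' p :=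
  zsmul_sgn_mem _ (h.pick_mem a ha hn (by omega) _)

/-- The differential raises the weight by at most one, so `d x` is an element of `Q₀` plus a weight
one term, and the latter is expanded by `eq_sum_pick`. The sign built into `der` cancels against the
sign in front of the sum. -/
theorem d_eq (h : IsCurv Q κ Q₀) {n n' : ℕ} {p q : ℤ} (hq : q + 1 = p) (hn : n' = n + 1)
    (hk : n + 1 = n' + 0) (hr : p + -1 = q) {x : Q.obj n p} (hx : x ∈ Q₀.carrier n p) :
    ∃ y ∈ Q₀.carrier n q, Q.d hq x =
      y + sgn p • ∑ i : Fin n', Q.circ i.1 i.2 hk hr (h.der i.1 i.2 hn x) κ := by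
  obtain ⟨y, z, hy, hz, e⟩ := h.strict_mixed 0 n p q hq x (.of_mem x hx)
  refine ⟨y, hy.mem.1 rfl, ?_⟩
  rw [e]
  refine congrArg _ ?_
  conv_lhs => rw [h.eq_sum_pick hn hq.symm hk hr (hz.mem.2 rfl)]
  rw [Finset.smul_sum]
  refine Finset.sum_congr rfl (fun i _ => ?_)
  rw [h.der_eq _ _ _ hq, e, map_add, h.pick_of_mem _ _ _ _ (hy.mem.1 rfl), zero_add, map_zsmul,
    AddMonoidHom.smul_apply, sgn_smul_sgn_smul]

/-- By independence of the insertions, any expansion of `d x` with coefficients in `Q₀` is the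
expansion by the `D_a`. All later identifications of `D_a`, in concrete operads or under morphisms,
go through this. -/
theorem der_unique (h : IsCurv Q κ Q₀) (a : ℕ) {n n' : ℕ} {p q : ℤ} (ha : a < n')
    (hn : n' = n + 1) (hq : q + 1 = p)
    (hk : n + 1 = n' + 0) (hr : p + -1 = q) {x : Q.obj n p} {y : Q.obj n q}
    (hy : y ∈ Q₀.carrier n q) (c : Fin n' → Q.obj n' p) (hc : ∀ i, c i ∈ Q₀.carrier n' p)
    (e : Q.d hq x = y + sgn p • ∑ i : Fin n', Q.circ i.1 i.2 hk hr (c i) κ) :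
    h.der a ha hn x = c ⟨a, ha⟩ := by
  rw [h.der_eq _ _ _ hq, e, map_add, h.pick_of_mem _ _ _ _ hy, zero_add, map_zsmul,
    h.pick_sum _ _ _ _ _ _ _ hc, sgn_smul_sgn_smul]

/-- The operations `D_a` satisfy a Leibniz rule. -/
theorem der_circ (h : IsCurv Q κ Q₀) (a : ℕ) {m n l l' : ℕ} {p q r : ℤ} (k : ℕ) (hk : k < m)
    (hl : l + 1 = m + n) (hr : p + q = r) (ha : a < l') (hl' : l' = l + 1) {x : Q.obj m p}
    {y : Q.obj n q} (hx : x ∈ Q₀.carrier m p) (hy : y ∈ Q₀.carrier n q) :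
    h.der a ha hl' (Q.circ k hk hl hr x y) =
      (∑ j : Fin (m + 1), if j.1 ≤ k then
          if a = j.1 then Q.circ (k + 1) (by omega) (by omega) hr (h.der j.1 j.2 rfl x) y else 0
        else if a + 1 = j.1 + n then Q.circ k (by omega) (by omega) hr (h.der j.1 j.2 rfl x) y
          else 0) +
      ∑ j : Fin (n + 1), if a = k + j.1 then
        Q.circ k hk (by omega) hr x (h.der j.1 j.2 rfl y) else 0 := by
  subst hr
  obtain ⟨x', hx', ex⟩ := h.d_eq (q := p - 1) (by omega) (rfl : m + 1 = _) rfl (by omega) hx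
  obtain ⟨y', hy', ey⟩ := h.d_eq (q := q - 1) (by omega) (rfl : n + 1 = _) rfl (by omega) hy
  rw [h.der_eq (q := p + q - 1) _ _ _ (by omega), Q.d_circ k hk hl rfl (p' := p - 1) (q' := q - 1)
    (by omega) (by omega) (by omega) (by omega) (by omega), ex, ey]
  simp only [map_add, AddMonoidHom.add_apply, map_zsmul, map_sum, AddMonoidHom.smul_apply,
    AddMonoidHom.finsetSum_apply, smul_add, Finset.smul_sum]
  -- The weight zero parts of `d x` and `d y` contribute only to weight zero.
  rw [h.pick_of_mem _ _ _ _ (Q₀.circ_mem _ _ _ _ _ _ hx' hy),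
    h.pick_of_mem _ _ _ _ (Q₀.circ_mem _ _ _ _ _ _ hx hy')]
  simp only [smul_zero, zero_add]
  refine congrArg₂ _ (Finset.sum_congr rfl fun j _ => ?_) (Finset.sum_congr rfl fun j _ => ?_)
  -- An input created in `x` at place `j ≤ k` stays at `j` and pushes the insertion point of `y` to
  -- `k + 1`; one created at `j > k` ends up to the right of `y`, at place `j + n - 1`. An input
  -- created in `y`, treated afterwards, is moved by `k`.
  · split_ifs with h₁ h₂ h₂
    · rw [Q.circ_kappa_le κ k j.1 h₁ j.2 _ _ hk hl _ (by omega) (a := l') (r := p + q) (by omega)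
        rfl (by omega) (by omega) (by omega), map_zsmul,
        h.pick_circ_kappa _ _ _ _ _ _ _ _ (Q₀.circ_mem _ _ _ _ _ _ (h.der_mem _ _ _ _) hy),
        if_pos h₂, sgn_add_smul]
    · rw [Q.circ_kappa_le κ k j.1 h₁ j.2 _ _ hk hl _ (by omega) (a := l') (r := p + q) (by omega)
        rfl (by omega) (by omega) (by omega), map_zsmul,
        h.pick_circ_kappa _ _ _ _ _ _ _ _ (Q₀.circ_mem _ _ _ _ _ _ (h.der_mem _ _ _ _) hy),
        if_neg h₂, smul_zero, smul_zero, smul_zero]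
    · rw [Q.circ_kappa_gt κ k j.1 (j.1 + n - 1) (by omega) (by omega) j.2 _ _ hk hl _ (by omega)
        (a := l') (r := p + q) (by omega)
        rfl (by omega) (by omega) (by omega), map_zsmul,
        h.pick_circ_kappa _ _ _ _ _ _ _ _ (Q₀.circ_mem _ _ _ _ _ _ (h.der_mem _ _ _ _) hy),
        if_pos (by omega), sgn_add_smul]
    · rw [Q.circ_kappa_gt κ k j.1 (j.1 + n - 1) (by omega) (by omega) j.2 _ _ hk hl _ (by omega)
        (a := l') (r := p + q) (by omega)
        rfl (by omega) (by omega) (by omega), map_zsmul,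
        h.pick_circ_kappa _ _ _ _ _ _ _ _ (Q₀.circ_mem _ _ _ _ _ _ (h.der_mem _ _ _ _) hy),
        if_neg (by omega), smul_zero, smul_zero, smul_zero]
  · rw [← Q.circ_seq k j.1 hk j.2 (a := l') (pq := p + q) (by omega) (by omega) (by omega)
      (by omega) (by omega),
      h.pick_circ_kappa _ _ _ _ _ _ _ _ (Q₀.circ_mem _ _ _ _ _ _ hx (h.der_mem _ _ _ _)),
      sgn_add_smul]

theorem der_one (h : IsCurv Q κ Q₀) (a : ℕ) {n : ℕ} (ha : a < n) (hn : n = 1 + 1) :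
    h.der a ha hn Q.one = 0 := by
  rw [h.der_eq (q := -1) _ _ _ rfl, Q.d_one, map_zero, smul_zero]

/-- The coefficient in `Q₀` of the weight two words. -/
noncomputable def pick₂ (h : IsCurv Q κ Q₀) (a b : ℕ) {n n' : ℕ} {p p' : ℤ} (ha : a + b ≤ n)
    (hn : n' = n + 2) (hp : p' = p + 2) : Q.obj n p →+ Q.obj n' p' :=
  h.coeff (kkWord a b (n - a - b) (by omega) hn hp)

/-- If the inserted `κ` is the first one of the word, it becomes a slot, and the other `κ` then has
`a + b + 1` slots on its left. If it is the second one, the place `a` of the first is unchanged. -/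
theorem pick₂_circ_kappa (h : IsCurv Q κ Q₀) (a b : ℕ) {n m n' : ℕ} {p r p' : ℤ}
    (ha : a + b ≤ n) (hn : n' = n + 2) (hp : p' = p + 2) (i : ℕ) (hi : i < m)
    (hk : n + 1 = m + 0) (hr : r + -1 = p) (z : Q.obj m r) :
    h.pick₂ a b ha hn hp (Q.circ i hi hk hr z κ) =
      -(if a = i then h.pick (a + b + 1) (by omega) (by omega) (by omega) z else 0) +
        if a + b = i then h.pick a (by omega) (by omega) (by omega) z else 0 := by
  unfold pick₂ pick
  rw [h.coeff_circ_kappa_two i hi hk hr z _ (kWord (a + b + 1) (m - (a + b + 1)) (by omega) (by omega)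
    (by omega)) (kWord a (m - a) (by omega) (by omega) (by omega)) (List.replicate a slot)
    (List.replicate b slot) (List.replicate (n - a - b) slot) rfl
    _ _ (ka_notMem_replicate_slot _) (ka_notMem_replicate_slot _) (ka_notMem_replicate_slot _)]
  · simp
  · simp only [kWord, ← List.cons_append, ← List.replicate_succ, ← List.append_assoc,
      List.replicate_append_replicate]
    rw [show a + (b + 1) = a + b + 1 by omega, show m - (a + b + 1) = n - a - b by omega]
  · simp only [kWord, ← List.replicate_succ, List.replicate_append_replicate]
    rw [show b + (n - a - b + 1) = m - a by omega]

theorem pick₂_of_mem (h : IsCurv Q κ Q₀) (a b : ℕ) {n n' : ℕ} {p p' : ℤ} (ha : a + b ≤ n)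
    (hn : n' = n + 2) (hp : p' = p + 2) {z : Q.obj n p} (hz : z ∈ Q₀.carrier n p) :
    h.pick₂ a b ha hn hp z = 0 := h.coeff_ka _ (by simp [kkWord]) hz

theorem pick₂_weightOne (h : IsCurv Q κ Q₀) (a b : ℕ) {n n' : ℕ} {p p' : ℤ} (ha : a + b ≤ n)
    (hn : n' = n + 2) (hp : p' = p + 2) {z : Q.obj n p} (hz : z ∈ weightOne κ Q₀ n p) :
    h.pick₂ a b ha hn hp z = 0 := by
  rw [h.eq_sum_pick rfl rfl rfl (by omega) hz, map_sum]
  refine Finset.sum_eq_zero (fun i _ => ?_)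
  rw [h.pick₂_circ_kappa, h.pick_of_mem _ _ _ _ (h.pick_mem _ _ _ _ _),
    h.pick_of_mem _ _ _ _ (h.pick_mem _ _ _ _ _)]
  simp

theorem pick₂_d (h : IsCurv Q κ Q₀) (a b : ℕ) {n n' : ℕ} {p p' q : ℤ} (ha : a + b ≤ n)
    (hn : n' = n + 2) (hp : p' = p + 2) (hq : p + 1 = q) {z : Q.obj n q}
    (hz : z ∈ Q₀.carrier n q) : h.pick₂ a b ha hn hp (Q.d hq z) = 0 := by
  obtain ⟨x, y, hx, hy, e⟩ := h.strict_mixed 0 n q p hq z (.of_mem z hz)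
  rw [e, map_add, h.pick₂_of_mem _ _ _ _ _ (hx.mem.1 rfl),
    h.pick₂_weightOne _ _ _ _ _ (hy.mem.2 rfl), add_zero]

/-- Since `d κ` has weight one, `z ∘ d κ` does not reach weight two; only `d z ∘ κ` does. The
transport `Q.cast` merely identifies two names of the same degree. -/
theorem pick₂_d_circ_kappa (h : IsCurv Q κ Q₀) (a b : ℕ) {n m n' : ℕ} {p r p' q : ℤ}
    (ha : a + b ≤ n) (hn : n' = n + 2) (hp : p' = p + 2) (hq : p + 1 = q) (i : ℕ) (hi : i < m)
    (hk : n + 1 = m + 0) (hr : r + -1 = q) {z : Q.obj m r} (hz : z ∈ Q₀.carrier m r)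
    (hr' : p + 1 + 1 = r) :
    h.pick₂ a b ha hn hp (Q.d hq (Q.circ i hi hk hr z κ)) =
      sgn r • (-(if a = i then h.der (n' := n') (a + b + 1) (by omega) (by omega)
          (Q.cast rfl (by omega : r = p') z) else 0) +
        if a + b = i then h.der (n' := n') a (by omega) (by omega)
          (Q.cast rfl (by omega : r = p') z) else 0) := by
  obtain rfl : r = p' := by omega
  rw [Q.d_circ i hi hk hr (p' := p + 1) (q' := -2) hr' (by omega) hq (by omega) (by omega),
    map_add, map_zsmul,
    h.pick₂_weightOne _ _ _ _ _ (circ_weightOne κ Q₀ _ _ _ _ hz (h.d_kappa.mem.2 rfl)), smul_zero,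
    add_zero, pick₂_circ_kappa, h.der_eq _ _ _ hr', h.der_eq _ _ _ hr']
  simp only [GrOperad.cast_rfl, smul_add, smul_neg, smul_ite, smul_zero, sgn_smul_sgn_smul]

/-- This is the coefficient, in `d (d x) = 0`, of the word with two letters `κ` having `a` and `a +
b` slots on their left. The input created at `a` moves the later place `a + b` to `a + b + 1`, and
the sign between the two letters `κ` turns the vanishing of the sum into an equality. -/
theorem der_der (h : IsCurv Q κ Q₀) (a b : ℕ) {n n₁ n₂ : ℕ} {p : ℤ} (ha : a + b ≤ n)
    (hn₁ : n₁ = n + 1) (hn₂ : n₂ = n₁ + 1) {x : Q.obj n p} (hx : x ∈ Q₀.carrier n p) :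
    h.der (n' := n₂) (a + b + 1) (by omega) hn₂ (h.der (n' := n₁) a (by omega) hn₁ x) =
      h.der a (by omega) hn₂ (h.der (n' := n₁) (a + b) (by omega) hn₁ x) := by
  obtain ⟨y, hy, e⟩ := h.d_eq (q := p - 1) (by omega) hn₁ (by omega) (by omega) hx
  have e' := congrArg (h.pick₂ (p := p - 1 - 1) (p' := p) (n' := n₂) a b ha (by omega) (by omega))
    (Q.d_d (r := p - 1 - 1) (by omega : p - 1 + 1 = p) (by omega) x)
  rw [e, map_add, map_add, h.pick₂_d _ _ _ _ _ _ hy, zero_add, map_zsmul, map_zsmul, map_sum,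
    map_sum, map_zero] at e'
  simp only [h.pick₂_d_circ_kappa a b ha (by omega : n₂ = n + 2) (by omega : p = p - 1 - 1 + 2) _ _
    _ _ _ (h.der_mem _ _ _ x) (by omega : p - 1 - 1 + 1 + 1 = p), GrOperad.cast_rfl] at e'
  -- In each of the two sums over the place of the inserted `κ` a single term survives, at `a` and
  -- at `a + b` respectively.
  rw [← Finset.smul_sum, sgn_smul_sgn_smul, Finset.sum_add_distrib, Finset.sum_neg_distrib,
    Fintype.sum_eq_single ⟨a, by omega⟩, Fintype.sum_eq_single ⟨a + b, by omega⟩] at e'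
  · rw [if_pos rfl, if_pos rfl, neg_add_eq_zero] at e'
    exact e'
  · intro i hi
    exact if_neg (fun e => hi (Fin.ext e.symm))
  · intro i hi
    exact if_neg (fun e => hi (Fin.ext e.symm))

/-- The images of the generators of the curved A-infinity operad. -/
noncomputable def mu (h : IsCurv Q κ Q₀) : ∀ n, Q.obj n (-1)
  | 0 => κ
  | n + 1 => -h.pick 0 (by omega) rfl (by omega) (Q.d (q := -2) (by omega) (h.mu n))

theorem mu_succ_mem (h : IsCurv Q κ Q₀) (n : ℕ) : h.mu (n + 1) ∈ Q₀.carrier (n + 1) (-1) := by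
  rw [mu]
  exact neg_mem (h.pick_mem _ _ _ _ _)

/-- In arity zero a weight one element has a single coefficient; for `d κ` it is `-μ₁` by the
definition of `mu`. -/
theorem d_kappa_eq (h : IsCurv Q κ Q₀) :
    Q.d (q := -2) (by omega) κ = -Q.circ 0 (by omega) (by omega) (by omega) (h.mu 1) κ := by
  conv_lhs => rw [h.eq_sum_pick (p' := -1) rfl (by omega) rfl (by omega) (h.d_kappa.mem.2 rfl),
    Fin.sum_univ_one]
  rw [mu, mu, map_neg, AddMonoidHom.neg_apply, neg_neg]
  rfl

theorem mu_one_unique (h : IsCurv Q κ Q₀) {ν : Q.obj 1 (-1)} (hν : ν ∈ Q₀.carrier 1 (-1))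
    (e : Q.d (q := -2) (by omega) κ = -Q.circ 0 (by omega) (by omega) (by omega) ν κ) :
    h.mu 1 = ν := by
  rw [mu, mu, e, map_neg, h.pick_circ_kappa _ _ _ _ _ _ _ _ hν, if_pos rfl, neg_neg]

/-- The minus sign in the recursion for `mu` is the sign `sgn (-1)` in `der`. -/
theorem der_zero_mu (h : IsCurv Q κ Q₀) (n n' : ℕ) (hn : n' = n + 1) (h0 : 0 < n') :
    h.der 0 h0 hn (h.mu n) = Q.cast hn.symm rfl (h.mu (n + 1)) := by
  subst hn
  rw [h.der_eq (q := -2) _ _ _ (by omega), sgn_neg_one, neg_one_smul, GrOperad.cast_rfl, mu]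

/-- `der_der` speaks of elements of `Q₀` only and so cannot be used for `κ`; the weight two part of
`d (d κ) = 0` replaces it. -/
theorem der_one_mu_one (h : IsCurv Q κ Q₀) :
    h.der 1 (by omega) rfl (h.mu 1) = h.der 0 (by omega) rfl (h.mu 1) := by
  have e := congrArg (h.pick₂ (p := -3) (p' := -1) (n' := 2) 0 0 (by omega) (by omega) (by omega))
    (Q.d_d (q := -2) (r := -3) (by omega) (by omega) κ)
  rw [h.d_kappa_eq, map_neg, map_neg, h.pick₂_d_circ_kappa 0 0 _ _ _ _ _ _ _ _ (h.mu_succ_mem 0)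
    (by omega), map_zero, if_pos rfl, if_pos rfl, sgn_neg_one, neg_one_smul, neg_neg,
    neg_add_eq_zero] at e
  exact e

/-- By induction, using `D_{a+1} D_0 = D_0 D_a`: on `μ_{n+1}` the inner operators both give
`μ_{n+2}`, hence `D_{a+1}` and `D_0` agree there. -/
theorem der_mu (h : IsCurv Q κ Q₀) (n a : ℕ) (ha : a < n + 1 + 1) :
    h.der a ha rfl (h.mu (n + 1)) = h.mu (n + 1 + 1) := by
  induction n generalizing a with
  | zero =>
    obtain rfl | rfl : a = 0 ∨ a = 1 := by omega
    · exact h.der_zero_mu 1 2 rfl ha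
    · exact h.der_one_mu_one.trans (h.der_zero_mu 1 2 rfl _)
  | succ n ih =>
    rcases a with _ | a
    · exact h.der_zero_mu _ _ rfl ha
    · have e := h.der_der 0 a (n := n + 1) (by omega) rfl rfl (h.mu_succ_mem n)
      rw [ih, ih] at e
      simp only [zero_add] at e
      exact e.trans (h.der_zero_mu _ _ rfl _)

end IsCurv

/-! ### Morphisms preserve `D_a` and `μ_n` -/

section Morphism

variable {Q Q' : DGOperad.{u}} {κ : Q.obj 0 (-1)} {Q₀ : SubOperad Q.toGrOperad}
  {κ' : Q'.obj 0 (-1)} {Q₀' : SubOperad Q'.toGrOperad}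

/-- The image under `F` of the expansion of `d x` is an expansion of `d (F x)` with coefficients in
`Q₀'`, so `der_unique` applies. Compatibility with the differential is needed at the element `x`
only. -/
theorem IsCurv.map_der (h : IsCurv Q κ Q₀) (h' : IsCurv Q' κ' Q₀')
    (F : GrOperad.Hom Q.toGrOperad Q'.toGrOperad) (hκ : F.map 0 (-1) κ = κ')
    (hF : ∀ n p x, x ∈ Q₀.carrier n p → F.map n p x ∈ Q₀'.carrier n p)
    {n n' : ℕ} {p q : ℤ} (a : ℕ) (ha : a < n') (hn : n' = n + 1) (hq : q + 1 = p)
    {x : Q.obj n p} (hx : x ∈ Q₀.carrier n p)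
    (hd : F.map n q (Q.d hq x) = Q'.d hq (F.map n p x)) :
    F.map n' p (h.der a ha hn x) = h'.der a ha hn (F.map n p x) := by
  obtain ⟨y, hy, e⟩ := h.d_eq hq hn (by omega) (by omega) hx
  refine (h'.der_unique a ha hn hq (by omega) (by omega) (hF _ _ _ hy)
    (fun i => F.map n' p (h.der i.1 i.2 hn x)) (fun i => hF _ _ _ (h.der_mem _ _ _ _)) ?_).symm
  rw [← hd, e, map_add, map_zsmul, map_sum]
  simp only [F.map_circ, hκ]

theorem IsCurv.map_mu (h : IsCurv Q κ Q₀) (h' : IsCurv Q' κ' Q₀')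
    (F : DGOperad.Hom Q Q') (hκ : F.map 0 (-1) κ = κ')
    (hF : ∀ n p x, x ∈ Q₀.carrier n p → F.map n p x ∈ Q₀'.carrier n p) (n : ℕ) :
    F.map n (-1) (h.mu n) = h'.mu n := by
  induction n with
  | zero => exact hκ
  | succ n ih =>
    rcases n with _ | n
    -- `μ₁` comes from `d κ`, which `map_der` does not cover, and is characterised by `d κ = -μ₁ ∘
    -- κ`. From there on `μ_{n+1} = D_0 μ_n` with `μ_n` in `Q₀`.
    · refine (h'.mu_one_unique (hF _ _ _ (h.mu_succ_mem 0)) ?_).symm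
      rw [← hκ, ← F.map_d, h.d_kappa_eq, map_neg, F.map_circ]
    · rw [← h.der_mu n 0 (by omega), ← h'.der_mu n 0 (by omega), ← ih]
      exact h.map_der h' F.toHom hκ hF 0 _ rfl (q := -2) (by omega) (h.mu_succ_mem n) (F.map_d _ _)

end Morphism

/-! ### Universal property of the free operad, and conditions that can be checked on generators -/

section Lift

variable (X : GrOperad.{u}) (m : ∀ n, X.obj n (-1))

/-- The value of a formal expression in an operad. -/
def preLift : ∀ {n : ℕ} {p : ℤ}, Pre.{u} n p → X.obj n p
  | _, _, .mu n => m n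
  | _, _, .one => X.one
  | _, _, .zero => 0
  | _, _, .add x y => preLift x + preLift y
  | _, _, .neg x => -preLift x
  | _, _, .circ i hi hk hr x y => X.circ i hi hk hr (preLift x) (preLift y)

theorem preLift_signed (e : ℤ) {n : ℕ} {p : ℤ} (x : Pre.{u} n p) :
    preLift X m (Pre.signed e x) = sgn e • preLift X m x := by
  unfold Pre.signed sgn
  split_ifs <;> simp [preLift]

theorem preLift_rel {n : ℕ} {p : ℤ} {x y : Pre.{u} n p} (h : Rel x y) :
    preLift X m x = preLift X m y := by
  induction h with
  | refl x => rfl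
  | symm _ ih => exact ih.symm
  | trans _ _ ih ih' => exact ih.trans ih'
  | add_congr _ _ ih ih' => simp [preLift, ih, ih']
  | neg_congr _ ih => simp [preLift, ih]
  | circ_congr i hi hk hr _ _ ih ih' => simp only [preLift, ih, ih']
  | add_assoc x y z => simp [preLift, add_assoc]
  | add_comm x y => simp [preLift, add_comm]
  | zero_add x => simp [preLift]
  | neg_add x => simp [preLift]
  | circ_add => simp [preLift]
  | add_circ => simp [preLift]
  | one_circ h₀ hk hr x => exact X.one_circ h₀ hk hr _
  | circ_one i hi hk hr x => exact X.circ_one i hi hk hr _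
  | circ_seq i j hi hj ha hpq hij ht hs hb hqr ht' hs' =>
    exact X.circ_seq i j hi hj ha hpq hij ht hs hb hqr ht' hs' _ _ _
  | circ_par i k k' hik hi hk ha hpq hkk hk' ht hs hb hpr hib ht' hs' =>
    rw [preLift_signed]
    exact X.circ_par i k k' hik hi hk ha hpq hkk hk' ht hs hb hpr hib ht' hs' _ _ _

/-- The morphism from the free operad which is given by the images of the generators. -/
def freeLift : GrOperad.Hom freeOperad.{u} X where
  map n p := AddMonoidHom.mk'
    (fun x => Quotient.lift (preLift X m) (fun _ _ h => preLift_rel X m h) x) (by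
      rintro ⟨x⟩ ⟨y⟩
      rfl)
  map_one := rfl
  map_circ i hi hk hr x y := by
    induction x using fmk_ind with | h x => ?_
    induction y using fmk_ind with | h y => ?_
    rfl

theorem free_mem_of_sub (S : SubOperad freeOperad.{u}) (h : ∀ n, freeMu n ∈ S.carrier n (-1))
    {n : ℕ} {p : ℤ} (x : freeOperad.{u}.obj n p) : x ∈ S.carrier n p := by
  induction x using fmk_ind with | h x => ?_
  induction x with
  | mu n => exact h n
  | one => exact S.one_mem
  | zero => exact zero_mem _
  | add x y hx hy => exact add_mem hx hy
  | neg x hx => exact neg_mem hx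
  | circ i hi hk hr x y hx hy => exact S.circ_mem i hi hk hr _ _ hx hy

variable {X} in
theorem free_hom_ext {f g : GrOperad.Hom freeOperad.{u} X}
    (h : ∀ n, f.map n (-1) (freeMu n) = g.map n (-1) (freeMu n)) : f = g :=
  GrOperad.Hom.ext (funext fun _ => funext fun _ => AddMonoidHom.ext fun x =>
    free_mem_of_sub (f.eqSub g) h x)

end Lift

theorem SubOperad.subset_closure {P : GrOperad.{u}} (s : ∀ n p, Set (P.obj n p)) {n : ℕ} {p : ℤ}
    {x : P.obj n p} (hx : x ∈ s n p) : x ∈ (SubOperad.closure s).carrier n p :=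
  (AddSubgroup.mem_iInf).2 fun S => S.2 n p hx

theorem SubOperad.closure_le {P : GrOperad.{u}} {s : ∀ n p, Set (P.obj n p)} (S : SubOperad P)
    (h : ∀ n p, s n p ⊆ S.carrier n p) {n : ℕ} {p : ℤ}
    {x : P.obj n p} (hx : x ∈ (SubOperad.closure s).carrier n p) : x ∈ S.carrier n p :=
  (AddSubgroup.mem_iInf).1 hx ⟨S, h⟩

/-- The preimage of a sub-operad. -/
def SubOperad.comap {P Q : GrOperad.{u}} (f : GrOperad.Hom P Q) (S : SubOperad Q) :
    SubOperad P where
  carrier n p := (S.carrier n p).comap (f.map n p)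
  one_mem := by
    change f.map 1 0 P.one ∈ S.carrier 1 0
    rw [f.map_one]
    exact S.one_mem
  circ_mem {m n k p q r} i hi hk hr x y hx hy := by
    change f.map k r _ ∈ S.carrier k r
    rw [f.map_circ]
    exact S.circ_mem i hi hk hr _ _ hx hy

/-- The sub-operad on which a morphism of graded operads commutes with the differentials. -/
def DGOperad.chainSub {P Q : DGOperad.{u}} (f : GrOperad.Hom P.toGrOperad Q.toGrOperad) :
    SubOperad P.toGrOperad where
  carrier n p := ((f.map n (p - 1)).comp (P.d (by omega))).eqLocus
    ((Q.d (by omega)).comp (f.map n p))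
  one_mem := by
    change f.map _ _ (P.d _ P.one) = Q.d _ (f.map _ _ P.one)
    rw [f.map_one, P.d_one, Q.d_one, map_zero]
  circ_mem {m n k p q r} i hi hk hr x y hx hy := by
    change f.map _ _ (P.d _ _) = Q.d _ (f.map _ _ _)
    have hx' : f.map _ _ (P.d _ _) = Q.d _ (f.map _ _ _) := hx
    have hy' : f.map _ _ (P.d _ _) = Q.d _ (f.map _ _ _) := hy
    rw [f.map_circ, P.d_circ i hi hk hr (p' := p - 1) (q' := q - 1) (by omega) (by omega) (by omega)
      (by omega) (by omega), Q.d_circ i hi hk hr (p' := p - 1) (q' := q - 1) (by omega) (by omega)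
      (by omega) (by omega) (by omega), map_add, map_zsmul, f.map_circ, f.map_circ, hx', hy']

theorem DGOperad.mem_chainSub {P Q : DGOperad.{u}}
    (f : GrOperad.Hom P.toGrOperad Q.toGrOperad) {n : ℕ} {p q : ℤ} (h : q + 1 = p)
    (x : P.obj n p) : x ∈ (chainSub f).carrier n p ↔ f.map n q (P.d h x) = Q.d h (f.map n p x) := by
  obtain rfl : q = p - 1 := by omega
  rfl

/-! ### Reduction of the conditions on objects of `Curv` -/

section MixedSub

variable {Q : DGOperad.{u}} (κ : Q.obj 0 (-1)) (Q₀ : SubOperad Q.toGrOperad)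

/-- The sub-operad of the operations in `Q₀` whose differential has components of weights zero and
one only. -/
def mixedSub : SubOperad Q.toGrOperad where
  carrier n p := Q₀.carrier n p ⊓
    (Q₀.carrier n (p - 1) ⊔ weightOne κ Q₀ n (p - 1)).comap (Q.d (by omega))
  one_mem := ⟨Q₀.one_mem, by
    refine AddSubgroup.mem_comap.2 ?_
    rw [Q.d_one]
    exact zero_mem _⟩
  circ_mem {m n k p q r} i hi hk hr x y hx hy := by
    obtain ⟨hx, hx'⟩ := hx
    obtain ⟨hy, hy'⟩ := hy
    obtain ⟨a, ha, b, hb, e⟩ := AddSubgroup.mem_sup.1 (AddSubgroup.mem_comap.1 hx')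
    obtain ⟨a', ha', b', hb', e'⟩ := AddSubgroup.mem_sup.1 (AddSubgroup.mem_comap.1 hy')
    refine ⟨Q₀.circ_mem _ _ _ _ _ _ hx hy, ?_⟩
    refine AddSubgroup.mem_comap.2 ?_
    rw [Q.d_circ i hi hk hr (p' := p - 1) (q' := q - 1) (by omega) (by omega) (by omega)
      (by omega) (by omega), ← e, ← e', map_add, map_add, AddMonoidHom.add_apply]
    refine add_mem (add_mem ?_ ?_) (zsmul_sgn_mem _ (add_mem ?_ ?_))
    · exact AddSubgroup.mem_sup_left (Q₀.circ_mem _ _ _ _ _ _ ha hy)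
    · exact AddSubgroup.mem_sup_right (weightOne_circ κ Q₀ _ _ _ _ hb hy)
    · exact AddSubgroup.mem_sup_left (Q₀.circ_mem _ _ _ _ _ _ hx ha')
    · exact AddSubgroup.mem_sup_right (circ_weightOne κ Q₀ _ _ _ _ hx hb')

end MixedSub

/-- The coproduct condition implies that `κ` is not in `Q₀`, unless the operad vanishes. -/
theorem kappa_notMem_of_coproduct {Q : GrOperad.{u}} {κ : Q.obj 0 (-1)} {Q₀ : SubOperad Q}
    (h : ∀ (X : GrOperad.{u}) (g : GrOperad.Hom Q₀.toGrOperad X) (x : X.obj 0 (-1)),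
      ∃ φ : GrOperad.Hom Q X, (∀ (n : ℕ) (p : ℤ) (y : Q₀.carrier n p), φ.map n p y.1 = g.map n p y)
        ∧ φ.map 0 (-1) κ = x) (h1 : Q.one ≠ 0) : κ ∉ Q₀.carrier 0 (-1) := by
  intro hκ
  obtain ⟨φ, h₁, h₂⟩ := h _ (hatIncl Q₀.toGrOperad) (hatKappa Q₀.toGrOperad)
  have e := (h₁ 0 (-1) ⟨κ, hκ⟩).symm.trans h₂
  -- The coefficient of the one-letter word `κ` is zero in the image of `Q₀` and is the unit in
  -- `hatKappa`; if `κ` were in `Q₀`, the unit would vanish.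
  obtain ⟨w, hw⟩ : ∃ w : Word 0 (-1) 1 0, w.w = [ka] := ⟨kWord 0 0 rfl rfl (by omega), rfl⟩
  have e₁ : hatEval Q₀.toGrOperad w ((hatIncl Q₀.toGrOperad).map 0 (-1) ⟨κ, hκ⟩) = 0 :=
    hatInclFun_ne Q₀.toGrOperad ⟨κ, hκ⟩ w (by simp [hw])
  have e₂ : hatEval Q₀.toGrOperad w (hatKappa Q₀.toGrOperad) = Q₀.toGrOperad.one :=
    hatKappa_ka Q₀.toGrOperad w hw
  have e' := congrArg (hatEval Q₀.toGrOperad w) e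
  rw [e₁, e₂] at e'
  exact h1 (congrArg (Q₀.incl.map 1 0) e').symm

/-! ### Sums of A-infinity type -/

section TripleSum

variable (P : GrOperad.{u})

/-- The sum `∑_{p+q+r=n} A_{p+1+r} ∘_{p+1} B_q`. -/
noncomputable def tripleSum {a b s : ℤ} (A : ∀ n, P.obj n a) (B : ∀ n, P.obj n b) (n : ℕ)
    (hs : a + b = s) : P.obj n s :=
  ∑ t : Triple n, P.circ (m := t.p + 1 + t.r) (n := t.q) t.p (by omega)
    (by have := t.sum_eq; omega) hs (A (t.p + 1 + t.r)) (B t.q)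

/-- Splitting off the terms with `q = 0`, which insert `B 0` into one input of `A (n + 1)`,
separates the weight one part of a curved A-infinity relation from its weight zero part. -/
theorem tripleSum_eq {a b s : ℤ} (A : ∀ n, P.obj n a) (B : ∀ n, P.obj n b) (n : ℕ)
    (hs : a + b = s) : tripleSum P A B n hs =
      ∑ i : Fin (n + 1), P.circ (k := n) i.1 i.2 (by omega) hs (A (n + 1)) (B 0) +
      ∑ t : Triple n, if t.q = 0 then 0 else
        P.circ (m := t.p + 1 + t.r) (n := t.q) t.p (by omega)
          (by have := t.sum_eq; omega) hs (A (t.p + 1 + t.r)) (B t.q) := by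
  have e : tripleSum P A B n hs = ∑ t : Triple n, (if t.q = 0 then
      P.circ (m := t.p + 1 + t.r) (n := t.q) (k := n) t.p (by omega)
          (by have := t.sum_eq; omega) hs (A (t.p + 1 + t.r)) (B t.q) else 0) +
      ∑ t : Triple n, if t.q = 0 then 0 else
        P.circ (m := t.p + 1 + t.r) (n := t.q) t.p (by omega)
          (by have := t.sum_eq; omega) hs (A (t.p + 1 + t.r)) (B t.q) := by
    rw [← Finset.sum_add_distrib]
    refine Finset.sum_congr rfl (fun t _ => ?_)
    split_ifs <;> simp
  rw [e]
  refine congrArg (· + _) (Eq.symm ?_)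
  -- The triples with `q = 0` are the `(i, 0, n - i)`.
  refine Fintype.sum_of_injective
    (fun i : Fin (n + 1) => (⟨i.1, 0, n - i.1, by omega⟩ : Triple n)) ?_ _ _ ?_ ?_
  · intro i j h
    exact Fin.ext (congrArg Triple.p h)
  · rintro ⟨p, q, r, h⟩ ht
    refine if_neg (fun hq => ht ⟨⟨p, by omega⟩, ?_⟩)
    dsimp only at hq
    exact Triple.ext rfl hq.symm (by dsimp only; omega)
  · intro i
    rw [if_pos rfl]
    have hA : ∀ k, k = n + 1 → SameOp P (A (n + 1)) (A k) := by
      rintro k rfl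
      exact ⟨rfl, rfl, HEq.rfl⟩
    exact P.circ_same rfl _ _ _ _ _ _ (hA _ (by dsimp only; omega)) ⟨rfl, rfl, HEq.rfl⟩

theorem ainfSum_eq_tripleSum (μ : ∀ n, P.obj n (-1)) (n : ℕ) :
    ainfSum P μ n rfl = tripleSum P μ μ (s := -2) n rfl := rfl

end TripleSum

/-! ### The curved A-infinity operad as an object of `Curv` -/

theorem cAinf_mu_mem (n : ℕ) :
    cAinf.mu.{u} (n + 1) ∈ cAinf.sub.{u}.carrier (n + 1) (-1) :=
  SubOperad.subset_closure _ ⟨by omega, rfl, rfl⟩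

theorem cAinf_d_mu (n : ℕ) {q : ℤ} (h : q + 1 = -1) : cAinf.{u}.d h (cAinf.mu n) =
    -tripleSum cAinf.{u}.toGrOperad cAinf.mu cAinf.mu n (by omega) := by
  obtain rfl : q = -2 := by omega
  exact freeD_mu n h

theorem cAinf_rest_mem (n : ℕ) {s : ℤ} (hs : (-1 : ℤ) + -1 = s) :
    (∑ t : Triple n, if t.q = 0 then 0 else
      cAinf.{u}.circ (m := t.p + 1 + t.r) (n := t.q) t.p (by omega)
        (by have := t.sum_eq; omega) hs (cAinf.mu (t.p + 1 + t.r)) (cAinf.mu t.q)) ∈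
      cAinf.sub.{u}.carrier n s := by
  refine sum_mem (fun t _ => ?_)
  split_ifs with h
  · exact zero_mem _
  · refine cAinf.sub.circ_mem _ _ _ _ _ _ ?_ ?_
    · obtain ⟨k, hk⟩ : ∃ k, t.p + 1 + t.r = k + 1 := ⟨t.p + t.r, by omega⟩
      rw [hk]
      exact cAinf_mu_mem k
    · obtain ⟨k, hk⟩ : ∃ k, t.q = k + 1 := ⟨t.q - 1, by omega⟩
      rw [hk]
      exact cAinf_mu_mem k

theorem cAinf_sum_kappa_mem (n : ℕ) {s : ℤ} (hs : (-1 : ℤ) + -1 = s) :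
    (∑ i : Fin (n + 1), cAinf.{u}.circ (k := n) i.1 i.2 (by omega) hs (cAinf.mu (n + 1)) (cAinf.mu 0)) ∈
      weightOne (cAinf.mu.{u} 0) cAinf.sub.{u} n s :=
  sum_mem (fun _ _ => circ_kappa_mem_weightOne _ _ _ _ _ _ (cAinf_mu_mem n))

/-- Being free on all `μ_n`, the operad is the coproduct of the sub-operad on the `μ_n` with `n > 0`
and the operad on `μ₀`. The terms of `d μ_n` contain either one `μ₀` in the inner place or none, by
`tripleSum_eq`. -/
theorem cAinf_isCurv : IsCurv cAinf.{u} (cAinf.mu 0) cAinf.sub := by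
  have hdκ : HasWeight cAinf.{u} (cAinf.mu 0) cAinf.sub 1
      (cAinf.d (q := -2) (by norm_num) (cAinf.mu 0)) := by
    rw [cAinf_d_mu, tripleSum_eq]
    refine .neg _ (.of_weightOne (add_mem (cAinf_sum_kappa_mem 0 _) ?_))
    refine sum_mem (fun t _ => ?_)
    -- In arity zero the sum over triples has only the term with `q = 0`.
    rw [if_pos (by have := t.sum_eq; omega)]
    exact zero_mem _
  have hcop : ∀ (X : GrOperad.{u}) (g : GrOperad.Hom cAinf.sub.{u}.toGrOperad X)
      (x : X.obj 0 (-1)), ∃ φ : GrOperad.Hom cAinf.{u}.toGrOperad X,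
      (∀ (n : ℕ) (p : ℤ) (y : cAinf.sub.{u}.carrier n p), φ.map n p y.1 = g.map n p y) ∧
        φ.map 0 (-1) (cAinf.mu 0) = x := by
    intro X g x
    let φ := freeLift X (fun n => match n with
      | 0 => x
      | n + 1 => g.map (n + 1) (-1) ⟨cAinf.mu (n + 1), cAinf_mu_mem n⟩)
    refine ⟨φ, fun n p y => ?_, rfl⟩
    -- The locus where `φ` and `g` agree lives in the sub-operad; its image in the whole operad is
    -- taken because `closure_le` compares sub-operads of the ambient operad.
    let S : SubOperad cAinf.{u}.toGrOperad :=
      { carrier := fun n p => ((φ.comp cAinf.sub.incl).eqSub g).carrier n p |>.map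
          (cAinf.sub.incl.map n p)
        one_mem := ⟨_, ((φ.comp cAinf.sub.incl).eqSub g).one_mem, rfl⟩
        circ_mem := by
          rintro m n k p q r i hi hk hr _ _ ⟨x, hx, rfl⟩ ⟨y, hy, rfl⟩
          exact ⟨_, ((φ.comp cAinf.sub.incl).eqSub g).circ_mem i hi hk hr x y hx hy, rfl⟩ }
    have hS : y.1 ∈ S.carrier n p := by
      refine SubOperad.closure_le S ?_ y.2
      rintro n p x ⟨hn, rfl, rfl⟩
      obtain ⟨k, rfl⟩ : ∃ k, n = k + 1 := ⟨n - 1, by omega⟩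
      exact ⟨⟨cAinf.mu (k + 1), cAinf_mu_mem k⟩, rfl, rfl⟩
    obtain ⟨y', hy', e⟩ := hS
    obtain rfl : y' = y := Subtype.ext e
    exact hy'
  refine ⟨kappa_notMem_of_coproduct hcop, fun X g x => ?_, strict_mixed_of ?_ hdκ, hdκ⟩
  · obtain ⟨φ, h₁, h₂⟩ := hcop X g x
    refine ⟨φ, ⟨h₁, h₂⟩, ?_⟩
    rintro ψ ⟨h₃, h₄⟩
    refine free_hom_ext (fun n => ?_)
    rcases n with _ | n
    · exact h₄.trans h₂.symm
    · exact (h₃ _ _ ⟨cAinf.mu (n + 1), cAinf_mu_mem n⟩).trans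
        (h₁ _ _ ⟨cAinf.mu (n + 1), cAinf_mu_mem n⟩).symm
  · intro n p q h x hx
    obtain rfl : q = p - 1 := by omega
    -- The weight condition on `d` is stable under composition, so it suffices to know it for the
    -- generators.
    have hS : x ∈ (mixedSub (cAinf.mu.{u} 0) cAinf.sub).carrier n p := by
      refine SubOperad.closure_le _ ?_ hx
      rintro n p x ⟨hn, rfl, rfl⟩
      obtain ⟨k, rfl⟩ : ∃ k, n = k + 1 := ⟨n - 1, by omega⟩
      refine ⟨cAinf_mu_mem k, ?_⟩
      refine AddSubgroup.mem_comap.2 ?_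
      change cAinf.d _ (cAinf.mu (k + 1)) ∈ (_ : AddSubgroup _)
      rw [cAinf_d_mu, tripleSum_eq]
      exact neg_mem (add_mem (AddSubgroup.mem_sup_right (cAinf_sum_kappa_mem _ _))
        (AddSubgroup.mem_sup_left (cAinf_rest_mem _ _)))
    obtain ⟨y, hy, z, hz, e⟩ := AddSubgroup.mem_sup.1 (AddSubgroup.mem_comap.1 hS.2)
    exact ⟨y, z, hy, hz, e.symm⟩

/-- In `d μ_n` the letter `μ₀` is inserted into each input of `-μ_{n+1}`, so the recursion defining
`mu` returns the generators. -/
theorem cAinf_mu_eq (hA : IsCurv cAinf.{u} (cAinf.mu 0) cAinf.sub) (n : ℕ) :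
    hA.mu n = cAinf.mu n := by
  induction n with
  | zero => rfl
  | succ n ih =>
    rw [IsCurv.mu, ih, cAinf_d_mu, tripleSum_eq, map_neg, neg_neg, map_add,
      hA.pick_of_mem _ _ _ _ (cAinf_rest_mem n _), add_zero,
      hA.pick_sum _ _ _ _ _ _ (fun _ => cAinf.mu (n + 1)) (fun _ => cAinf_mu_mem n)]

/-! ### The curved A-infinity relations in an object of `Curv`, and initiality -/

section Initial

variable {Q : DGOperad.{u}} {κ : Q.obj 0 (-1)} {Q₀ : SubOperad Q.toGrOperad}

/-- The operations `mu n` satisfy the curved A-infinity relations. -/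
theorem IsCurv.d_mu (h : IsCurv Q κ Q₀) (n : ℕ) :
    Q.d (q := -2) (by omega) (h.mu n) = -tripleSum Q.toGrOperad h.mu h.mu (s := -2) n rfl := by
  have main : ∀ n, ∀ k, k ≤ n →
      Q.d (q := -2) (by omega) (h.mu k) = -tripleSum Q.toGrOperad h.mu h.mu (s := -2) k rfl := by
    intro n
    induction n with
    | zero =>
      intro k hk
      obtain rfl : k = 0 := by omega
      rw [tripleSum_eq, Fin.sum_univ_one, Finset.sum_eq_zero, add_zero]
      · exact h.d_kappa_eq
      · intro t _
        exact if_pos (by have := t.sum_eq; omega)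
    | succ n ih =>
      intro k hk
      rcases Nat.lt_or_ge k (n + 1) with hk' | hk'
      · exact ih k (by omega)
      obtain rfl : k = n + 1 := by omega
      -- `e k` is the defect of the `k`-th relation.
      let e : ∀ k, Q.obj k (-2) := fun k =>
        Q.d (q := -2) (by omega) (h.mu k) + tripleSum Q.toGrOperad h.mu h.mu (s := -2) k rfl
      have hd : ∀ k, Q.d (q := -2) (by omega) (h.mu k) =
          e k - tripleSum Q.toGrOperad h.mu h.mu (s := -2) k rfl := fun k => by simp [e]
      have he : ∀ k ≤ n, e k = 0 := fun k hk => by simp [e, ih k hk]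
      -- The weight one part of `d μ_{n+1}` is `-∑ D_i μ_{n+1} ∘ κ = -∑ μ_{n+2} ∘ κ`, which cancels
      -- the terms with `q = 0` of the sum.
      have hmem : e (n + 1) ∈ Q₀.carrier (n + 1) (-2) := by
        obtain ⟨y, hy, ey⟩ := h.d_eq (q := -2) (by omega) rfl rfl (by omega) (h.mu_succ_mem n)
        have : e (n + 1) = y + ∑ t : Triple (n + 1), if t.q = 0 then 0 else
            Q.circ (m := t.p + 1 + t.r) (n := t.q) t.p (by omega)
            (by have := t.sum_eq; omega) (by omega) (h.mu (t.p + 1 + t.r)) (h.mu t.q) := by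
          simp only [e]
          rw [ey, tripleSum_eq, sgn_neg_one, neg_one_smul]
          simp only [h.der_mu]
          rw [add_assoc]
          exact congrArg _ (neg_add_cancel_left _ _)
        rw [this]
        refine add_mem hy (sum_mem (fun t _ => ?_))
        split_ifs with h'
        · exact zero_mem _
        · refine Q₀.circ_mem _ _ _ _ _ _ ?_ ?_
          · obtain ⟨k, hk⟩ : ∃ k, t.p + 1 + t.r = k + 1 := ⟨t.p + t.r, by omega⟩
            rw [hk]
            exact h.mu_succ_mem k
          · obtain ⟨k, hk⟩ : ∃ k, t.q = k + 1 := ⟨t.q - 1, by omega⟩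
            rw [hk]
            exact h.mu_succ_mem k
      -- The Leibniz rule is applied to each `μ ∘ μ` and `d μ` is replaced by its defect minus the
      -- quadratic sum; the resulting cubic terms cancel by `ainf_square`.
      have key : Q.d (q := -3) (by omega) (tripleSum Q.toGrOperad h.mu h.mu (s := -2) n rfl) =
          tripleSum Q.toGrOperad e h.mu (s := -3) n rfl - tripleSum Q.toGrOperad h.mu e (s := -3) n rfl := by
        have sq := ainf_square Q.toGrOperad h.mu n (s := -3) rfl rfl
        rw [← sub_eq_zero] at sq
        rw [← sub_zero (tripleSum _ _ _ _ _ - _), ← sq]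
        simp only [tripleSum, map_sum]
        rw [← Finset.sum_sub_distrib, ← Finset.sum_sub_distrib, ← Finset.sum_sub_distrib]
        refine Finset.sum_congr rfl (fun t _ => ?_)
        rw [Q.d_circ (p := -1) (q := -1) (r := -2) (p' := -2) (q' := -2) _ _ _ _ (by omega)
          (by omega) _ rfl rfl, hd, hd,
          sgn_neg_one, neg_one_smul]
        simp only [map_sub, AddMonoidHom.sub_apply]
        rw [ainfSum_eq_tripleSum, ainfSum_eq_tripleSum]
        abel
      have key' : Q.d (q := -3) (by omega) (tripleSum Q.toGrOperad h.mu h.mu (s := -2) n rfl) = 0 := by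
        have := Q.d_d (q := -2) (r := -3) (by omega) (by omega) (h.mu n)
        rw [ih n le_rfl, map_neg, neg_eq_zero] at this
        exact this
      have h0 : tripleSum Q.toGrOperad h.mu e n (rfl : (-1 : ℤ) + -2 = -3) = 0 :=
        Finset.sum_eq_zero (fun t _ => by
          rw [he t.q (by have := t.sum_eq; omega), map_zero])
      -- All defects of index at most `n` vanish. What is left is `e (n + 1)` with `κ` inserted into
      -- each input, and `pick_sum` then gives `e (n + 1) = 0`.
      rw [key', h0, sub_zero, tripleSum_eq, Finset.sum_eq_zero (s := (Finset.univ : Finset (Triple n))),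
        add_zero] at key
      · have := congrArg (h.pick 0 (p' := -2) (by omega) rfl (by omega)) key
        rw [map_zero] at this
        have e0 : e (n + 1) = 0 := ((h.pick_sum 0 (by omega) rfl (by omega) rfl (by omega)
          (fun _ => e (n + 1)) (fun _ => hmem)).symm.trans this.symm)
        exact eq_neg_of_add_eq_zero_left e0
      · intro t _
        split_ifs with h'
        · rfl
        · rw [he _ (by have := t.sum_eq; omega), map_zero, AddMonoidHom.zero_apply]
  exact main n n le_rfl

/-- The morphism from the curved A-infinity operad to an object of `Curv`. -/
noncomputable def IsCurv.fromCAinf (h : IsCurv Q κ Q₀) : cAinf.{u} ⟶ Q where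
  toHom := freeLift Q.toGrOperad h.mu
  map_d {n p q} hq x := by
    -- Compatibility with the differentials passes to compositions, so it is checked on the
    -- generators, where it is `d_mu`.
    refine (DGOperad.mem_chainSub (P := cAinf) _ hq x).1 (free_mem_of_sub _ (fun n => ?_) x)
    refine (DGOperad.mem_chainSub (P := cAinf) (q := -2) _ (by omega) _).2 ?_
    refine (congrArg ((freeLift Q.toGrOperad h.mu).map n (-2)) (cAinf_d_mu n _)).trans ?_
    refine (map_neg ((freeLift Q.toGrOperad h.mu).map n (-2)) _).trans ?_
    refine Eq.trans (congrArg Neg.neg ?_) (h.d_mu n).symm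
    refine (map_sum ((freeLift Q.toGrOperad h.mu).map n (-2)) _ _).trans ?_
    refine Finset.sum_congr rfl fun t _ => ?_
    exact (freeLift Q.toGrOperad h.mu).map_circ _ _ _ _ _ _

theorem cAinf_hom_ext {f g : cAinf.{u} ⟶ Q}
    (h : ∀ n, f.map n (-1) (cAinf.mu n) = g.map n (-1) (cAinf.mu n)) : f = g := by
  have e : f.toHom = g.toHom := free_hom_ext h
  exact DGOperad.Hom.ext (congrArg GrOperad.Hom.map e)

/-- The curved A-infinity operad is the initial object of `Curv`. -/
noncomputable def cAinfInitial (hA : IsCurv cAinf.{u} (cAinf.mu 0) cAinf.sub) :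
    Limits.IsInitial (cAinfCurv hA) :=
  Limits.IsInitial.ofUniqueHom
    (fun X => ⟨X.isCurv.fromCAinf, rfl, fun n p x hx => by
      refine SubOperad.closure_le (SubOperad.comap X.isCurv.fromCAinf.toHom X.Q₀) ?_ hx
      rintro n p x ⟨hn, rfl, rfl⟩
      obtain ⟨k, rfl⟩ : ∃ k, n = k + 1 := ⟨n - 1, by omega⟩
      exact X.isCurv.mu_succ_mem k⟩)
    -- A morphism of `Curv` sends the `μ_n` of its source, here the generators, to those of its
    -- target.
    (fun X m => Curv.Hom.ext (cAinf_hom_ext fun n => by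
      have e := hA.map_mu X.isCurv m.hom m.map_κ m.map_mem n
      rw [cAinf_mu_eq] at e
      exact e))

end Initial

/-! ### Replacing a slot of a word by `κ` or `α` -/

section Fill

variable {n m : ℕ} {p p' : ℤ} {N : ℕ} {q : ℤ}

theorem Word.exists_pre (w : Word m p N q) {i : ℕ} (hi : i < m) :
    ∃ t : List Letter × List Letter, t.1 ++ slot :: t.2 = w.w ∧ t.1.count slot = i := by
  obtain ⟨A, B, h₁, h₂⟩ := exists_slot (w := w.w) (i := i) (by rw [w.slots_eq]; exact hi)
  exact ⟨(A, B), h₁, h₂⟩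

/-- The part of a word to the left of a given slot. -/
noncomputable def Word.pre (w : Word m p N q) (i : ℕ) (hi : i < m) : List Letter :=
  (w.exists_pre hi).choose.1

/-- The part of a word to the right of a given slot. -/
noncomputable def Word.post (w : Word m p N q) (i : ℕ) (hi : i < m) : List Letter :=
  (w.exists_pre hi).choose.2

theorem Word.pre_post (w : Word m p N q) (i : ℕ) (hi : i < m) :
    w.pre i hi ++ slot :: w.post i hi = w.w := (w.exists_pre hi).choose_spec.1

theorem Word.count_pre (w : Word m p N q) (i : ℕ) (hi : i < m) :
    (w.pre i hi).count slot = i := (w.exists_pre hi).choose_spec.2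

theorem Word.pre_eq (w : Word m p N q) (i : ℕ) (hi : i < m) {A B : List Letter}
    (h : w.w = A ++ slot :: B) (hA : A.count slot = i) : w.pre i hi = A ∧ w.post i hi = B :=
  slot_inj ((w.pre_post i hi).trans h) ((w.count_pre i hi).trans hA.symm)

/-- The word obtained by replacing a slot by `κ`. -/
noncomputable def Word.fillKa (w : Word m p' N q) (i : ℕ) (hi : i < m) (hk : n + 1 = m + 0)
    (hr : p' + -1 = p) : Word n p N q where
  w := w.pre i hi ++ ka :: w.post i hi
  slots_eq := by
    have h := congrArg (List.count slot) (w.pre_post i hi)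
    rw [w.slots_eq] at h
    simp at h ⊢
    omega
  length_eq := by
    have h := congrArg List.length (w.pre_post i hi)
    rw [w.length_eq] at h
    simpa using h
  degree_eq := by
    have h := congrArg kap (w.pre_post i hi)
    have h' := w.degree_eq
    simp only [kap_append, kap_ka, kap_slot] at *
    omega

/-- The word obtained by replacing a slot by `α`. -/
noncomputable def Word.fillAl (w : Word m p N q) (i : ℕ) (hi : i < m) (hm : m = n + 1) :
    Word n p N q where
  w := w.pre i hi ++ al :: w.post i hi
  slots_eq := by
    have h := congrArg (List.count slot) (w.pre_post i hi)
    rw [w.slots_eq] at h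
    simp at h ⊢
    omega
  length_eq := by
    have h := congrArg List.length (w.pre_post i hi)
    rw [w.length_eq] at h
    simpa using h
  degree_eq := by
    have h := congrArg kap (w.pre_post i hi)
    have h' := w.degree_eq
    simp only [kap_append, kap_al, kap_slot] at *
    omega

end Fill

/-! ### Decomposition of the completed coproduct along the leftmost `κ` -/

section Head

variable {P : GrOperad.{u}}

/-- The coefficients of the words in which the leftmost `κ` has exactly `i` slots on its left, with
this `κ` replaced by a slot. -/
noncomputable def headK {n m : ℕ} {p p' : ℤ} (i : ℕ) (hi : i < m) (hk : n + 1 = m + 0)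
    (hr : p' + -1 = p) : hatObj P n p →+ hatObj P m p' :=
  AddMonoidHom.mk' (fun y => ⟨fun N q w => if ka ∈ w.pre i hi then 0 else
      sgn (kap (w.post i hi)) • y.1 N q (w.fillKa i hi hk hr), by
    obtain ⟨B, hB⟩ := y.2
    refine ⟨B, fun N q w hw => ?_⟩
    dsimp only
    rw [hB, smul_zero, ite_self]
    have h := congrArg kap (w.pre_post i hi)
    simp only [Word.fillKa, kap_append, kap_ka, kap_slot] at *
    omega⟩) (fun y y' => by
      ext N q w
      change (if ka ∈ w.pre i hi then (0 : P.obj N q) else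
        sgn (kap (w.post i hi)) • (y.1 N q (w.fillKa i hi hk hr) + y'.1 N q (w.fillKa i hi hk hr))) =
        (if ka ∈ w.pre i hi then (0 : P.obj N q) else _) +
          (if ka ∈ w.pre i hi then (0 : P.obj N q) else _)
      split_ifs
      · rw [add_zero]
      · exact smul_add _ _ _)

theorem headK_apply {n m : ℕ} {p p' : ℤ} (i : ℕ) (hi : i < m) (hk : n + 1 = m + 0)
    (hr : p' + -1 = p) (y : hatObj P n p) {N : ℕ} {q : ℤ} (w : Word m p' N q) (w' : Word n p N q)
    (A B : List Letter) (hw : w.w = A ++ slot :: B) (hA : A.count slot = i)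
    (hw' : w'.w = A ++ ka :: B) : (headK i hi hk hr y).1 N q w =
      if ka ∈ A then 0 else sgn (kap B) • y.1 N q w' := by
  change ite _ _ _ = _
  obtain ⟨e₁, e₂⟩ := w.pre_eq i hi hw hA
  have e : w.fillKa i hi hk hr = w' := Word.ext (by
    rw [hw', ← e₁, ← e₂]
    rfl)
  rw [e, e₁, e₂]

/-- The coefficients of the words in `α`, with one `α` replaced by a slot. -/
noncomputable def headA {n m : ℕ} {p : ℤ} (i : ℕ) (hi : i < m) (hm : m = n + 1) :
    hatObj P n p →+ hatObj P m p :=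
  AddMonoidHom.mk' (fun y => ⟨fun N q w => y.1 N q (w.fillAl i hi hm), by
    obtain ⟨B, hB⟩ := y.2
    refine ⟨B, fun N q w hw => hB _ _ _ ?_⟩
    have h := congrArg kap (w.pre_post i hi)
    simp only [Word.fillAl, kap_append, kap_al, kap_slot] at *
    omega⟩) (fun _ _ => rfl)

theorem headA_apply {n m : ℕ} {p : ℤ} (i : ℕ) (hi : i < m) (hm : m = n + 1)
    (y : hatObj P n p) {N : ℕ} {q : ℤ} (w : Word m p N q) (w' : Word n p N q)
    (A B : List Letter) (hw : w.w = A ++ slot :: B) (hA : A.count slot = i)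
    (hw' : w'.w = A ++ al :: B) : (headA i hi hm y).1 N q w = y.1 N q w' := by
  obtain ⟨e₁, e₂⟩ := w.pre_eq i hi hw hA
  have e : w.fillAl i hi hm = w' := Word.ext (by
    rw [hw', ← e₁, ← e₂]
    rfl)
  exact congrArg (y.1 N q) e

/-- The part of weight zero. -/
noncomputable def zeroPart (n : ℕ) (p : ℤ) : hatObj P n p →+ (hatAlpha P).toGrOperad.obj n p :=
  AddMonoidHom.mk' (fun y => ⟨⟨fun N q w => if ka ∈ w.w then 0 else y.1 N q w, by
      obtain ⟨B, hB⟩ := y.2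
      refine ⟨B, fun N q w hw => ?_⟩
      dsimp only
      rw [hB N q w hw, ite_self]⟩, fun N q w hw => if_pos hw⟩)
    (fun y y' => by
      refine Subtype.ext (Subtype.ext (funext fun N => funext fun q => funext fun w => ?_))
      change (if ka ∈ w.w then (0 : P.obj N q) else y.1 N q w + y'.1 N q w) =
        (if ka ∈ w.w then (0 : P.obj N q) else _) + (if ka ∈ w.w then (0 : P.obj N q) else _)
      split_ifs
      · rw [add_zero]
      · rfl)

theorem zeroPart_apply {n : ℕ} {p : ℤ} (y : hatObj P n p) {N : ℕ} {q : ℤ} (w : Word n p N q) :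
    (show hatObj P n p from (zeroPart n p y).1).1 N q w = if ka ∈ w.w then 0 else y.1 N q w := rfl

theorem zeroPart_of_mem {n : ℕ} {p : ℤ} (y : hatObj P n p) (hy : y ∈ (hatAlpha P).carrier n p) :
    zeroPart n p y = ⟨y, hy⟩ := by
  refine Subtype.ext (Subtype.ext (funext fun N => funext fun q => funext fun w => ?_))
  refine (zeroPart_apply y w).trans ?_
  split_ifs with h
  · exact (hy N q w h).symm
  · rfl

/-- No `κ` occurs to the left of the given slot. -/
def LeftFree {m : ℕ} {p : ℤ} (i : ℕ) (y : hatObj P m p) : Prop :=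
  ∀ (N : ℕ) (q : ℤ) (w : Word m p N q) (A B : List Letter), w.w = A ++ slot :: B →
    A.count slot = i → ka ∈ A → y.1 N q w = 0

theorem leftFree_of_mem {m : ℕ} {p : ℤ} (i : ℕ) {y : hatObj P m p}
    (hy : y ∈ (hatAlpha P).carrier m p) : LeftFree i y := by
  intro N q w A B hw _ h
  refine hy N q w ?_
  rw [hw]
  simp [h]

theorem leftFree_headK {n m : ℕ} {p p' : ℤ} (i : ℕ) (hi : i < m) (hk : n + 1 = m + 0)
    (hr : p' + -1 = p) (y : hatObj P n p) : LeftFree i (headK i hi hk hr y) := by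
  intro N q w A B hw hA h
  refine if_pos ?_
  rwa [(w.pre_eq i hi hw hA).1]

/-- A `κ` inserted at the later slot `l` stands to the right of slot `i`. Any `κ` to the left of
slot `i` was thus already present in `y`, to the left of both slots, which either hypothesis
excludes. -/
theorem leftFree_circ {m k : ℕ} {p r : ℤ} (i l : ℕ) (hil : i < l)
    (hk : k + 1 = m + 0) (hr : p + -1 = r) {y : hatObj P m p}
    (hy : LeftFree i y ∨ LeftFree l y) : LeftFree i (hatCirc P l hk hr y (hatKappa P)) := by
  intro N q w A B hw hA h
  refine hatCirc_kappa_eq_zero P l hk hr y w ?_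
  rintro ⟨A', B', e⟩ hA'
  dsimp only at hA'
  rcases letter_cases' (by decide) (hw.symm.trans e.symm) with ⟨C, e₁, e₂⟩ | ⟨C, e₁, e₂⟩
  · rw [e₁] at hA
    simp at hA
    omega
  · subst e₁ e₂
    rcases hy with hy | hy
    · exact hy _ _ _ A (C ++ slot :: B') (by simp [KSplit.slotted]) hA h
    · exact hy _ _ _ (A ++ slot :: C) B' rfl hA' (by simp [h])

theorem zeroPart_circ_kappa {m k : ℕ} {p r : ℤ} (i : ℕ)
    (hk : k + 1 = m + 0) (hr : p + -1 = r) (y : hatObj P m p) :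
    zeroPart k r (hatCirc P i hk hr y (hatKappa P)) = 0 := by
  refine Subtype.ext (Subtype.ext (funext fun N => funext fun q => funext fun w => ?_))
  refine (zeroPart_apply _ w).trans ?_
  split_ifs with h
  · rfl
  · exact hatCirc_kappa_eq_zero P i hk hr y w (fun t => absurd t.ka_mem h)

/-- Without a `κ` to the left of slot `i`, the inserted `κ` can only be the leftmost one of a word,
so that `headK` undoes the insertion and its sign. -/
theorem headK_circ_kappa {m k m' : ℕ} {p r p' : ℤ} (i j : ℕ) (hj : j < m')
    (hk : k + 1 = m + 0) (hr : p + -1 = r) (hk' : k + 1 = m' + 0) (hr' : p' + -1 = r)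
    {y : hatObj P m p} (hy : LeftFree i y) :
    headK j hj hk' hr' (hatCirc P i hk hr y (hatKappa P)) =
      if i = j then P.hat.cast (by omega) (by omega) y else 0 := by
  obtain rfl : m' = m := by omega
  obtain rfl : p' = p := by omega
  refine Subtype.ext (funext fun N => funext fun q => funext fun w => ?_)
  have hw := (w.pre_post j hj).symm
  have hA := w.count_pre j hj
  rw [headK_apply j hj hk' hr' _ w (w.fillKa j hj hk' hr') _ _ hw hA rfl]
  split_ifs with h₁ h₂ h₂
  · subst h₂
    exact (hy N q w _ _ hw hA h₁).symm
  · rfl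
  · subst h₂
    rw [hatCirc_kappa_single P i hk hr y _ ⟨_, _, rfl⟩, if_pos hA, sgn_smul_sgn_smul]
    · exact (hat_same y _ _ (w.pre_post i hj)).eq
    · rintro ⟨A', B', e⟩ ht hA'
      rcases ka_cases e with ⟨rfl, rfl⟩ | ⟨C, rfl, -⟩ | ⟨C, e', -⟩
      · exact absurd rfl ht
      · exact hy _ _ _ _ B' rfl hA' (by simp)
      · exact absurd (by rw [e']; simp) h₁
  · refine (congrArg _ (hatCirc_kappa_eq_zero P i hk hr y _ ?_)).trans (smul_zero _)
    rintro ⟨A', B', e⟩ hA'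
    rcases ka_cases e with ⟨rfl, rfl⟩ | ⟨C, rfl, -⟩ | ⟨C, e', -⟩
    · exact absurd (hA'.symm.trans hA) h₂
    · exact hy _ _ _ _ B' rfl hA' (by simp)
    · exact absurd (by rw [e']; simp) h₁

theorem exists_first_ka {w : List Letter} (h : ka ∈ w) : ∃ A B, w = A ++ ka :: B ∧ ka ∉ A :=
  List.eq_append_cons_of_mem h

/-- Every operation of the completed coproduct is decomposed according to the leftmost `κ`. -/
theorem hat_decomp {n m : ℕ} {p p' : ℤ} (hk : n + 1 = m + 0) (hr : p' + -1 = p)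
    (y : hatObj P n p) :
    y = (show hatObj P n p from (zeroPart n p y).1) +
      ∑ i : Fin m, hatCirc P i.1 hk hr (headK i.1 i.2 hk hr y) (hatKappa P) := by
  refine Subtype.ext (funext fun N => funext fun q => funext fun w => ?_)
  have hsum : (∑ i : Fin m, hatCirc P i.1 hk hr (headK i.1 i.2 hk hr y) (hatKappa P)).1 N q w =
      ∑ i : Fin m, (hatCirc P i.1 hk hr (headK i.1 i.2 hk hr y) (hatKappa P)).1 N q w :=
    map_sum (hatEval P w) _ _
  change _ = (show hatObj P n p from (zeroPart n p y).1).1 N q w + _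
  rw [hsum, zeroPart_apply]
  by_cases h : ka ∈ w.w
  · obtain ⟨A, B, hw, hA⟩ := exists_first_ka h
    have hcA : A.count slot < m := by
      have h₁ := w.slots_eq
      rw [hw] at h₁
      simp at h₁
      omega
    let t : KSplit w.w := ⟨A, B, hw.symm⟩
    -- Only the leftmost `κ` of `w` contributes: the operations `headK` have no coefficient with a
    -- further `κ` to the left of the slot being filled. The number of slots before it selects one
    -- `i`.
    have key : ∀ i : Fin m, (hatCirc P i.1 hk hr (headK i.1 i.2 hk hr y) (hatKappa P)).1 N q w =
        if A.count slot = i.1 then y.1 N q w else 0 := by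
      intro i
      rw [hatCirc_kappa_single P i.1 hk hr _ w t]
      · by_cases hi : A.count slot = i.1
        · rw [if_pos hi, if_pos (show t.A.count slot = i.1 from hi),
            headK_apply i.1 i.2 hk hr y _ w A B rfl hi hw, if_neg hA, sgn_smul_sgn_smul]
        · rw [if_neg hi, if_neg (show t.A.count slot ≠ i.1 from hi)]
      · rintro ⟨A', B', e⟩ ht hA'
        rcases ka_cases (e.trans hw) with ⟨rfl, rfl⟩ | ⟨C, rfl, -⟩ | ⟨C, rfl, -⟩
        · exact absurd rfl ht
        · exact leftFree_headK i.1 i.2 hk hr y _ _ _ _ B' rfl hA' (by simp)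
        · exact absurd (by simp) hA
    rw [if_pos h, zero_add, Finset.sum_congr rfl (fun i _ => key i),
      Fintype.sum_eq_single ⟨_, hcA⟩, if_pos rfl]
    intro i hi
    exact if_neg (fun e => hi (Fin.ext e.symm))
  · rw [if_neg h, Finset.sum_eq_zero, add_zero]
    intro i _
    exact hatCirc_kappa_eq_zero P _ hk hr _ w (fun t => absurd t.ka_mem h)

/-- The coefficients of the words with more than `B` letters `κ` vanish. -/
def KBound (B : ℕ) {n : ℕ} {p : ℤ} (y : hatObj P n p) : Prop :=
  ∀ (N : ℕ) (q : ℤ) (w : Word n p N q), (B : ℤ) < kap w.w → y.1 N q w = 0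

theorem exists_kBound {n : ℕ} {p : ℤ} (y : hatObj P n p) : ∃ B, KBound B y := by
  obtain ⟨B, hB⟩ := y.2
  exact ⟨B.toNat, fun N q w hw => hB N q w (by omega)⟩

theorem KBound.mono {B B' : ℕ} (hB : B ≤ B') {n : ℕ} {p : ℤ} {y : hatObj P n p}
    (hy : KBound B y) : KBound B' y := fun N q w hw => hy N q w (by omega)

theorem KBound.mem {n : ℕ} {p : ℤ} {y : hatObj P n p} (hy : KBound 0 y) :
    y ∈ (hatAlpha P).carrier n p := by
  intro N q w hw
  refine hy N q w ?_
  simpa [kap] using hw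

theorem KBound.headK {B n m : ℕ} {p p' : ℤ} (i : ℕ) (hi : i < m) (hk : n + 1 = m + 0)
    (hr : p' + -1 = p) {y : hatObj P n p} (hy : KBound (B + 1) y) :
    KBound B (headK i hi hk hr y) := by
  intro N q w hw
  rw [headK_apply i hi hk hr y w (w.fillKa i hi hk hr) _ _ (w.pre_post i hi).symm
    (w.count_pre i hi) rfl, hy, smul_zero, ite_self]
  have h := congrArg kap (w.pre_post i hi)
  simp only [Word.fillKa, kap_append, kap_ka, kap_slot] at *
  push_cast
  omega

theorem headK_of_mem {n m : ℕ} {p p' : ℤ} (i : ℕ) (hi : i < m) (hk : n + 1 = m + 0)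
    (hr : p' + -1 = p) {y : hatObj P n p} (hy : y ∈ (hatAlpha P).carrier n p) :
    headK i hi hk hr y = 0 := by
  refine Subtype.ext (funext fun N => funext fun q => funext fun w => ?_)
  rw [headK_apply i hi hk hr y w (w.fillKa i hi hk hr) _ _ (w.pre_post i hi).symm
    (w.count_pre i hi) rfl, show y.1 N q (w.fillKa i hi hk hr) = 0 from
    hy N q _ (by simp [Word.fillKa]), smul_zero, ite_self]
  rfl

/-- The completed coproduct is generated by `P ∨̂ [α]` and `κ`. -/
theorem hat_induction {motive : ∀ {n : ℕ} {p : ℤ}, hatObj P n p → Prop}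
    (mem : ∀ {n : ℕ} {p : ℤ} (y : hatObj P n p), y ∈ (hatAlpha P).carrier n p → motive y)
    (add : ∀ {n : ℕ} {p : ℤ} (y y' : hatObj P n p), motive y → motive y' → motive (y + y'))
    (circ : ∀ {n m : ℕ} {p p' : ℤ} (i : ℕ) (_ : i < m) (hk : n + 1 = m + 0) (hr : p' + -1 = p)
      (y : hatObj P m p'), LeftFree i y → motive y → motive (hatCirc P i hk hr y (hatKappa P)))
    {n : ℕ} {p : ℤ} (y : hatObj P n p) : motive y := by
  -- The induction is on a bound for the number of `κ`. It exists because the completion is a direct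
  -- sum, not a product, over the `κ`-weight.
  obtain ⟨B, hB⟩ := exists_kBound y
  induction B generalizing n p with
  | zero => exact mem y hB.mem
  | succ B ih =>
    have hs : ∀ s : Finset (Fin (n + 1)), motive (∑ i ∈ s,
        hatCirc (k := n) (r := p) P i.1 (Nat.add_zero _).symm (by omega)
          (headK (m := n + 1) (p' := p + 1) i.1 i.2 (Nat.add_zero _).symm (by omega) y)
          (hatKappa P)) := by
      intro s
      induction s using Finset.induction_on with
      | empty =>
        rw [Finset.sum_empty]
        exact mem 0 (zero_mem _)
      | insert i s his hs =>
        rw [Finset.sum_insert his]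
        exact add _ _ (circ i.1 i.2 _ _ _ (leftFree_headK _ _ _ _ _)
          (ih _ (KBound.headK _ _ _ _ hB))) hs
    rw [hat_decomp (m := n + 1) (p' := p + 1) rfl (by omega) y]
    exact add _ _ (mem _ (zeroPart n p y).2) (hs _)

end Head

/-! ### The completed coproduct is free on `κ` over its part without `κ` -/

section KappaLift

variable {P : GrOperad.{u}} {X : GrOperad.{u}} (g : GrOperad.Hom (hatAlpha P).toGrOperad X)
  (x : X.obj 0 (-1))

/-- Approximations of the extension of `g` to the completed coproduct. -/
noncomputable def kappaLiftAux : ℕ → ∀ (n : ℕ) (p : ℤ), hatObj P n p →+ X.obj n p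
  | 0, n, p => (g.map n p).comp (zeroPart n p)
  | B + 1, n, p => AddMonoidHom.mk' (fun y => g.map n p (zeroPart n p y) +
      ∑ i : Fin (n + 1), X.circ (k := n) (r := p) i.1 i.2 (Nat.add_zero _).symm (by omega)
        (kappaLiftAux B (n + 1) (p + 1) 
          (headK i.1 i.2 (Nat.add_zero _).symm (by omega) y)) x) (fun y y' => by
      simp only [map_add, AddMonoidHom.add_apply, Finset.sum_add_distrib]
      abel)

theorem kappaLiftAux_succ (B : ℕ) {n : ℕ} {p : ℤ} (y : hatObj P n p) :
    kappaLiftAux g x (B + 1) n p y = g.map n p (zeroPart n p y) +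
      ∑ i : Fin (n + 1), X.circ (k := n) (r := p) i.1 i.2 (Nat.add_zero _).symm (by omega)
        (kappaLiftAux g x B (n + 1) (p + 1) 
          (headK i.1 i.2 (Nat.add_zero _).symm (by omega) y)) x := rfl

/-- Each step of the recursion removes one `κ`; once `B` steps have exhausted them, `headK` vanishes
and a further step changes nothing. -/
theorem kappaLiftAux_stable (B : ℕ) {n : ℕ} {p : ℤ} {y : hatObj P n p} (hy : KBound B y) :
    kappaLiftAux g x (B + 1) n p y = kappaLiftAux g x B n p y := by
  induction B generalizing n p with
  | zero =>
    rw [kappaLiftAux_succ, Finset.sum_eq_zero, add_zero]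
    · rfl
    · intro i _
      rw [headK_of_mem _ _ _ _ hy.mem, map_zero, map_zero, AddMonoidHom.zero_apply]
  | succ B ih =>
    rw [kappaLiftAux_succ, kappaLiftAux_succ]
    refine congrArg _ (Finset.sum_congr rfl fun i _ => ?_)
    rw [ih (KBound.headK _ _ _ _ hy)]

theorem kappaLiftAux_le {B B' : ℕ} (h : B ≤ B') {n : ℕ} {p : ℤ} {y : hatObj P n p}
    (hy : KBound B y) : kappaLiftAux g x B' n p y = kappaLiftAux g x B n p y := by
  induction B', h using Nat.le_induction with
  | base => rfl
  | succ B' h ih => rw [kappaLiftAux_stable g x B' (hy.mono h), ih]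

/-- The extension of `g` to the completed coproduct, on operations. -/
noncomputable def kappaLiftFun {n : ℕ} {p : ℤ} (y : hatObj P n p) : X.obj n p :=
  kappaLiftAux g x (exists_kBound y).choose n p y

theorem kappaLiftFun_eq {B : ℕ} {n : ℕ} {p : ℤ} {y : hatObj P n p} (hy : KBound B y) :
    kappaLiftFun g x y = kappaLiftAux g x B n p y := by
  rw [← kappaLiftAux_le g x (le_max_left B (exists_kBound y).choose) hy]
  exact (kappaLiftAux_le g x (le_max_right B _) (exists_kBound y).choose_spec).symm

/-- The extension of `g` to the completed coproduct, as a homomorphism. -/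
noncomputable def kappaLiftHom (n : ℕ) (p : ℤ) : hatObj P n p →+ X.obj n p :=
  AddMonoidHom.mk' (fun y => kappaLiftFun g x y) (fun y y' => by
    obtain ⟨B, hB⟩ := exists_kBound y
    obtain ⟨B', hB'⟩ := exists_kBound y'
    have h₁ := hB.mono (le_max_left B B')
    have h₂ := hB'.mono (le_max_right B B')
    have h₃ : KBound (max B B') (y + y') := fun N q w hw => by
      change y.1 N q w + y'.1 N q w = 0
      rw [h₁ N q w hw, h₂ N q w hw, add_zero]
    rw [kappaLiftFun_eq g x h₁, kappaLiftFun_eq g x h₂, kappaLiftFun_eq g x h₃, map_add])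

theorem kappaLiftHom_eq {n : ℕ} {p : ℤ} (y : hatObj P n p) :
    kappaLiftHom g x n p y = g.map n p (zeroPart n p y) +
      ∑ i : Fin (n + 1), X.circ (k := n) (r := p) i.1 i.2 (Nat.add_zero _).symm (by omega)
        (kappaLiftHom g x (n + 1) (p + 1) 
          (headK i.1 i.2 (Nat.add_zero _).symm (by omega) y)) x := by
  obtain ⟨B, hB⟩ := exists_kBound y
  refine (kappaLiftFun_eq g x (hB.mono (Nat.le_succ B))).trans ?_
  rw [kappaLiftAux_succ]
  refine congrArg _ (Finset.sum_congr rfl fun i _ => ?_)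
  rw [← kappaLiftFun_eq g x (KBound.headK _ _ _ _ (hB.mono (Nat.le_succ B)))]
  rfl

theorem kappaLiftHom_of_mem {n : ℕ} {p : ℤ} {y : hatObj P n p}
    (hy : y ∈ (hatAlpha P).carrier n p) : kappaLiftHom g x n p y = g.map n p ⟨y, hy⟩ := by
  rw [kappaLiftHom_eq, zeroPart_of_mem y hy, Finset.sum_eq_zero, add_zero]
  intro i _
  rw [headK_of_mem _ _ _ _ hy, map_zero, map_zero, AddMonoidHom.zero_apply]

/-- By `headK_circ_kappa` the decomposition of such an insertion has a single term. -/
theorem kappaLiftHom_leftFree {m k : ℕ} {p r : ℤ} (i : ℕ) (hi : i < m)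
    (hk : k + 1 = m + 0) (hr : p + -1 = r) {y : hatObj P m p} (hy : LeftFree i y) :
    kappaLiftHom g x k r (hatCirc P i hk hr y (hatKappa P)) =
      X.circ i hi hk hr (kappaLiftHom g x m p y) x := by
  obtain rfl : m = k + 1 := by omega
  obtain rfl : p = r + 1 := by omega
  rw [kappaLiftHom_eq, zeroPart_circ_kappa, map_zero, zero_add, Fintype.sum_eq_single ⟨i, hi⟩]
  · rw [headK_circ_kappa _ _ _ _ _ _ _ hy, if_pos rfl]
    rfl
  · intro j hj
    have e : headK j.1 j.2 (Nat.add_zero _).symm (by omega)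
        (hatCirc P i hk hr y (hatKappa P)) = (0 : hatObj P (k + 1) (r + 1)) :=
      (headK_circ_kappa _ _ _ _ _ _ _ hy).trans (if_neg (fun e => hj (Fin.ext e.symm)))
    rw [e, map_zero, map_zero, AddMonoidHom.zero_apply]

theorem hatCirc_kappa_le (P : GrOperad.{u}) {m n l a t : ℕ} {p q p' r s : ℤ} (i k : ℕ)
    (hki : k ≤ i) (hk : k < m) (hl : l + 1 = m + 0) (hp' : p + -1 = p') (hi : i < l)
    (ht : t + 1 = l + n) (hs : p' + q = s) (ha : a + 1 = m + n) (hr : p + q = r)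
    (ht' : t + 1 = a + 0) (hs' : r + -1 = s) (c : hatObj P m p) (y : hatObj P n q) :
    hatCirc P i ht hs (hatCirc P k hl hp' c (hatKappa P)) y =
      sgn q • hatCirc P k ht' hs' (hatCirc P (i + 1) ha hr c y) (hatKappa P) :=
  P.hat.circ_kappa_le (hatKappa P) i k hki hk hl hp' hi ht hs (by omega) ha hr (by omega) ht' hs' c y

theorem hatCirc_kappa_gt (P : GrOperad.{u}) {m n l a t : ℕ} {p q p' r s : ℤ} (i k k' : ℕ)
    (hik : i < k) (hkk : k' + 1 = k + n)
    (hk : k < m) (hl : l + 1 = m + 0) (hp' : p + -1 = p') (hi : i < l) (ht : t + 1 = l + n)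
    (hs : p' + q = s) (ha : a + 1 = m + n) (hr : p + q = r)
    (ht' : t + 1 = a + 0) (hs' : r + -1 = s) (c : hatObj P m p) (y : hatObj P n q) :
    hatCirc P i ht hs (hatCirc P k hl hp' c (hatKappa P)) y =
      sgn q • hatCirc P k' ht' hs' (hatCirc P i ha hr c y) (hatKappa P) :=
  P.hat.circ_kappa_gt (hatKappa P) i k k' hik hkk hk hl hp' hi ht hs (by omega) ha hr (by omega)
    ht' hs' c y

/-- If `y` already has a `κ` inserted at `j ≤ i`, the two insertions are exchanged, so that the
outer one has no `κ` to its left and `kappaLiftHom_leftFree` applies. The same exchange, with the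
same sign, holds in `X` because `x` has degree `-1`. If `j > i` no exchange is needed. -/
theorem kappaLiftHom_circ_kappa {m k : ℕ} {p r : ℤ} (i : ℕ) (hi : i < m)
    (hk : k + 1 = m + 0) (hr : p + -1 = r) (y : hatObj P m p) :
    kappaLiftHom g x k r (hatCirc P i hk hr y (hatKappa P)) =
      X.circ i hi hk hr (kappaLiftHom g x m p y) x := by
  induction y using hat_induction generalizing k r i with
  | mem y hy => exact kappaLiftHom_leftFree g x i hi hk hr (leftFree_of_mem i hy)
  | add y y' h h' =>
    rw [map_add, AddMonoidHom.add_apply, map_add, h i hi, h' i hi, map_add, map_add,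
      AddMonoidHom.add_apply]
  | @circ n m p p' j hj hk' hr' y hy ih =>
    rcases le_or_gt j i with hji | hij
    · rw [hatCirc_kappa_le P i j hji hj hk' hr' hi hk hr (a := k + 1) (r := r + 1) (by omega)
        (by omega) (by omega) (by omega), map_zsmul,
        kappaLiftHom_leftFree g x j (by omega) _ _ (leftFree_circ j (i + 1) (by omega) _ _ (.inl hy)),
        ih (i + 1) (by omega), kappaLiftHom_leftFree g x j hj hk' hr' hy,
        X.circ_kappa_le x i j hji hj hk' hr' hi hk hr (a := k + 1) (r := r + 1)
        (by omega) (by omega) (by omega) (by omega) (by omega) (by omega)]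
    · exact kappaLiftHom_leftFree g x i hi hk hr (leftFree_circ i j hij _ _ (.inr hy))

/-- Induction on `z`: a `κ` inserted into `z` is, by sequential associativity, a `κ` inserted into
the whole composite. -/
theorem kappaLiftHom_mem_circ {m n k : ℕ} {p q r : ℤ} (i : ℕ) (hi : i < m)
    (hk : k + 1 = m + n) (hr : p + q = r) {y : hatObj P m p} (hy : y ∈ (hatAlpha P).carrier m p)
    (z : hatObj P n q) :
    kappaLiftHom g x k r (hatCirc P i hk hr y z) =
      X.circ i hi hk hr (kappaLiftHom g x m p y) (kappaLiftHom g x n q z) := by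
  induction z using hat_induction generalizing k r with
  | mem z hz =>
    rw [kappaLiftHom_of_mem g x hy, kappaLiftHom_of_mem g x hz]
    exact (kappaLiftHom_of_mem g x ((hatAlpha P).circ_mem i hi hk hr y z hy hz)).trans
      (g.map_circ i hi hk hr ⟨y, hy⟩ ⟨z, hz⟩)
  | add z z' h h' => rw [map_add, map_add, h, h', map_add, map_add]
  | @circ n m' q q' j hj hk' hr' z hz ih =>
    rw [kappaLiftHom_circ_kappa g x j hj,
      ← hat_circ_seq P i j hj (a := k + 1) (pq := r + 1) (by omega) (by omega) (by omega) (by omega),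
      kappaLiftHom_circ_kappa g x (i + j) (by omega), ih]
    exact X.circ_seq i j hi hj _ _ _ _ _ _ _ _ _ _ _ _

/-- Induction on `y`: a `κ` inserted into `y` is moved out past `z`, in the completed coproduct and
in `X` by the same rule. -/
theorem kappaLiftHom_circ {m n k : ℕ} {p q r : ℤ} (i : ℕ) (hi : i < m)
    (hk : k + 1 = m + n) (hr : p + q = r) (y : hatObj P m p) (z : hatObj P n q) :
    kappaLiftHom g x k r (hatCirc P i hk hr y z) =
      X.circ i hi hk hr (kappaLiftHom g x m p y) (kappaLiftHom g x n q z) := by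
  induction y using hat_induction generalizing k r i with
  | mem y hy => exact kappaLiftHom_mem_circ g x i hi hk hr hy z
  | add y y' h h' =>
    rw [map_add, AddMonoidHom.add_apply, map_add, h i hi, h' i hi, map_add, map_add,
      AddMonoidHom.add_apply]
  | @circ l m p p' j hj hk' hr' y hy ih =>
    rw [kappaLiftHom_circ_kappa g x j hj]
    rcases le_or_gt j i with hji | hij
    · rw [hatCirc_kappa_le P i j hji hj hk' hr' hi hk hr (a := k + 1) (r := r + 1) (by omega)
        (by omega) (by omega) (by omega), map_zsmul,
        kappaLiftHom_circ_kappa g x j (by omega), ih (i + 1) (by omega),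
        X.circ_kappa_le x i j hji hj hk' hr' hi hk hr (a := k + 1) (r := r + 1)
        (by omega) (by omega) (by omega) (by omega) (by omega) (by omega)]
    · rw [hatCirc_kappa_gt P i j (j + n - 1) hij (by omega) hj hk' hr' hi hk hr (a := k + 1)
        (r := r + 1) (by omega) (by omega) (by omega) (by omega), map_zsmul,
        kappaLiftHom_circ_kappa g x _ (by omega), ih i (by omega),
        X.circ_kappa_gt x i j (j + n - 1) hij (by omega) hj hk' hr' hi hk hr (a := k + 1)
        (r := r + 1) (by omega) (by omega) (by omega) (by omega) (by omega) (by omega)]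

/-- The extension of a morphism from `P ∨̂ [α]` to the completed coproduct. -/
noncomputable def kappaLift : GrOperad.Hom P.hat X where
  map n p := kappaLiftHom g x n p
  map_one := (kappaLiftHom_of_mem g x (hatAlpha P).one_mem).trans g.map_one
  map_circ i hi hk hr y z := kappaLiftHom_circ g x i hi hk hr y z

theorem kappaLift_kappa : (kappaLift g x).map 0 (-1) (hatKappa P) = x := by
  -- `κ` is rewritten as `1 ∘ κ`.
  have e := kappaLiftHom_circ_kappa g x (k := 0) (r := -1) 0 zero_lt_one (by omega)
    (by omega) (hatOne P)
  rw [show kappaLiftHom g x 1 0 (hatOne P) = X.one from (kappaLift g x).map_one, X.one_circ] at e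
  exact (congrArg (kappaLiftHom g x 0 (-1))
    (P.hat.one_circ (n := 0) (p := -1) (by omega) (by omega) (by omega) (hatKappa P))).symm.trans e

/-- The completed coproduct is the coproduct of `P ∨̂ [α]` and `[κ]`. -/
theorem hat_coproduct :
    ∃! φ : GrOperad.Hom P.hat X,
      (∀ (n : ℕ) (p : ℤ) (y : (hatAlpha P).carrier n p), φ.map n p y.1 = g.map n p y) ∧
        φ.map 0 (-1) (hatKappa P) = x := by
  refine ⟨kappaLift g x, ⟨fun n p y => kappaLiftHom_of_mem g x y.2, kappaLift_kappa g x⟩, ?_⟩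
  rintro ψ ⟨h₁, h₂⟩
  refine GrOperad.Hom.ext (funext fun n => funext fun p => AddMonoidHom.ext fun y => ?_)
  induction y using hat_induction with
  | mem y hy => exact (h₁ _ _ ⟨y, hy⟩).trans (kappaLiftHom_of_mem g x hy).symm
  | add y y' h h' =>
    refine (map_add _ _ _).trans ?_
    rw [h, h']
    exact (map_add _ _ _).symm
  | @circ n m p p' i hi hk hr y _ h =>
    refine (ψ.map_circ i hi hk hr y (hatKappa P)).trans ?_
    rw [h, h₂]
    exact (kappaLiftHom_circ_kappa g x i hi hk hr y).symm

end KappaLift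

/-! ### The differential of the completed coproduct as an insertion of `κ` -/

section Inner

variable (P : DGOperad.{u})

/-- The differential of `P`, applied to all coefficients. -/
noncomputable def hatDInner {n : ℕ} {p p' : ℤ} (hp : p' + 1 = p) (y : hatObj P.toGrOperad n p) :
    hatObj P.toGrOperad n p' :=
  ⟨fun _ _ w => P.d rfl (y.1 _ _ (w.up hp)), by
    obtain ⟨B, hB⟩ := y.2
    exact ⟨B, fun N q w h =>
      (congrArg (P.d rfl) (hB _ _ (w.up hp) h)).trans (map_zero _)⟩⟩

theorem hatDInner_apply {n : ℕ} {p p' : ℤ} (hp : p' + 1 = p) (y : hatObj P.toGrOperad n p)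
    {N : ℕ} {q : ℤ} (w : Word n p' N q) :
    (hatDInner P hp y).1 N q w = P.d rfl (y.1 _ _ (w.up hp)) := rfl

theorem hatDInner_mem {n : ℕ} {p p' : ℤ} (hp : p' + 1 = p) {y : hatObj P.toGrOperad n p}
    (hy : y ∈ (hatAlpha P.toGrOperad).carrier n p) :
    hatDInner P hp y ∈ (hatAlpha P.toGrOperad).carrier n p' := by
  intro N q w hw
  rw [hatDInner_apply, show y.1 _ _ (w.up hp) = 0 from hy _ _ (w.up hp) hw, map_zero]

/-- The differential of the completed coproduct in terms of insertions of `κ`. -/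
theorem hatD_eq {n n' : ℕ} {p p' : ℤ} (hp : p' + 1 = p) (hn : n' = n + 1) (hk : n + 1 = n' + 0)
    (hr : p + -1 = p') (y : hatObj P.toGrOperad n p) :
    hatD P hp y = hatDInner P hp y + sgn p • ∑ i : Fin n',
      hatCirc P.toGrOperad i.1 hk hr (headA i.1 i.2 hn y) (hatKappa P.toGrOperad) := by
  refine Subtype.ext (funext fun N => funext fun q => funext fun w => ?_)
  have hsum : (sgn p • ∑ i : Fin n', hatCirc P.toGrOperad i.1 hk hr (headA i.1 i.2 hn y)
      (hatKappa P.toGrOperad)).1 N q w = sgn p • ∑ i : Fin n', (hatCirc P.toGrOperad i.1 hk hr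
        (headA i.1 i.2 hn y) (hatKappa P.toGrOperad)).1 N q w :=
    (map_zsmul (hatEval P.toGrOperad w) _ _).trans
      (congrArg _ (map_sum (hatEval P.toGrOperad w) _ _))
  change _ = (hatDInner P hp y).1 N q w + _
  rw [hsum, hatD_apply, hatDInner_apply]
  refine congrArg _ ?_
  simp only [hatCirc_kappa]
  -- For each `κ` of the word, exactly one place `i` contributes, the number of slots before it.
  rw [Finset.sum_comm, Finset.smul_sum]
  refine Finset.sum_congr rfl (fun t _ => ?_)
  have hA : t.A.count slot < n' := by
    have h := congrArg (List.count slot) t.eq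
    rw [w.slots_eq] at h
    simp at h
    omega
  rw [Fintype.sum_eq_single ⟨_, hA⟩]
  · rw [if_pos rfl, headA_apply _ _ _ _ _ (t.word hp) t.A t.B rfl rfl rfl, smul_smul, ← sgn_add]
    -- The Koszul sign of `d_T` counts the letters `κ` of `A` twice, which leaves `p` plus the
    -- number of `κ` in `B`.
    refine congrArg (· • _) (sgn_congr ⟨kap t.A, by ring⟩)
  · intro i hi
    exact if_neg (fun e => hi (Fin.ext e.symm))

end Inner

theorem headA_mem {P : GrOperad.{u}} {n m : ℕ} {p : ℤ} (i : ℕ) (hi : i < m) (hm : m = n + 1)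
    {y : hatObj P n p} (hy : y ∈ (hatAlpha P).carrier n p) :
    headA i hi hm y ∈ (hatAlpha P).carrier m p := by
  intro N q w hw
  refine hy N q (w.fillAl i hi hm) ?_
  rw [← w.pre_post i hi] at hw
  simpa [Word.fillAl] using hw

/-! ### The operations `∑ μ_N(w)` -/

section HatMu

variable (P : GrOperad.{u}) (μ : ∀ k, P.obj k (-1))

theorem Word.degree_of_notMem {n : ℕ} {p : ℤ} {N : ℕ} {q : ℤ} {w : Word n p N q}
    (h : ka ∉ w.w) : p = q := by
  have h' := w.degree_eq
  rw [kap_eq_zero h] at h'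
  omega

/-- The operation `∑ μ_N(w)` of the completed coproduct, where `w` runs over all words of length `N`
in `α` and `n` slots. -/
noncomputable def hatMu (n : ℕ) : hatObj P n (-1) :=
  ⟨fun N _ w => if h : ka ∈ w.w then 0 else P.cast rfl (Word.degree_of_notMem h) (μ N), 0,
    fun N q w h => dif_pos (by simpa [kap] using h)⟩

theorem hatMu_mem (n : ℕ) : hatMu P μ n ∈ (hatAlpha P).carrier n (-1) :=
  fun _ _ _ h => dif_pos h

theorem hatMu_apply {n : ℕ} {N : ℕ} (w : Word n (-1) N (-1)) (h : ka ∉ w.w) :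
    (hatMu P μ n).1 N (-1) w = μ N := dif_neg h

/-- The coefficient of a word without `κ` depends on its length only, so it does not see whether a
letter is `α` or a slot. -/
theorem headA_hatMu {n m : ℕ} (i : ℕ) (hi : i < m) (hm : m = n + 1) :
    headA i hi hm (hatMu P μ n) = hatMu P μ m := by
  refine Subtype.ext (funext fun N => funext fun q => funext fun w => ?_)
  by_cases h : ka ∈ w.w
  · exact (headA_mem i hi hm (hatMu_mem P μ n) N q w h).trans (hatMu_mem P μ m N q w h).symm
  · obtain rfl := Word.degree_of_notMem h
    rw [hatMu_apply P μ w h]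
    refine hatMu_apply P μ (w.fillAl i hi hm) ?_
    rw [← w.pre_post i hi] at h
    simpa [Word.fillAl] using h

theorem Word.eq_replicate_al {p : ℤ} {N : ℕ} {q : ℤ} (w : Word 0 p N q) (h : ka ∉ w.w) :
    w.w = List.replicate N al := by
  refine List.eq_replicate_iff.2 ⟨w.length_eq, fun c hc => ?_⟩
  rcases c with _ | _ | _
  · exact absurd hc (List.count_eq_zero.1 w.slots_eq)
  · rfl
  · exact absurd hc h

theorem hatMC_eq : hatMC P μ = hatMu P μ 0 := by
  refine Subtype.ext (funext fun N => funext fun q => funext fun w => ?_)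
  by_cases h : ka ∈ w.w
  · refine Eq.trans (dif_neg (fun e => ?_)) (hatMu_mem P μ 0 N q w h).symm
    rw [e] at h
    exact absurd (List.eq_of_mem_replicate h) (by decide)
  · obtain rfl := Word.degree_of_notMem h
    rw [hatMu_apply P μ w h]
    exact dif_pos (w.eq_replicate_al h)

end HatMu

/-! ### The translated element `κ + ∑ μ_k(α, …, α)`, and the quadruple `R(P)` -/

section Twisted

variable (P : DGOperad.{u}) (μ : ∀ k, P.obj k (-1))

/-- The only coefficient is a unit, which the differential of `P` kills, and there is no `α` to be
replaced. -/
theorem hatD_kappa : hatD P (p' := -2) (by omega) (hatKappa P.toGrOperad) = 0 := by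
  rw [hatD_eq P _ rfl rfl (by omega), Finset.sum_eq_zero, smul_zero, add_zero]
  · refine Subtype.ext (funext fun N => funext fun q => funext fun w => ?_)
    rw [hatDInner_apply]
    by_cases h : w.w = [ka]
    · obtain ⟨rfl, hq⟩ := Word.kappa_index (w := w.up (by omega)) h
      obtain rfl : q = -1 := by omega
      rw [hatKappa_ka _ _ h]
      exact P.d_one _
    · rw [hatKappa_ne _ _ h, map_zero]
      rfl
  · intro i _
    have e : headA (P := P.toGrOperad) i.1 i.2 rfl (hatKappa P.toGrOperad) = 0 := by
      refine Subtype.ext (funext fun N => funext fun q => funext fun w => ?_)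
      refine hatKappa_ne _ _ (fun h => ?_)
      have : al ∈ [ka] := h ▸ (by simp [Word.fillAl])
      simp at this
    rw [e, map_zero, AddMonoidHom.zero_apply]

/-- The decompositions of a word `α⋯α` into three parts. -/
def tripleSplit {N : ℕ} {w : List Letter} (hw : w = List.replicate N al) (t : Triple N) :
    Split w 0 0 :=
  ⟨List.replicate t.p al, List.replicate t.q al, List.replicate t.r al, by
    rw [hw, List.replicate_append_replicate, List.replicate_append_replicate, t.sum_eq],
    by simp [List.count_replicate], by simp [List.count_replicate]⟩

theorem tripleSplit_bijective {N : ℕ} {w : List Letter} (hw : w = List.replicate N al) :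
    Function.Bijective (tripleSplit hw) := by
  refine ⟨fun t t' h => ?_, fun s => ?_⟩
  · have h₁ := congrArg (fun s => s.A.length) h
    have h₂ := congrArg (fun s => s.v.length) h
    have h₃ := congrArg (fun s => s.B.length) h
    simp only [tripleSplit, List.length_replicate] at h₁ h₂ h₃
    exact Triple.ext h₁ h₂ h₃
  · have hall : ∀ c ∈ s.A ++ s.v ++ s.B, c = al := by
      rw [s.eq, hw]
      exact fun c hc => List.eq_of_mem_replicate hc
    have hl := congrArg List.length (s.eq.trans hw)
    simp only [List.length_append, List.length_replicate] at hl
    refine ⟨⟨s.A.length, s.v.length, s.B.length, hl⟩, Split.ext ?_ ?_ ?_⟩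
    · exact (List.eq_replicate_of_mem fun c hc => hall c (by simp [hc])).symm
    · exact (List.eq_replicate_of_mem fun c hc => hall c (by simp [hc])).symm
    · exact (List.eq_replicate_of_mem fun c hc => hall c (by simp [hc])).symm

theorem hatMu_same {Q : GrOperad.{u}} (ν : ∀ k, Q.obj k (-1)) {n N : ℕ} {q : ℤ}
    (w : Word n (-1) N q) (h : ka ∉ w.w) {N' : ℕ} (hN : N' = N) :
    SameOp Q (ν N') ((hatMu Q ν n).1 N q w) := by
  subst hN
  obtain rfl := Word.degree_of_notMem h
  rw [hatMu_apply Q ν w h]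
  exact ⟨rfl, rfl, HEq.rfl⟩

/-- On the word `α⋯α` of length `N` this is the `N`-th curved A-infinity relation: splittings of the
word into three blocks are triples `(p, q, r)`, and without `κ` there are no Koszul signs. -/
theorem hatDInner_hatMu_zero
    (hμ : ∀ n, P.d (q := -2) (by omega) (μ n) = -tripleSum P.toGrOperad μ μ (s := -2) n rfl) :
    hatDInner P (p' := -2) (by omega) (hatMu P.toGrOperad μ 0) =
      -hatCirc P.toGrOperad (k := 0) 0 (by omega) (by omega) (hatMu P.toGrOperad μ 1)
        (hatMu P.toGrOperad μ 0) := by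
  refine Subtype.ext (funext fun N => funext fun q => funext fun w => ?_)
  by_cases h : ka ∈ w.w
  · exact (hatDInner_mem P _ (hatMu_mem _ μ 0) N q w h).trans
      (neg_mem ((hatAlpha P.toGrOperad).circ_mem 0 zero_lt_one (by omega) (by omega) _ _
        (hatMu_mem _ μ 1) (hatMu_mem _ μ 0)) N q w h).symm
  · obtain rfl := Word.degree_of_notMem h
    change _ = -(hatCirc P.toGrOperad (k := 0) 0 _ _ (hatMu P.toGrOperad μ 1)
        (hatMu P.toGrOperad μ 0)).1 N (-2) w
    have e : P.d rfl ((hatMu P.toGrOperad μ 0).1 _ _ (w.up (by omega))) = P.d (q := -2) (by omega) (μ N) :=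
      (SameOp.eq (P.d_same _ _ (hatMu_same μ (w.up (by omega)) h rfl))).symm
    rw [hatDInner_apply, e, hμ, hatCirc_apply, tripleSum]
    have hw := w.eq_replicate_al h
    refine congrArg _ ((Finset.sum_congr rfl fun t _ => ?_).trans
      ((tripleSplit_bijective hw).sum_comp _))
    have hk : ∀ k, kap (List.replicate k al) = 0 := fun k => by simp [kap, List.count_replicate]
    have hk' : ∀ k, ka ∉ List.replicate k al := fun k => ka_notMem_of_kap (hk k)
    simp only [tripleSplit, hk, mul_zero, add_zero, sgn_zero, one_smul]
    refine P.circ_same (by simp) _ _ _ _ _ _ (hatMu_same μ _ ?_ (by simp)) (hatMu_same μ _ ?_ (by simp))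
    · simp [Split.left, hk']
    · exact hk' _

/-- The operation `κ + ∑ μ_k(α, …, α)`. -/
noncomputable def hatTwist : P.hat.obj 0 (-1) :=
  hatKappa P.toGrOperad + hatMu P.toGrOperad μ 0

-- Write `m` for `hatMu` in arity zero and `M` for it in arity one. The part `d_P` of the
-- differential sends `m` to `-M ∘ m`, by the relations, and `d_T` sends it to `-M ∘ κ`, by turning
-- one `α` into `κ`; together they give `-M ∘ (κ + m)`. This is the reason for translating `κ` by
-- `m`.
variable {P μ} in
theorem hatD_hatTwist
    (hμ : ∀ n, P.d (q := -2) (by omega) (μ n) = -tripleSum P.toGrOperad μ μ (s := -2) n rfl) :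
    P.hat.d (q := -2) (by omega) (hatTwist P μ) =
      -P.hat.circ 0 (by omega) (by omega) (by omega) (hatMu P.toGrOperad μ 1) (hatTwist P μ) := by
  change hatD P _ (hatKappa P.toGrOperad + hatMu P.toGrOperad μ 0) =
    -hatCirc P.toGrOperad 0 _ _ (hatMu P.toGrOperad μ 1)
      (hatKappa P.toGrOperad + hatMu P.toGrOperad μ 0)
  rw [map_add, hatD_kappa, zero_add, hatD_eq P _ rfl rfl (by omega), hatDInner_hatMu_zero P μ hμ,
    Fin.sum_univ_one, headA_hatMu, sgn_neg_one, neg_one_smul, map_add, neg_add_rev]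
  rfl

/-- Substituting `κ = hatTwist - m` in `hatD_eq` produces extra terms containing `m`, which have no
`κ` and are absorbed into the weight zero part. -/
theorem hatD_twist {n n' : ℕ} {p p' : ℤ} (hp : p' + 1 = p) (hn : n' = n + 1)
    (hk : n + 1 = n' + 0) (hr : p + -1 = p') {y : P.hat.obj n p}
    (hy : y ∈ (hatAlpha P.toGrOperad).carrier n p) :
    ∃ z : P.hat.obj n p', z ∈ (hatAlpha P.toGrOperad).carrier n p' ∧ P.hat.d hp y = z + sgn p • ∑ i : Fin n',
      P.hat.circ i.1 i.2 hk hr (headA i.1 i.2 hn y) (hatTwist P μ) := by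
  refine ⟨hatDInner P hp y - sgn p • ∑ i : Fin n', hatCirc P.toGrOperad i.1 hk hr
    (headA i.1 i.2 hn y) (hatMu P.toGrOperad μ 0), ?_, ?_⟩
  · refine sub_mem (hatDInner_mem P hp hy) (zsmul_sgn_mem _ (sum_mem fun i _ => ?_))
    exact (hatAlpha P.toGrOperad).circ_mem i.1 i.2 hk hr _ _ (headA_mem i.1 i.2 hn hy)
      (hatMu_mem _ μ 0)
  · refine (hatD_eq P hp hn hk hr y).trans ?_
    change _ = hatDInner P hp y - sgn p • ∑ i : Fin n', hatCirc P.toGrOperad i.1 hk hr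
      (headA i.1 i.2 hn y) (hatMu P.toGrOperad μ 0) + sgn p • ∑ i : Fin n',
      hatCirc P.toGrOperad i.1 hk hr (headA i.1 i.2 hn y)
        (hatKappa P.toGrOperad + hatMu P.toGrOperad μ 0)
    simp only [map_add, Finset.sum_add_distrib, smul_add]
    abel

variable {P μ} in
theorem hat_isCurv
    (hμ : ∀ n, P.d (q := -2) (by omega) (μ n) = -tripleSum P.toGrOperad μ μ (s := -2) n rfl) :
    IsCurv P.hat (hatTwist P μ) (hatAlpha P.toGrOperad) := by
  have hdκ : HasWeight P.hat (hatTwist P μ) (hatAlpha P.toGrOperad) 1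
      (P.hat.d (q := -2) (by norm_num) (hatTwist P μ)) := by
    rw [hatD_hatTwist hμ]
    exact .neg _ (.of_weightOne (circ_kappa_mem_weightOne _ _ _ _ _ _ (hatMu_mem _ μ 1)))
  have hcop : ∀ (X : GrOperad.{u}) (g : GrOperad.Hom (hatAlpha P.toGrOperad).toGrOperad X)
      (x : X.obj 0 (-1)), ∃! φ : GrOperad.Hom P.hat.toGrOperad X,
      (∀ (n : ℕ) (p : ℤ) (y : (hatAlpha P.toGrOperad).carrier n p),
        φ.map n p y.1 = g.map n p y) ∧ φ.map 0 (-1) (hatTwist P μ) = x := by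
    intro X g x
    have hκ : ∀ φ : GrOperad.Hom P.hat.toGrOperad X, φ.map 0 (-1) (hatTwist P μ) =
        φ.map 0 (-1) (hatKappa P.toGrOperad) + φ.map 0 (-1) (hatMu P.toGrOperad μ 0) :=
      fun φ => map_add (φ.map 0 (-1)) _ _
    let m : (hatAlpha P.toGrOperad).carrier 0 (-1) := ⟨hatMu P.toGrOperad μ 0, hatMu_mem _ μ 0⟩
    -- Translation by an element of the sub-operad preserves freeness: sending `κ + m` to `x`
    -- amounts to sending `κ` to `x - g(m)`.
    obtain ⟨φ, ⟨h₁, h₂⟩, h₃⟩ := hat_coproduct g (x - g.map 0 (-1) m)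
    refine ⟨φ, ⟨h₁, ?_⟩, ?_⟩
    · exact (hκ φ).trans ((congrArg₂ (· + ·) h₂ (h₁ 0 (-1) m)).trans (sub_add_cancel _ _))
    · rintro ψ ⟨h₄, h₅⟩
      refine h₃ ψ ⟨h₄, ?_⟩
      rw [← h₅, hκ ψ]
      exact (add_sub_cancel_right _ _).symm.trans
        (congrArg (ψ.map 0 (-1) (hatKappa P.toGrOperad) + ψ.map 0 (-1) m.1 - ·) (h₄ 0 (-1) m))
  refine ⟨kappa_notMem_of_coproduct fun X g x => (hcop X g x).exists, hcop,
    strict_mixed_of ?_ hdκ, hdκ⟩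
  intro n p q h x hx
  obtain ⟨z, hz, e⟩ := hatD_twist P μ h rfl rfl (by omega) hx
  refine ⟨z, _, hz, zsmul_sgn_mem _ (sum_mem fun i _ => ?_), e⟩
  exact circ_kappa_mem_weightOne _ _ _ _ _ _ (headA_mem i.1 i.2 rfl hx)

variable {P μ}

/-- `hatD_twist` is an expansion of `d y` of the shape required by `der_unique`. -/
theorem hat_der (h : IsCurv P.hat (hatTwist P μ) (hatAlpha P.toGrOperad)) (a : ℕ) {n n' : ℕ}
    {p : ℤ} (ha : a < n') (hn : n' = n + 1) {y : P.hat.obj n p}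
    (hy : y ∈ (hatAlpha P.toGrOperad).carrier n p) :
    h.der a ha hn y = headA (P := P.toGrOperad) a ha hn y := by
  obtain ⟨z, hz, e⟩ := hatD_twist P μ (p' := p - 1) (by omega) hn (by omega) (by omega) hy
  exact h.der_unique a ha hn (by omega) (by omega) (by omega) hz
    (fun i => headA (P := P.toGrOperad) i.1 i.2 hn y) (fun i => headA_mem i.1 i.2 hn hy) e

theorem hat_mu
    (hμ : ∀ n, P.d (q := -2) (by omega) (μ n) = -tripleSum P.toGrOperad μ μ (s := -2) n rfl)
    (h : IsCurv P.hat (hatTwist P μ) (hatAlpha P.toGrOperad)) (n : ℕ) :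
    h.mu (n + 1) = hatMu P.toGrOperad μ (n + 1) := by
  induction n with
  | zero => exact h.mu_one_unique (hatMu_mem _ μ 1) (hatD_hatTwist hμ)
  | succ n ih =>
    rw [← h.der_mu n 0 (by omega), ih]
    exact (hat_der h 0 _ rfl (hatMu_mem _ μ (n + 1))).trans (headA_hatMu _ μ _ _ _)

/-- The counit takes the coefficient of the word of slots, which is `μ_n` in `hatMu`. In arity zero
this is the empty word: `κ` contributes nothing and `m` contributes the curvature `μ₀`. It makes the
counit a morphism under the curved A-infinity operad. -/
theorem hatCounit_mu
    (hμ : ∀ n, P.d (q := -2) (by omega) (μ n) = -tripleSum P.toGrOperad μ μ (s := -2) n rfl)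
    (h : IsCurv P.hat (hatTwist P μ) (hatAlpha P.toGrOperad)) (n : ℕ) :
    (hatCounit P).map n (-1) (h.mu n) = μ n := by
  have key : ∀ n, (hatMu P.toGrOperad μ n).1 n (-1) (slotWord n (-1)) = μ n := fun n =>
    hatMu_apply _ _ _ (ka_notMem_replicate_slot n)
  rcases n with _ | n
  · refine Eq.trans (congrArg₂ (· + ·) (hatKappa_ne P.toGrOperad (slotWord 0 (-1)) ?_) (key 0))
      (zero_add _)
    simp [slotWord]
  · rw [hat_mu hμ]
    exact key (n + 1)

end Twisted

/-! ### Operads under the curved A-infinity operad -/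

section UnderHat

theorem underMu_d (P : Under cAinf.{u}) (n : ℕ) : P.right.d (q := -2) (by omega) (underMu P n) =
    -tripleSum P.right.toGrOperad (underMu P) (underMu P) (s := -2) n rfl := by
  let f : cAinf ⟶ P.right := P.hom
  refine (f.map_d (q := -2) (by omega) (cAinf.mu n)).symm.trans ?_
  rw [cAinf_d_mu, map_neg]
  refine congrArg _ ((map_sum (f.map n (-2)) _ _).trans (Finset.sum_congr rfl fun t _ => ?_))
  exact f.map_circ _ _ _ _ _ _

theorem twistedKappa_eq (P : Under cAinf.{u}) :
    twistedKappa P = hatTwist P.right (underMu P) :=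
  congrArg (fun x : hatObj P.right.toGrOperad 0 (-1) => hatKappa P.right.toGrOperad + x) (hatMC_eq _ _)

theorem twisted_isCurv (P : Under cAinf.{u}) :
    IsCurv P.right.hat (twistedKappa P) (hatAlpha P.right.toGrOperad) := by
  rw [twistedKappa_eq]
  exact hat_isCurv (underMu_d P)

end UnderHat

/-! ### An operation without `κ` is determined by its iterated derivatives -/

section Coinduction

variable {P : GrOperad.{u}}

theorem exists_al {w : List Letter} (h : al ∈ w) : ∃ A B, w = A ++ al :: B :=
  List.append_of_mem h

theorem hat_apply_al {n : ℕ} {p : ℤ} (y : hatObj P n p) {N : ℕ} {q : ℤ} (w : Word n p N q)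
    {A B : List Letter} (hw : w.w = A ++ al :: B) (hA : A.count slot < n + 1)
    (w' : Word (n + 1) p N q) (hw' : w'.w = A ++ slot :: B) :
    y.1 N q w = (headA (A.count slot) hA rfl y).1 N q w' :=
  (headA_apply _ hA rfl y w' w A B hw' rfl hw).symm

theorem exists_slotted_al {n : ℕ} {p : ℤ} {N : ℕ} {q : ℤ} (w : Word n p N q)
    {A B : List Letter} (hw : w.w = A ++ al :: B) :
    A.count slot < n + 1 ∧ ∃ w' : Word (n + 1) p N q, w'.w = A ++ slot :: B := by
  have h₁ := w.slots_eq
  have h₂ := w.length_eq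
  have h₃ := w.degree_eq
  rw [hw] at h₁ h₂ h₃
  refine ⟨?_, ⟨A ++ slot :: B, ?_, ?_, ?_⟩, rfl⟩
  · simp at h₁
    omega
  · simp at h₁ ⊢
    omega
  · simpa using h₂
  · simpa using h₃

theorem hat_apply_slots {n : ℕ} {p : ℤ} (y : hatObj P n p) (h : y.1 n p (slotWord n p) = 0)
    {N : ℕ} {q : ℤ} (w : Word n p N q) (hk : ka ∉ w.w) (ha : al ∉ w.w) : y.1 N q w = 0 := by
  have hw : w.w = List.replicate n slot := eq_replicate_slot w.slots_eq (fun c hc => by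
    rcases c with _ | _ | _
    · rfl
    · exact absurd hc ha
    · exact absurd hc hk)
  obtain ⟨rfl, rfl⟩ := Word.slots_index hw
  obtain rfl : w = slotWord n p := Word.ext hw
  exact h

/-- A family of sets of operations of `P ∨̂ [α]` which is stable, up to sums, under replacing one `α`
by a slot, vanishes if the coefficients of the words without `α` vanish. -/
theorem hat_coinduction (s : ∀ n p, Set (P.hat.obj n p))
    (hs : ∀ n p y, y ∈ s n p → y ∈ (hatAlpha P).carrier n p)
    (h0 : ∀ n p y, y ∈ s n p → hatEval P (slotWord n p) y = 0)
    (hd : ∀ n p y, y ∈ s n p → ∀ (a : ℕ) (ha : a < n + 1),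
      (headA (P := P) a ha rfl y : P.hat.obj (n + 1) p) ∈ AddSubgroup.closure (s (n + 1) p))
    {n : ℕ} {p : ℤ} {y : P.hat.obj n p} (hy : y ∈ s n p) : y = 0 := by
  -- The induction is on the number of `α` in the word. It has to run over the generated subgroups,
  -- since replacing an `α` by a slot gives only a sum of members of the family.
  have key : ∀ (k n : ℕ) (p : ℤ) (y : P.hat.obj n p), y ∈ AddSubgroup.closure (s n p) →
      ∀ (N : ℕ) (q : ℤ) (w : Word n p N q), w.w.count al = k → hatEval P w y = 0 := by
    intro k
    induction k with
    | zero =>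
      intro n p y hy N q w hw
      induction hy using AddSubgroup.closure_induction with
      | mem y hy =>
        by_cases hk : ka ∈ w.w
        · exact hs n p y hy N q w hk
        · exact hat_apply_slots y (h0 n p y hy) w hk (List.count_eq_zero.1 hw)
      | zero => exact map_zero _
      | add x y _ _ hx hy => rw [map_add, hx, hy, add_zero]
      | neg x _ hx => rw [map_neg, hx, neg_zero]
    | succ k ih =>
      intro n p y hy N q w hw
      induction hy using AddSubgroup.closure_induction with
      | mem y hy =>
        obtain ⟨A, B, e⟩ := exists_al (w := w.w) (List.count_pos_iff.1 (by omega))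
        obtain ⟨hA, w', hw'⟩ := exists_slotted_al w e
        refine (hat_apply_al y w e hA w' hw').trans (ih _ _ _ (hd n p y hy _ hA) _ _ w' ?_)
        rw [e] at hw
        rw [hw']
        simp at hw ⊢
        omega
      | zero => exact map_zero _
      | add x y _ _ hx hy => rw [map_add, hx, hy, add_zero]
      | neg x _ hx => rw [map_neg, hx, neg_zero]
  exact Subtype.ext (funext fun N => funext fun q => funext fun w =>
    key _ n p y (AddSubgroup.subset_closure hy) N q w rfl)

end Coinduction

/-! ### Iterated derivatives along a word -/

namespace IsCurv

variable {Q : DGOperad.{u}} {κ : Q.obj 0 (-1)} {Q₀ : SubOperad Q.toGrOperad} (h : IsCurv Q κ Q₀)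

/-- The iterated operations `D`, one for each letter `α` of a word. -/
noncomputable def taylor : ∀ (w : List Letter) (a n : ℕ) (p : ℤ) (N : ℕ) (q : ℤ)
    (_ : a + w.count slot = n) (_ : N = a + w.length) (_ : p + kap w = q),
    Q.obj n p →+ Q.obj N q
  -- `a` counts the letters already read; each of them is now an input, so the next `α` creates its
  -- input at place `a`.
  | [], _, _, _, _, _, hn, hN, hq => Q.cast (by simp at hn hN; omega) (by simpa using hq)
  | slot :: w, a, n, p, N, q, hn, hN, hq => taylor w (a + 1) n p N q
      (by simp at hn; omega) (by simp at hN; omega) (by simpa using hq)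
  | al :: w, a, n, p, N, q, hn, hN, hq => (taylor w (a + 1) (n + 1) p N q
      (by simp at hn; omega) (by simp at hN; omega) (by simpa using hq)).comp
      (h.der a (by omega) rfl)
  | ka :: _, _, _, _, _, _, _, _, _ => 0

theorem taylor_ka {w : List Letter} (hw : ka ∈ w) {a n : ℕ} {p : ℤ} {N : ℕ} {q : ℤ}
    (hn : a + w.count slot = n) (hN : N = a + w.length) (hq : p + kap w = q) (x : Q.obj n p) :
    h.taylor w a n p N q hn hN hq x = 0 := by
  induction w generalizing a n with
  | nil => simp at hw
  | cons c w ih =>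
    rcases c with _ | _ | _
    · exact ih (by simpa using hw) _ _ _ _
    · exact ih (by simpa using hw) _ _ _ _
    · rfl

theorem taylor_slots (k : ℕ) {a n : ℕ} {p : ℤ}
    (hn : a + (List.replicate k slot).count slot = n)
    (hN : n = a + (List.replicate k slot).length) (hq : p + kap (List.replicate k slot) = p)
    (x : Q.obj n p) : h.taylor (List.replicate k slot) a n p n p hn hN hq x = x := by
  induction k generalizing a with
  | zero => rfl
  | succ k ih => exact ih _ _ _

/-- The input belonging to a given `α` may be created first: `der_der` moves its derivative past
those of the letters `α` before it, each of which shifts its place by one. -/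
theorem taylor_al (A B : List Letter) {a n : ℕ} {p : ℤ} {N : ℕ} {q : ℤ}
    (hn : a + (A ++ al :: B).count slot = n) (hN : N = a + (A ++ al :: B).length)
    (hq : p + kap (A ++ al :: B) = q) (j : ℕ) (hj : j = a + A.count slot)
    (hj' : j < n + 1) (hn' : a + (A ++ slot :: B).count slot = n + 1)
    (hN' : N = a + (A ++ slot :: B).length) (hq' : p + kap (A ++ slot :: B) = q) {x : Q.obj n p}
    (hx : x ∈ Q₀.carrier n p) :
    h.taylor (A ++ al :: B) a n p N q hn hN hq x =
      h.taylor (A ++ slot :: B) a (n + 1) p N q hn' hN' hq' (h.der j hj' rfl x) := by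
  induction A generalizing a n j with
  | nil =>
    obtain rfl : j = a := by simpa using hj
    rfl
  | cons c A ih =>
    rcases c with _ | _ | _
    · exact ih _ _ _ j (by simp at hj; omega) hj' _ _ _ hx
    · have hj₂ : j = a + A.count slot := by simpa using hj
      refine (ih _ _ _ (j + 1) (by omega) (by omega) (by simp at hn' ⊢; omega) (by simp at hN' ⊢; omega)
        (by simpa using hq')
        (h.der_mem _ _ _ x)).trans ?_
      refine congrArg (h.taylor (A ++ slot :: B) (a + 1) (n + 1 + 1) p N q _ _ _) ?_
      subst hj₂
      exact h.der_der a (A.count slot) (by omega) rfl rfl hx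
    · rfl

/-- Each `D_a` raises the index of `μ_n` by one when `n ≥ 1`, so the result depends on the length of
the word only. -/
theorem taylor_mu {w : List Letter} (hw : ka ∉ w) {a n N : ℕ} (h1 : 1 ≤ n)
    (hn : a + w.count slot = n) (hN : N = a + w.length) (hq : (-1 : ℤ) + kap w = -1) :
    h.taylor w a n (-1) N (-1) hn hN hq (h.mu n) = h.mu N := by
  induction w generalizing a n with
  | nil =>
    obtain rfl : n = N := by simp at hn hN; omega
    rfl
  | cons c w ih =>
    rcases c with _ | _ | _
    · exact ih (by simpa using hw) h1 _ _ _
    · obtain ⟨m, rfl⟩ : ∃ m, n = m + 1 := ⟨n - 1, by omega⟩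
      refine (congrArg _ (h.der_mu m a (by simp at hn; omega))).trans ?_
      exact ih (by simpa using hw) (by omega) _ _ _
    · simp at hw

end IsCurv

/-! ### Taylor expansion along a morphism of dg operads -/

section Taylor

variable {Q : DGOperad.{u}} {κ : Q.obj 0 (-1)} {Q₀ : SubOperad Q.toGrOperad} (h : IsCurv Q κ Q₀)
  {P : DGOperad.{u}} (f : DGOperad.Hom Q P)

/-- The Taylor expansion of an operation, with coefficients in `P`. -/
noncomputable def hatTaylor (n : ℕ) (p : ℤ) : Q.obj n p →+ P.hat.obj n p :=
  AddMonoidHom.mk' (fun x => (⟨fun _ _ w => f.map _ _ (h.taylor w.w 0 n p _ _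
      (by simpa using w.slots_eq) (by simpa using w.length_eq.symm) w.degree_eq x), 0,
      fun N q _ hw => (congrArg (f.map N q) (h.taylor_ka (by simpa [kap] using hw) _ _ _ x)).trans
        (map_zero _)⟩ : hatObj P.toGrOperad n p)) (fun x y => by
    refine Subtype.ext (funext fun N => funext fun q => funext fun w => ?_)
    exact (congrArg (f.map N q) (map_add _ x y)).trans (map_add _ _ _))

theorem hatTaylor_mem {n : ℕ} {p : ℤ} (x : Q.obj n p) :
    hatTaylor h f n p x ∈ (hatAlpha P.toGrOperad).carrier n p := fun N q _ hw =>
  (congrArg (f.map N q) (h.taylor_ka hw _ _ _ x)).trans (map_zero _)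

theorem hatTaylor_slotWord {n : ℕ} {p : ℤ} (x : Q.obj n p) :
    hatEval P.toGrOperad (slotWord n p) (hatTaylor h f n p x) = f.map n p x :=
  congrArg (f.map n p) (h.taylor_slots n _ _ _ x)

/-- Comparing coefficients, this is `taylor_al`: differentiating the series is the same as expanding
the derivative. -/
theorem headA_hatTaylor {n : ℕ} {p : ℤ} (a : ℕ) (ha : a < n + 1) {x : Q.obj n p}
    (hx : x ∈ Q₀.carrier n p) :
    headA (P := P.toGrOperad) a ha rfl (hatTaylor h f n p x) =
      hatTaylor h f (n + 1) p (h.der a ha rfl x) := by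
  refine Subtype.ext (funext fun N => funext fun q => funext fun w => ?_)
  obtain ⟨w, h₁, h₂, h₃⟩ := w
  obtain ⟨A, B, rfl, hA⟩ := exists_slot (w := w) (i := a) (by omega)
  have w' : ∃ w' : Word n p N q, w'.w = A ++ al :: B := by
    refine ⟨⟨A ++ al :: B, ?_, ?_, ?_⟩, rfl⟩
    · simp at h₁ ⊢
      omega
    · simpa using h₂
    · simpa using h₃
  obtain ⟨w', hw'⟩ := w'
  refine (headA_apply a ha rfl _ _ w' A B rfl hA hw').trans ?_
  obtain ⟨w', h₁', h₂', h₃'⟩ := w'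
  dsimp only at hw'
  subst hw'
  exact congrArg (f.map N q) (h.taylor_al A B _ _ _ a (by omega) ha _ _ _ hx)

variable {μ : ∀ k, P.obj k (-1)} (h' : IsCurv P.hat (hatTwist P μ) (hatAlpha P.toGrOperad))

theorem der_hatTaylor {n : ℕ} {p : ℤ} (a : ℕ) (ha : a < n + 1) {x : Q.obj n p}
    (hx : x ∈ Q₀.carrier n p) :
    h'.der a ha rfl (hatTaylor h f n p x) = hatTaylor h f (n + 1) p (h.der a ha rfl x) :=
  (hat_der h' a ha rfl (hatTaylor_mem h f x)).trans (headA_hatTaylor h f a ha hx)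

end Taylor

/-! ### Existence and uniqueness of lifts to `R(P)` -/

section Lift

variable {Q : DGOperad.{u}} {κ : Q.obj 0 (-1)} {Q₀ : SubOperad Q.toGrOperad} (h : IsCurv Q κ Q₀)
  {P : DGOperad.{u}} (f : DGOperad.Hom Q P) {μ : ∀ k, P.obj k (-1)}

/-- The coinduction principle, in terms of the operations `D` of the completed coproduct. -/
theorem hat_coinduction_der (h' : IsCurv P.hat (hatTwist P μ) (hatAlpha P.toGrOperad))
    (s : ∀ n p, Set (P.hat.obj n p))
    (hs : ∀ n p y, y ∈ s n p → y ∈ (hatAlpha P.toGrOperad).carrier n p)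
    (h0 : ∀ n p y, y ∈ s n p → (hatCounit P).map n p y = 0)
    (hd : ∀ n p y, y ∈ s n p → ∀ (a : ℕ) (ha : a < n + 1),
      h'.der a ha rfl y ∈ AddSubgroup.closure (s (n + 1) p))
    {n : ℕ} {p : ℤ} {y : P.hat.obj n p} (hy : y ∈ s n p) : y = 0 := by
  refine hat_coinduction (P := P.toGrOperad) s hs h0 (fun n p y hy a ha => ?_) hy
  have e := hd n p y hy a ha
  rw [hat_der h' a ha rfl (hs n p y hy)] at e
  exact e

theorem hatTaylor_one (h' : IsCurv P.hat (hatTwist P μ) (hatAlpha P.toGrOperad)) :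
    hatTaylor h f 1 0 Q.one = P.hat.one := by
  rw [← sub_eq_zero]
  -- The family consists of the one difference in arity one and degree zero. The counit kills it,
  -- and so does every `D_a`, since units have derivative zero.
  refine hat_coinduction_der h' (fun n p => {z | ∃ (hn : 1 = n) (hp : 0 = p),
    z = P.hat.cast hn hp (hatTaylor h f 1 0 Q.one - P.hat.one)}) ?_ ?_ ?_ ⟨rfl, rfl, rfl⟩
  · rintro _ _ _ ⟨rfl, rfl, rfl⟩
    exact sub_mem (hatTaylor_mem h f _) (hatAlpha P.toGrOperad).one_mem
  · rintro _ _ _ ⟨rfl, rfl, rfl⟩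
    rw [GrOperad.cast_rfl, map_sub, (hatCounit P).map_one, sub_eq_zero]
    exact (hatTaylor_slotWord h f _).trans f.map_one
  · rintro _ _ _ ⟨rfl, rfl, rfl⟩ a ha
    rw [GrOperad.cast_rfl, map_sub, h'.der_one, der_hatTaylor h f h' a ha Q₀.one_mem, h.der_one,
      map_zero, sub_zero]
    exact zero_mem _

/-- Both sides have the same image under the counit and obey the same Leibniz rule, so a derivative
of their difference is a sum of differences of the same form, with `x` or `y` replaced by a
derivative. The coinduction therefore runs over all pairs from `Q₀` at once. -/
theorem hatTaylor_circ (h' : IsCurv P.hat (hatTwist P μ) (hatAlpha P.toGrOperad))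
    {m n l : ℕ} {p q r : ℤ} (k : ℕ) (hk : k < m)
    (hl : l + 1 = m + n) (hr : p + q = r) {x : Q.obj m p}
    {y : Q.obj n q} (hx : x ∈ Q₀.carrier m p) (hy : y ∈ Q₀.carrier n q) :
    hatTaylor h f l r (Q.circ k hk hl hr x y) =
      P.hat.circ k hk hl hr (hatTaylor h f m p x) (hatTaylor h f n q y) := by
  rw [← sub_eq_zero]
  refine hat_coinduction_der h' (fun l r => {z | ∃ (m n : ℕ) (p q : ℤ) (k : ℕ) (hk : k < m)
    (hl : l + 1 = m + n) (hr : p + q = r) (x : Q.obj m p) (y : Q.obj n q)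
    (_ : x ∈ Q₀.carrier m p) (_ : y ∈ Q₀.carrier n q),
    z = hatTaylor h f l r (Q.circ k hk hl hr x y) -
      P.hat.circ k hk hl hr (hatTaylor h f m p x) (hatTaylor h f n q y)}) ?_ ?_ ?_
    ⟨m, n, p, q, k, hk, hl, hr, x, y, hx, hy, rfl⟩
  · rintro _ _ _ ⟨m, n, p, q, k, hk, hl, hr, x, y, hx, hy, rfl⟩
    exact sub_mem (hatTaylor_mem h f _) ((hatAlpha P.toGrOperad).circ_mem k hk hl hr _ _
      (hatTaylor_mem h f x) (hatTaylor_mem h f y))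
  · rintro _ _ _ ⟨m, n, p, q, k, hk, hl, hr, x, y, hx, hy, rfl⟩
    rw [map_sub, (hatCounit P).map_circ, sub_eq_zero]
    refine (hatTaylor_slotWord h f _).trans ((f.map_circ _ _ _ _ _ _).trans ?_)
    exact congrArg₂ (fun u v => P.circ k hk hl hr u v) (hatTaylor_slotWord h f x).symm
      (hatTaylor_slotWord h f y).symm
  · rintro l r _ ⟨m, n, p, q, k, hk, hl, hr, x, y, hx, hy, rfl⟩ a ha
    rw [map_sub, der_hatTaylor h f h' a ha (Q₀.circ_mem _ _ _ _ _ _ hx hy),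
      h.der_circ a k hk hl hr ha rfl hx hy,
      h'.der_circ a k hk hl hr ha rfl (hatTaylor_mem h f x) (hatTaylor_mem h f y)]
    simp only [der_hatTaylor h f h' _ _ hx, der_hatTaylor h f h' _ _ hy, map_add, map_sum]
    rw [add_sub_add_comm, ← Finset.sum_sub_distrib, ← Finset.sum_sub_distrib]
    refine add_mem (sum_mem fun j _ => ?_) (sum_mem fun j _ => ?_)
    · split_ifs
      · exact AddSubgroup.subset_closure ⟨_, _, _, _, _, _, _, _, _, _, h.der_mem _ _ _ _, hy, rfl⟩
      · rw [map_zero, sub_zero]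
        exact zero_mem _
      · exact AddSubgroup.subset_closure ⟨_, _, _, _, _, _, _, _, _, _, h.der_mem _ _ _ _, hy, rfl⟩
      · rw [map_zero, sub_zero]
        exact zero_mem _
    · split_ifs
      · exact AddSubgroup.subset_closure ⟨_, _, _, _, _, _, _, _, _, _, hx, h.der_mem _ _ _ _, rfl⟩
      · rw [map_zero, sub_zero]
        exact zero_mem _

/-- All iterated derivatives of `μ₁` are operations `μ_N`, and `f` preserves these. -/
theorem hatTaylor_mu (hf : ∀ n, f.map n (-1) (h.mu n) = μ n) :
    hatTaylor h f 1 (-1) (h.mu 1) = hatMu P.toGrOperad μ 1 := by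
  refine Subtype.ext (funext fun N => funext fun q => funext fun w => ?_)
  by_cases hw : ka ∈ w.w
  · exact (hatTaylor_mem h f _ N q w hw).trans (hatMu_mem _ μ 1 N q w hw).symm
  · obtain rfl := Word.degree_of_notMem hw
    rw [hatMu_apply _ μ w hw, ← hf]
    exact congrArg (f.map N (-1)) (h.taylor_mu hw le_rfl _ _ _)

/-- The Taylor expansion as a morphism of operads. -/
noncomputable def hatTaylorHom (h' : IsCurv P.hat (hatTwist P μ) (hatAlpha P.toGrOperad)) :
    GrOperad.Hom Q₀.toGrOperad P.hat.toGrOperad where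
  map n p := (hatTaylor h f n p).comp (Q₀.carrier n p).subtype
  map_one := hatTaylor_one h f h'
  map_circ i hi hk hr x y := hatTaylor_circ h f h' i hi hk hr x.2 y.2

/-- The lift is the Taylor expansion on `Q₀` and sends `κ` to the translated `κ`. The substantial
point is that it commutes with the differentials: its defect on `Q₀` has no `κ`, is killed by the
counit and commutes with the `D_a`, so it vanishes by coinduction. -/
theorem exists_hatLift (hμ : ∀ n, P.d (q := -2) (by omega) (μ n) =
      -tripleSum P.toGrOperad μ μ (s := -2) n rfl)
    (hf : ∀ n, f.map n (-1) (h.mu n) = μ n) :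
    ∃ F : Q ⟶ P.hat, F.map 0 (-1) κ = hatTwist P μ ∧
      (∀ n p x, x ∈ Q₀.carrier n p → F.map n p x ∈ (hatAlpha P.toGrOperad).carrier n p) ∧
      F ≫ hatCounit P = f := by
  have h' := hat_isCurv hμ
  obtain ⟨F, ⟨hF, hκ⟩, -⟩ := h.coproduct _ (hatTaylorHom h f h') (hatTwist P μ)
  replace hF : ∀ n p x, x ∈ Q₀.carrier n p → F.map n p x = hatTaylor h f n p x :=
    fun n p x hx => hF n p ⟨x, hx⟩
  have hε : (hatCounit P).toHom.comp F = f.toHom := by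
    refine h.hom_ext (fun n p x hx => ?_) ?_
    · exact (congrArg _ (hF n p x hx)).trans (hatTaylor_slotWord h f x)
    · exact (congrArg _ hκ).trans ((hatCounit_mu hμ h' 0).trans (hf 0).symm)
  have hε' : ∀ {n p} (x : Q.obj n p), (hatCounit P).map n p (F.map n p x) = f.map n p x :=
    fun {n p} x => congrArg (fun g : GrOperad.Hom Q.toGrOperad P.toGrOperad => g.map n p x) hε
  have hdκ : P.hat.d (q := -2) (by omega) (F.map 0 (-1) κ) =
      F.map 0 (-2) (Q.d (q := -2) (by omega) κ) := by
    rw [hκ, hatD_hatTwist hμ, h.d_kappa_eq, map_neg, F.map_circ, hκ, hF _ _ _ (h.mu_succ_mem 0),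
      hatTaylor_mu h f hf]
  -- The defect of `F` as a chain map. By `hdκ` it vanishes at `κ`, hence by the Leibniz rule it
  -- commutes with insertions of `κ`, which is `hEκ`.
  let E : ∀ (n : ℕ) (p q : ℤ) (_ : q + 1 = p), Q.obj n p →+ P.hat.obj n q := fun n p q hq =>
    (P.hat.d hq).comp (F.map n p) - (F.map n q).comp (Q.d hq)
  have hE : ∀ n p q hq x, E n p q hq x = P.hat.d hq (F.map n p x) - F.map n q (Q.d hq x) :=
    fun _ _ _ _ _ => rfl
  have hEκ : ∀ {n n' : ℕ} {p q r s : ℤ} (i : ℕ) (hi : i < n') (hk : n + 1 = n' + 0)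
      (hr : r + -1 = p) (hq : q + 1 = p) (hs : s + 1 = r) (hsq : s + -1 = q) (c : Q.obj n' r),
      E n p q hq (Q.circ i hi hk hr c κ) =
        P.hat.circ i hi hk hsq (E n' r s hs c) (hatTwist P μ) := by
    intro n n' p q r s i hi hk hr hq hs hsq c
    rw [hE, hE, F.map_circ, P.hat.d_circ i hi hk hr (q' := -2) hs (by omega) hq hsq (by omega),
      Q.d_circ i hi hk hr (q' := -2) hs (by omega) hq hsq (by omega), map_add, map_zsmul,
      F.map_circ, F.map_circ, hdκ, hκ, map_sub, AddMonoidHom.sub_apply]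
    abel
  -- The weight one parts of `d (F x)` and of `F (d x)` cancel, because `F` intertwines the
  -- operators `D_a`.
  have hEmem : ∀ n p q hq x, x ∈ Q₀.carrier n p →
      E n p q hq x ∈ (hatAlpha P.toGrOperad).carrier n q := by
    intro n p q hq x hx
    obtain ⟨y, hy, ey⟩ := h.d_eq hq rfl rfl (by omega) hx
    obtain ⟨z, hz, ez⟩ := hatD_twist P μ hq rfl rfl (by omega) (hatTaylor_mem h f x)
    have e : E n p q hq x = z - hatTaylor h f n q y := by
      rw [hE, hF _ _ _ hx, ez, ey, map_add, hF _ _ _ hy, map_zsmul, map_sum]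
      simp only [F.map_circ, hκ]
      rw [Finset.sum_congr rfl fun i _ => congrArg (fun c => P.hat.circ i.1 i.2 _ _ c (hatTwist P μ))
        ((headA_hatTaylor h f i.1 i.2 hx).trans (hF _ _ _ (h.der_mem _ _ _ _)).symm)]
      abel
    rw [e]
    exact sub_mem hz (hatTaylor_mem h f y)
  have hE0 : ∀ n p q hq x, x ∈ Q₀.carrier n p → E n p q hq x = 0 := by
    intro n p q hq x hx
    refine hat_coinduction_der h' (fun n q => {z | ∃ (p : ℤ) (hq : q + 1 = p) (x : Q.obj n p)
      (_ : x ∈ Q₀.carrier n p), z = E n p q hq x}) ?_ ?_ ?_ ⟨p, hq, x, hx, rfl⟩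
    · rintro n q _ ⟨p, hq, x, hx, rfl⟩
      exact hEmem n p q hq x hx
    · rintro n q _ ⟨p, hq, x, hx, rfl⟩
      rw [hE, map_sub, (hatCounit P).map_d, hε', hε', f.map_d, sub_self]
    · rintro n q _ ⟨p, hq, x, hx, rfl⟩ a ha
      refine AddSubgroup.subset_closure ⟨p, hq, h.der a ha rfl x, h.der_mem _ _ _ _, ?_⟩
      obtain ⟨y, hy, ey⟩ := h.d_eq hq rfl rfl (by omega) hx
      refine h'.der_unique a ha rfl (q := q - 1) (by omega) (by omega) (by omega)
        (y := -E n q (q - 1) (by omega) y) (neg_mem (hEmem _ _ _ _ _ hy))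
        (fun i => E (n + 1) p q hq (h.der i.1 i.2 rfl x))
        (fun i => hEmem _ _ _ _ _ (h.der_mem _ _ _ _)) ?_
      -- As both differentials square to zero, `d E = -E d`. Expanding `d x` on the right gives an
      -- expansion of `d (E x)` with coefficients `E (D_i x)`, so that `D_a (E x) = E (D_a x)`.
      have e₁ : P.hat.d (q := q - 1) (by omega) (E n p q hq x) =
          -E n q (q - 1) (by omega) (Q.d hq x) := by
        rw [hE, hE, map_sub, P.hat.d_d, Q.d_d, map_zero, zero_sub, sub_zero]
      rw [e₁, ey, map_add, map_zsmul, map_sum, neg_add]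
      refine congrArg _ ?_
      subst hq
      -- `E x` has degree one less than `x`; the resulting change of sign absorbs the minus sign of
      -- `d E = -E d`.
      rw [sgn_succ, neg_smul, neg_neg]
      exact congrArg _ (Finset.sum_congr rfl fun i _ => hEκ i.1 i.2 _ _ _ _ _ _)
  have hd : ∀ {n : ℕ} {p q : ℤ} (hq : q + 1 = p) (x : Q.obj n p),
      F.map n q (Q.d hq x) = P.hat.d hq (F.map n p x) := by
    intro n p q hq x
    refine (DGOperad.mem_chainSub F hq x).1 (h.mem_of_sub _ (fun n p x hx => ?_) ?_ x)
    · exact (DGOperad.mem_chainSub F (q := p - 1) (by omega) x).2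
        (sub_eq_zero.1 (hE0 n p (p - 1) (by omega) x hx)).symm
    · exact (DGOperad.mem_chainSub F (q := -2) (by omega) κ).2 hdκ.symm
  refine ⟨⟨F, hd⟩, hκ, fun n p x hx => ?_, ?_⟩
  · exact (hF n p x hx).symm ▸ hatTaylor_mem h f x
  · exact DGOperad.Hom.ext (congrArg GrOperad.Hom.map hε)

theorem hatLift_unique (h : IsCurv Q κ Q₀)
    (h' : IsCurv P.hat (hatTwist P μ) (hatAlpha P.toGrOperad)) {F G : Q ⟶ P.hat}
    (hFκ : F.map 0 (-1) κ = hatTwist P μ) (hGκ : G.map 0 (-1) κ = hatTwist P μ)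
    (hF : ∀ n p x, x ∈ Q₀.carrier n p → F.map n p x ∈ (hatAlpha P.toGrOperad).carrier n p)
    (hG : ∀ n p x, x ∈ Q₀.carrier n p → G.map n p x ∈ (hatAlpha P.toGrOperad).carrier n p)
    (e : F ≫ hatCounit P = G ≫ hatCounit P) : F = G := by
  have e' : F.toHom = G.toHom := by
    refine h.hom_ext (fun n p x hx => ?_) (hFκ.trans hGκ.symm)
    rw [← sub_eq_zero]
    -- Both morphisms commute with the `D_a`, so the differences `F x - G x` with `x` in `Q₀` form a
    -- family stable under `D`, which the counit kills by hypothesis.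
    refine hat_coinduction_der h' (fun n p => {z | ∃ (x : Q.obj n p)
      (_ : x ∈ Q₀.carrier n p), z = F.map n p x - G.map n p x}) ?_ ?_ ?_ ⟨x, hx, rfl⟩
    · rintro n p _ ⟨x, hx, rfl⟩
      exact sub_mem (hF n p x hx) (hG n p x hx)
    · rintro n p _ ⟨x, hx, rfl⟩
      rw [map_sub, sub_eq_zero]
      exact congrArg (fun g : Q ⟶ P => g.map n p x) e
    · rintro n p _ ⟨x, hx, rfl⟩ a ha
      refine AddSubgroup.subset_closure ⟨h.der a ha rfl x, h.der_mem _ _ _ _, ?_⟩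
      rw [map_sub]
      exact congrArg₂ (· - ·)
        (h.map_der h' F.toHom hFκ hF a ha rfl (q := p - 1) (by omega) hx (F.map_d _ _)).symm
        (h.map_der h' G.toHom hGκ hG a ha rfl (q := p - 1) (by omega) hx (G.map_d _ _)).symm
  exact DGOperad.Hom.ext (congrArg GrOperad.Hom.map e')

end Lift

/-! ### The adjunction and its counit -/

section Adjunction

theorem hatCounit_mu_twisted (P : Under cAinf.{u})
    (h : IsCurv P.right.hat (twistedKappa P) (hatAlpha P.right.toGrOperad)) (n : ℕ) :
    (hatCounit P.right).map n (-1) (h.mu n) = underMu P n := by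
  -- The element is generalised together with the proof of `IsCurv` that depends on it, so that the
  -- equation can be substituted.
  have key : ∀ (κ' : P.right.hat.obj 0 (-1)) (_ : κ' = hatTwist P.right (underMu P))
      (h : IsCurv P.right.hat κ' (hatAlpha P.right.toGrOperad)),
      (hatCounit P.right).map n (-1) (h.mu n) = underMu P n := by
    rintro _ rfl h
    exact hatCounit_mu (underMu_d P) h n
  exact key _ (twistedKappa_eq P) h

variable {hA : IsCurv cAinf.{u} (cAinf.mu 0) cAinf.sub} (init : Limits.IsInitial (cAinfCurv hA))

/-- Whatever the proof of initiality, the morphism agrees with the constructed one, whose value on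
generators is `mu` by definition. -/
theorem initial_to_mu (X : Curv.{u}) (n : ℕ) :
    (Curv.Hom.hom (init.to X)).map n (-1) (cAinf.mu n) = X.isCurv.mu n := by
  rw [init.hom_ext (init.to X) ((cAinfInitial hA).to X)]
  rfl

theorem forgetful_hom_mu {X : Curv.{u}} {P : Under cAinf.{u}} (f : (forgetful init).obj X ⟶ P)
    (n : ℕ) : (show X.Q ⟶ P.right from f.right).map n (-1) (X.isCurv.mu n) = underMu P n := by
  rw [← initial_to_mu init X n]
  exact congrArg (fun g : cAinf ⟶ P.right => g.map n (-1) (cAinf.mu n)) (Under.w f)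

variable (hR : ∀ P : Under cAinf.{u},
  IsCurv P.right.hat (twistedKappa P) (hatAlpha P.right.toGrOperad))

/-- The counit of the adjunction. -/
noncomputable def twistingCounit (P : Under cAinf.{u}) :
    (forgetful init).obj ((twisting hR).obj P) ⟶ P :=
  Under.homMk (U := (forgetful init).obj ((twisting hR).obj P)) (hatCounit P.right)
    (cAinf_hom_ext fun n => (congrArg ((hatCounit P.right).map n (-1))
      (initial_to_mu init ((twisting hR).obj P) n)).trans (hatCounit_mu_twisted P (hR P) n))

theorem exists_twistingLift {X : Curv.{u}} {P : Under cAinf.{u}}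
    (f : (forgetful init).obj X ⟶ P) :
    ∃ g : X ⟶ (twisting hR).obj P, (forgetful init).map g ≫ twistingCounit init hR P = f := by
  obtain ⟨F, hκ, hF, e⟩ := exists_hatLift X.isCurv (show X.Q ⟶ P.right from f.right) (underMu_d P)
    (forgetful_hom_mu init f)
  exact ⟨⟨F, hκ.trans (twistedKappa_eq P).symm, hF⟩, Under.UnderMorphism.ext e⟩

theorem twistingLift_unique {X : Curv.{u}} {P : Under cAinf.{u}}
    {g g' : X ⟶ (twisting hR).obj P}
    (e : (forgetful init).map g ≫ twistingCounit init hR P =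
      (forgetful init).map g' ≫ twistingCounit init hR P) : g = g' :=
  Curv.Hom.ext (hatLift_unique X.isCurv (hat_isCurv (underMu_d P))
    (g.map_κ.trans (twistedKappa_eq P)) (g'.map_κ.trans (twistedKappa_eq P)) g.map_mem g'.map_mem
    (congrArg (fun k => k.right) e))

theorem twistingCounit_naturality {P P' : Under cAinf.{u}} (f : P ⟶ P') :
    (forgetful init).map ((twisting hR).map f) ≫ twistingCounit init hR P' =
      twistingCounit init hR P ≫ f :=
  Under.UnderMorphism.ext rfl

/-- The correspondence between morphisms which defines the adjunction. -/
noncomputable def twistingEquiv (X : Curv.{u}) (P : Under cAinf.{u}) :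
    ((forgetful init).obj X ⟶ P) ≃ (X ⟶ (twisting hR).obj P) where
  toFun f := (exists_twistingLift init hR f).choose
  invFun g := (forgetful init).map g ≫ twistingCounit init hR P
  left_inv f := (exists_twistingLift init hR f).choose_spec
  right_inv _ := twistingLift_unique init hR (exists_twistingLift init hR _).choose_spec

/-- The forgetful functor is left adjoint to the twisting functor. -/
noncomputable def twistingAdjunction : forgetful init ⊣ twisting hR :=
  Adjunction.mkOfHomEquiv
    { homEquiv := twistingEquiv init hR
      homEquiv_naturality_left_symm := fun f g => by
        change (forgetful init).map (f ≫ g) ≫ _ = (forgetful init).map f ≫ (forgetful init).map g ≫ _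
        rw [Functor.map_comp, Category.assoc]
      homEquiv_naturality_right := fun {X Y Y'} f g => by
        -- The inverse bijection is given by an explicit formula; after applying it, the claim is
        -- the naturality of the counit.
        refine (twistingEquiv init hR X Y').symm.injective ?_
        rw [Equiv.symm_apply_apply]
        change f ≫ g = (forgetful init).map (_ ≫ _) ≫ _
        rw [Functor.map_comp, Category.assoc, twistingCounit_naturality, ← Category.assoc]
        exact congrArg (· ≫ g) ((twistingEquiv init hR X Y).symm_apply_apply f).symm }

theorem twistingAdjunction_counit (P : Under cAinf.{u}) :
    ((twistingAdjunction init hR).counit.app P).right = hatCounit P.right := by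
  have e : (twistingAdjunction init hR).counit.app P =
      (forgetful init).map (𝟙 _) ≫ twistingCounit init hR P := by
    simp [twistingAdjunction, Adjunction.mkOfHomEquiv, twistingEquiv]
  rw [e]
  rfl

end Adjunction

end CurvedOperad

theorem theorem1p5 :
    ∃ (hA : IsCurv cAinf.{u} (cAinf.mu 0) cAinf.sub)
      (init : Limits.IsInitial (cAinfCurv hA))
      (hR : ∀ P : Under cAinf.{u},
        IsCurv P.right.hat (twistedKappa P) (hatAlpha P.right.toGrOperad))
      (adj : forgetful init ⊣ twisting hR),
      ∀ P : Under cAinf.{u}, (adj.counit.app P).right = hatCounit P.right :=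
  ⟨cAinf_isCurv, cAinfInitial _, twisted_isCurv, twistingAdjunction _ _,
    twistingAdjunction_counit _ _⟩
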